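/- Let $k$ be an algebraically closed field of characteristic $0$. Let $s_1,s_2\in k$ with $27-18s_1s_2-s_1^2s_2^2+4s_1^3+4s_2^3\neq 0$, let $K=k(X,Y)$ be the genus 2 function field given by $$Y^2=X^6-s_1X^4+s_2X^2-1,$$ and put $u=s_1s_2$, $v=s_1^3+s_2^3$. Let $E_1=k(X^2,Y)$ and $E_2=k(X^2,YX)$. An *elliptic subfield of degree 2* of $K$ is an intermediate field $F$ of $K/k$ with $[K:F]=2$ that is the function field of an elliptic curve over $k$. Function fields $F,F'$ of elliptic curves over $k$ are called *$n$-isogenous* if there is an isogeny of degree $n$ between the curves, i.e. a $k$-embedding $F'\to F$ over whose image $F$ has degree $n$. Two subfields of $K$ are conjugate if some element of $\mathrm{Aut}(K/k)$ carries one to the other. $D_n$ is the dihedral group of order $2n$. Then: 1. $E_1$ and $E_2$ are elliptic subfields of degree 2 of $K$, and their $j$-invariants $j_1,j_2$ are the roots, with multiplicity, of the quadratic $$j^2+256\,\frac{2u^3-54u^2+9uv-v^2+27v}{u^2+18u-4v-27}\,j+65536\,\frac{(u^2+9u-3v)^3}{(u^2+18u-4v-27)^2}=0 .$$ 2. $j_1=j_2$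 if and only if $(v^2-4u^3)(v-9u+27)=0$. Likewise $E_1$ and $E_2$ are isomorphic over $k$ if and only if $(v^2-4u^3)(v-9u+27)=0$. 3. $E_1$ and $E_2$ are 3-isogenous if and only if $(4v-u^2+110u-1125)\,g_1(u,v)\,g_2(u,v)=0$, where $$\begin{aligned}g_1={}&256u^7-27008u^6-2432u^5v-1941120u^5+387712u^4v+7296u^3v^2-34553439u^4+16274844u^3v\\&-1720730u^2v^2-6692uv^3+v^4-116158860u^3+127753092u^2v-33416676uv^2+2419308v^3\\&+1018668150u^2-483963660uv+52621974v^2-1755067500u+381631500v+922640625,\end{aligned}$$ $$\begin{aligned}g_2={}&256u^9+80368u^8-3456u^7v+6848224u^7-998848u^6v+17032u^5v^2+291350448u^6-77908736u^5v\\&+4749840u^4v^2-35872u^3v^3-u^2v^4+5341019904u^5-2454612480u^4v+307234984u^3v^2\\&-10535040u^2v^3+26478uv^4+4v^5+27502903296u^4-23429955456u^3v+5455334016u^2v^2\\&-419583744uv^3+9516699v^4-108737593344u^3+28808773632u^2v+3503554560uv^2\\&-826436736v^3+82556485632u^2+41278242816uv-12123095040v^2-41278242816v.\end{aligned}$$ If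 $\mathrm{Aut}(K/k)\cong D_6$, then $4v-u^2+110u-1125=0$, and $E_1$ and $E_2$ are 3-isogenous. 4. $E_1$ and $E_2$ are 2-isogenous if and only if $f_1(u,v)\,f_2(u,v)=0$, where $$\begin{aligned}f_1={}&256u^5+801u^4-1744u^3v-140076u^3+18360u^2v+3312uv^2-16v^3-1296162u^2\\&+707616uv-81216v^2+3805380u-892296v-2460375,\end{aligned}$$ $$\begin{aligned}f_2={}&4096u^7+256016u^6-45824u^5v+4736016u^5-2126736u^4v+163840u^3v^2+256u^2v^3+23158143u^4\\&-25451712u^3v+5291136u^2v^2-179712uv^3-1024v^4-119745540u^3-48166488u^2v\\&+35831808uv^2-4036608v^3-2390500350u^2+1113270480uv-122250384v^2\\&+9300217500u-1791153000v-8303765625.\end{aligned}$$ 5. If $\mathrm{Aut}(K/k)\cong D_4$, then there are exactly two $\mathrm{Aut}(K/k)$-conjugacy classes of elliptic subfields of degree 2 of $K$, and any two non-conjugate elliptic subfields of degree 2 are 2-isogenous. -/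

import Mathlib

/-- `F` is, over `k`, the function field of an elliptic curve with `j`-invariant `j`. -/
def HasJInvariant (k F : Type*) [Field k] [Field F] [Algebra k F] (j : k) : Prop :=
  ∃ (W : WeierstrassCurve k) (_ : W.IsElliptic),
    W.j = j ∧ Nonempty (F ≃ₐ[k] W.toAffine.FunctionField)

/-- `F` is an elliptic subfield of degree 2 of `K / k`: the extension `K / F` has degree 2 and `F` is
the function field of an elliptic curve over `k`. -/
def IsEllipticSubfieldDegTwo {k K : Type*} [Field k] [Field K] [Algebra k K]
    (F : IntermediateField k K) : Prop :=
  Module.finrank F K = 2 ∧ ∃ j : k, HasJInvariant k F j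

/-- Two subfields of `K / k` are conjugate under `Aut (K / k)`. -/
def AreConjugate {k K : Type*} [Field k] [Field K] [Algebra k K]
    (F F' : IntermediateField k K) : Prop :=
  ∃ σ : K ≃ₐ[k] K, F.map (σ : K →ₐ[k] K) = F'

/-- For function fields `F`, `F'` of elliptic curves `E`, `E'` over an algebraically closed field
`k`: there is an isogeny `E → E'` of degree `n`.  Nonconstant morphisms `E → E'` are the same as
`k`-embeddings `F' → F`, the degree is the degree of `F` over the image, and every nonconstant
morphism becomes an isogeny of the same degree after a translation. -/
def IsogenousOfDegree (k F F' : Type*) [Field k] [Field F] [Field F'] [Algebra k F] [Algebra k F']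
    (n : ℕ) : Prop :=
  ∃ φ : F' →ₐ[k] F, Module.finrank φ.fieldRange F = n

/-- The first paired elliptic subfield, `k(X², Y)`. -/
def ellipticSubfieldOne (k : Type*) {K : Type*} [Field k] [Field K] [Algebra k K] (X Y : K) :
    IntermediateField k K :=
  IntermediateField.adjoin k {X ^ 2, Y}

/-- The second paired elliptic subfield, `k(X², Y X)`. -/
def ellipticSubfieldTwo (k : Type*) {K : Type*} [Field k] [Field K] [Algebra k K] (X Y : K) :
    IntermediateField k K :=
  IntermediateField.adjoin k {X ^ 2, Y * X}

/-- The polynomial `g₁(u, v)` of the 3-isogeny condition. -/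
def gOne {k : Type*} [Field k] (u v : k) : k :=
  256 * u ^ 7 - 27008 * u ^ 6 - 2432 * u ^ 5 * v - 1941120 * u ^ 5 + 387712 * u ^ 4 * v +
    7296 * u ^ 3 * v ^ 2 - 34553439 * u ^ 4 + 16274844 * u ^ 3 * v - 1720730 * u ^ 2 * v ^ 2 -
    6692 * u * v ^ 3 + v ^ 4 - 116158860 * u ^ 3 + 127753092 * u ^ 2 * v -
    33416676 * u * v ^ 2 + 2419308 * v ^ 3 + 1018668150 * u ^ 2 - 483963660 * u * v +
    52621974 * v ^ 2 - 1755067500 * u + 381631500 * v + 922640625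

/-- The polynomial `g₂(u, v)` of the 3-isogeny condition. -/
def gTwo {k : Type*} [Field k] (u v : k) : k :=
  256 * u ^ 9 + 80368 * u ^ 8 - 3456 * u ^ 7 * v + 6848224 * u ^ 7 - 998848 * u ^ 6 * v +
    17032 * u ^ 5 * v ^ 2 + 291350448 * u ^ 6 - 77908736 * u ^ 5 * v +
    4749840 * u ^ 4 * v ^ 2 - 35872 * u ^ 3 * v ^ 3 - u ^ 2 * v ^ 4 + 5341019904 * u ^ 5 -
    2454612480 * u ^ 4 * v + 307234984 * u ^ 3 * v ^ 2 - 10535040 * u ^ 2 * v ^ 3 +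
    26478 * u * v ^ 4 + 4 * v ^ 5 + 27502903296 * u ^ 4 - 23429955456 * u ^ 3 * v +
    5455334016 * u ^ 2 * v ^ 2 - 419583744 * u * v ^ 3 + 9516699 * v ^ 4 -
    108737593344 * u ^ 3 + 28808773632 * u ^ 2 * v + 3503554560 * u * v ^ 2 -
    826436736 * v ^ 3 + 82556485632 * u ^ 2 + 41278242816 * u * v - 12123095040 * v ^ 2 -
    41278242816 * v

/-- The polynomial `f₁(u, v)` of the 2-isogeny condition. -/
def fOne {k : Type*} [Field k] (u v : k) : k :=
  256 * u ^ 5 + 801 * u ^ 4 - 1744 * u ^ 3 * v - 140076 * u ^ 3 + 18360 * u ^ 2 * v +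
    3312 * u * v ^ 2 - 16 * v ^ 3 - 1296162 * u ^ 2 + 707616 * u * v - 81216 * v ^ 2 +
    3805380 * u - 892296 * v - 2460375

/-- The polynomial `f₂(u, v)` of the 2-isogeny condition. -/
def fTwo {k : Type*} [Field k] (u v : k) : k :=
  4096 * u ^ 7 + 256016 * u ^ 6 - 45824 * u ^ 5 * v + 4736016 * u ^ 5 - 2126736 * u ^ 4 * v +
    163840 * u ^ 3 * v ^ 2 + 256 * u ^ 2 * v ^ 3 + 23158143 * u ^ 4 - 25451712 * u ^ 3 * v +
    5291136 * u ^ 2 * v ^ 2 - 179712 * u * v ^ 3 - 1024 * v ^ 4 - 119745540 * u ^ 3 -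
    48166488 * u ^ 2 * v + 35831808 * u * v ^ 2 - 4036608 * v ^ 3 - 2390500350 * u ^ 2 +
    1113270480 * u * v - 122250384 * v ^ 2 + 9300217500 * u - 1791153000 * v - 8303765625

/-!
The function field of a curve `y² = f(x)` with `f` squarefree has a universal property
(`IsHyperellipticModel.exists_algHom`): an embedding into a field `M` is a solution of the equation
in `M` with transcendental abscissa. The fields `K`, `E₁` and `E₂` are all of this form, and each
claim becomes a claim about solutions of such equations.

*Isogenies of degree two and three.* Points of an elliptic curve over `k(x)` are constant, because
four members of a nonconstant pencil of polynomials cannot all be squares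
(`Polynomial.natDegree_eq_zero_of_pencil_sq`). Thus, for a point `S` over the function field of
`y² = f(x)` with involution `ι : y ↦ -y`, the sum `S + ι S` is constant, and an embedding of
elliptic function fields can be composed with a translation so that it commutes with `y ↦ -y`
(`IsHyperellipticModel.exists_anti_invariant`). It is then given by a rational function `p / q` of
`x` with `q (p - e₁ q) (p - e₂ q) (p - e₃ q) = f R²` (`IsIsogenyData`). Counting degrees in this
equation determines the ramification of `p / q`. In degree one it shows that the `j`-invariant
classifies elliptic function fields (`HasJInvariant.nonempty_algEquiv_iff`). In degrees two and
three it leaves one explicit family (`IsIsogenyData.exists_of_two`,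
`IsIsogenyData.exists_of_three`), whose pairs of `j`-invariants are rational functions of a
Hauptmodul. Eliminating the latter by a resultant gives the classical modular polynomials
(`HasJInvariant.isogenousOfDegree_two_iff`, `HasJInvariant.isogenousOfDegree_three_iff`).

*The two elliptic subfields.* The fields `E₁` and `E₂` are the fixed fields of `σ : X ↦ -X, Y ↦ Y`
and of `ι σ`, and have Weierstrass equations with right-hand sides `t³ - s₁ t² + s₂ t - 1` and
`t³ - s₂ t² + s₁ t - 1`. The modular polynomials at their `j`-invariants (`subcoverJ`) factor as
stated (`modularTwo_subcoverJ`, `modularThree_subcoverJ`).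

*Automorphism group `D₄`.* A subfield of index two is the fixed field of an involution. The fixed
field `k(X)` of `ι` is not elliptic (`not_hasJInvariant_adjoin_simple`), hence `ι` is conjugate
neither to `σ` nor to `ι σ`, and must be central. Then `σ` and `ι σ` are conjugate, which makes the
sextic symmetric, `s₁ = s₂`, after a rescaling of `X` (`IsHyperellipticModel.exists_symmetric`). The
elliptic subfields are the fixed fields of the noncentral involutions; these form the two conjugacy
classes of `σ` and of `μ : X ↦ -1 / X`, and the `j`-invariants of the fixed fields of `σ` and `μ`
satisfy the modular equation of level two (`IsHyperellipticModel.exists_hasJInvariant_symmetric`).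

*Automorphism group `D₆`.* The involution `ι` is central, for otherwise it has a conjugate `ι'` such
that `ι ι'` has order three. But `ι ι'` acts on the generic points of `E₁` and `E₂` by translations,
and these turn out to be translations by points that are both `2`- and `3`-torsion
(`IsHyperellipticModel.conj_eq_one_of_pow_three`). Hence an automorphism of order three inverted by
`σ` acts on `X` by a fractional linear transformation `X ↦ (X + b) / (1 + c X)` with `b c = -3`, and
the vanishing of the odd coefficients of the transformed sextic is the relation between `u` and `v`
(`eq_zero_of_sextic_invariant`).
-/

/-! ### Square classes of polynomials -/

section SquareParts

open Polynomial

variable {k : Type*} [Field k]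

/-- Every nonzero polynomial over a field is a square times a squarefree polynomial. -/
theorem Polynomial.exists_sq_mul_squarefree (a : k[X]) (ha : a ≠ 0) :
    ∃ b c : k[X], a = c * b ^ 2 ∧ Squarefree c := by
  induction hn : a.natDegree using Nat.strong_induction_on generalizing a with
  | _ n ih =>
    by_cases hs : Squarefree a
    · exact ⟨1, a, by simp, hs⟩
    · simp only [Squarefree, not_forall] at hs
      obtain ⟨x, ⟨d, hd⟩, hx⟩ := hs
      have hx0 : x ≠ 0 := by rintro rfl; simp at hd; exact ha hd
      have hd0 : d ≠ 0 := by rintro rfl; simp at hd; exact ha hd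
      have hxd : 0 < x.natDegree := by
        rw [Nat.pos_iff_ne_zero]; intro h
        exact hx ((Polynomial.isUnit_iff_degree_eq_zero).2
          (by rw [degree_eq_natDegree hx0, h]; rfl))
      have hdeg : d.natDegree < n := by
        rw [← hn, hd, natDegree_mul (mul_ne_zero hx0 hx0) hd0, natDegree_mul hx0 hx0]; omega
      obtain ⟨b, c, hbc, hc⟩ := ih _ hdeg d hd0 rfl
      exact ⟨x * b, c, by rw [hd, hbc]; ring, hc⟩

theorem Squarefree.dvd_of_mul_sq_eq_mul_sq {c d x y : k[X]} (hc : Squarefree c)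
    (hx : x ≠ 0) (h : c * x ^ 2 = d * y ^ 2) : y ∣ x := by
  classical
  obtain ⟨x', hx'⟩ := EuclideanDomain.gcd_dvd_left x y
  obtain ⟨y', hy'⟩ := EuclideanDomain.gcd_dvd_right x y
  have hab := EuclideanDomain.gcd_eq_gcd_ab x y
  generalize EuclideanDomain.gcd x y = g at hx' hy' hab
  generalize EuclideanDomain.gcdA x y = a at hab
  generalize EuclideanDomain.gcdB x y = b at hab
  have hg : g ≠ 0 := fun h0 => hx (by rw [hx', h0, zero_mul])
  have hco : IsCoprime x' y' := ⟨a, b, mul_left_cancel₀ hg (by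
    rw [hx', hy'] at hab; linear_combination -hab)⟩
  have h' : c * x' ^ 2 = d * y' ^ 2 := by
    refine mul_left_cancel₀ (pow_ne_zero 2 hg) ?_
    rw [hx', hy'] at h; linear_combination h
  have hdvd : y' ^ 2 ∣ c := by
    have h1 : y' ^ 2 ∣ c * x' ^ 2 := ⟨d, by rw [h']; ring⟩
    exact (hco.symm.pow (m := 2) (n := 2)).dvd_of_dvd_mul_right h1
  have hy1 : IsUnit y' := hc y' (by rwa [← sq])
  rw [hx', hy']
  exact mul_dvd_mul_left _ hy1.dvd

/-- The squarefree part of a nonzero polynomial is unique up to a constant. -/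
theorem Polynomial.exists_C_mul_of_mul_sq_eq_mul_sq {c d x y : k[X]} (hc : Squarefree c)
    (hd : Squarefree d) (hx : x ≠ 0) (hy : y ≠ 0) (h : c * x ^ 2 = d * y ^ 2) :
    ∃ u : k, u ≠ 0 ∧ c = C u * d := by
  obtain ⟨v, hv⟩ := associated_of_dvd_dvd (hd.dvd_of_mul_sq_eq_mul_sq hy h.symm)
    (hc.dvd_of_mul_sq_eq_mul_sq hx h)
  obtain ⟨w, hw, hwv⟩ := Polynomial.isUnit_iff.1 v.isUnit
  refine ⟨w ^ 2, pow_ne_zero 2 hw.ne_zero, ?_⟩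
  have h2 : x ^ 2 * c = x ^ 2 * (C (w ^ 2) * d) := by
    rw [mul_comm, h, ← hv, ← hwv, C_pow]; ring
  exact mul_left_cancel₀ (pow_ne_zero 2 hx) h2

/-- If a product of four pairwise coprime polynomials is a squarefree polynomial `f` times a
square, then `f` is distributed over the four factors, each of which is its share times a square. -/
theorem Polynomial.exists_squarefree_parts {a₀ a₁ a₂ a₃ f R : k[X]} (h₀₁ : IsCoprime a₀ a₁)
    (h₀₂ : IsCoprime a₀ a₂) (h₀₃ : IsCoprime a₀ a₃) (h₁₂ : IsCoprime a₁ a₂)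
    (h₁₃ : IsCoprime a₁ a₃) (h₂₃ : IsCoprime a₂ a₃) (hf : Squarefree f) (hR : R ≠ 0)
    (h : a₀ * a₁ * a₂ * a₃ = f * R ^ 2) :
    ∃ f₀ f₁ f₂ f₃ b₀ b₁ b₂ b₃ : k[X], a₀ = f₀ * b₀ ^ 2 ∧ a₁ = f₁ * b₁ ^ 2 ∧ a₂ = f₂ * b₂ ^ 2 ∧
      a₃ = f₃ * b₃ ^ 2 ∧ ∃ u : k, u ≠ 0 ∧ f₀ * f₁ * f₂ * f₃ = C u * f := by
  have hne : a₀ * a₁ * a₂ * a₃ ≠ 0 := h ▸ mul_ne_zero hf.ne_zero (pow_ne_zero 2 hR)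
  have hne3 := right_ne_zero_of_mul hne
  have hne2 := right_ne_zero_of_mul (left_ne_zero_of_mul hne)
  have hne1 := right_ne_zero_of_mul (left_ne_zero_of_mul (left_ne_zero_of_mul hne))
  have hne0 := left_ne_zero_of_mul (left_ne_zero_of_mul (left_ne_zero_of_mul hne))
  obtain ⟨b₀, f₀, e0, s0⟩ := exists_sq_mul_squarefree a₀ hne0
  obtain ⟨b₁, f₁, e1, s1⟩ := exists_sq_mul_squarefree a₁ hne1
  obtain ⟨b₂, f₂, e2, s2⟩ := exists_sq_mul_squarefree a₂ hne2
  obtain ⟨b₃, f₃, e3, s3⟩ := exists_sq_mul_squarefree a₃ hne3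
  refine ⟨f₀, f₁, f₂, f₃, b₀, b₁, b₂, b₃, e0, e1, e2, e3, ?_⟩
  have hsub : ∀ {a b f g x y : k[X]}, IsCoprime a b → a = f * x ^ 2 → b = g * y ^ 2 →
      IsCoprime f g := by
    rintro a b f g x y hab rfl rfl
    exact (hab.of_mul_left_left).of_mul_right_left
  have c01 := hsub h₀₁ e0 e1
  have c02 := hsub h₀₂ e0 e2
  have c03 := hsub h₀₃ e0 e3
  have c12 := hsub h₁₂ e1 e2
  have c13 := hsub h₁₃ e1 e3
  have c23 := hsub h₂₃ e2 e3
  have hsq : Squarefree (f₀ * f₁ * f₂ * f₃) := by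
    refine squarefree_mul_iff.2 ⟨((c03.mul_left c13).mul_left c23).isRelPrime, ?_, s3⟩
    refine squarefree_mul_iff.2 ⟨(c02.mul_left c12).isRelPrime, ?_, s2⟩
    exact squarefree_mul_iff.2 ⟨c01.isRelPrime, s0, s1⟩
  refine exists_C_mul_of_mul_sq_eq_mul_sq hsq hf (x := b₀ * b₁ * b₂ * b₃) (y := R) ?_ hR ?_
  · rintro h0
    apply hne
    rw [e0, e1, e2, e3]
    linear_combination (f₀ * f₁ * f₂ * f₃ * (b₀ * b₁ * b₂ * b₃)) * h0
  · rw [← h, e0, e1, e2, e3]; ring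

theorem Polynomial.dvd_wronskian_left {a b f x : k[X]} (h : a = f * x ^ 2) :
    x ∣ wronskian a b := by
  rw [wronskian, h]
  refine dvd_sub ⟨f * x * derivative b, by ring⟩ ?_
  refine ⟨(derivative f * x + f * 2 * derivative x) * b, ?_⟩
  simp only [derivative_mul, derivative_pow, Nat.cast_ofNat]
  rw [show (C 2 : k[X]) = 2 from rfl]
  ring

/-- Distinct members of a pencil spanned by coprime polynomials are coprime. -/
theorem IsCoprime.pencil {p q : k[X]} (h : IsCoprime p q) {e e' : k} (he : e ≠ e') :
    IsCoprime (p - C e * q) (p - C e' * q) := by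
  obtain ⟨a, b, hab⟩ := h
  have hC : C (e' - e)⁻¹ * (C e' - C e) = (1 : k[X]) := by
    rw [← C_sub, ← C_mul, inv_mul_cancel₀ (sub_ne_zero.2 he.symm), C_1]
  refine ⟨C (e' - e)⁻¹ * (C e' * a + b), -C (e' - e)⁻¹ * (C e * a + b), ?_⟩
  linear_combination hab + hC * (a * p + b * q)

theorem IsCoprime.pencil_left {p q : k[X]} (h : IsCoprime p q) (e : k) :
    IsCoprime q (p - C e * q) := by
  have := h.symm.add_mul_right_right (-C e)
  rwa [show p + -C e * q = p - C e * q by ring] at this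

/-- Four distinct members of a nonconstant pencil of polynomials in characteristic zero cannot all
be squares: the Wronskian of the pencil is divisible by all four square roots, which contradicts
the bound on its degree. -/
theorem Polynomial.natDegree_eq_zero_of_pencil_sq [CharZero k] {p q R : k[X]} {e₁ e₂ e₃ : k}
    (hpq : IsCoprime p q) (h₁₂ : e₁ ≠ e₂) (h₁₃ : e₁ ≠ e₃) (h₂₃ : e₂ ≠ e₃) (hq : q ≠ 0)
    (h : q * (p - C e₁ * q) * (p - C e₂ * q) * (p - C e₃ * q) = R ^ 2) :
    p.natDegree = 0 ∧ q.natDegree = 0 := by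
  by_cases hR : R = 0
  · have key : ∀ e : k, p - C e * q = 0 → p.natDegree = 0 ∧ q.natDegree = 0 := by
      intro e he
      have hp : p = C e * q := sub_eq_zero.1 he
      have hu : IsUnit q := hpq.isUnit_of_dvd' ⟨C e, by rw [hp]; ring⟩ dvd_rfl
      have hq0 := natDegree_eq_zero_of_isUnit hu
      refine ⟨?_, hq0⟩
      have := natDegree_C_mul_le e q
      rw [hp]; omega
    rw [hR] at h
    simp only [ne_eq, OfNat.ofNat_ne_zero, not_false_eq_true, zero_pow, mul_eq_zero, hq,
      false_or] at h
    rcases h with (h | h) | h <;> exact key _ h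
  obtain ⟨f₀, f₁, f₂, f₃, b₀, b₁, b₂, b₃, e0, e1, e2, e3, u, hu, hf⟩ :=
    exists_squarefree_parts (hpq.pencil_left e₁) (hpq.pencil_left e₂) (hpq.pencil_left e₃)
      (hpq.pencil h₁₂) (hpq.pencil h₁₃) (hpq.pencil h₂₃) (squarefree_one) hR
      (by rw [h, one_mul])
  by_contra hcon
  have hW : wronskian p q ≠ 0 := by
    intro hW
    obtain ⟨h1, h2⟩ := hpq.wronskian_eq_zero_iff.1 hW
    exact hcon ⟨derivative_eq_zero.1 h1,
      derivative_eq_zero.1 h2⟩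
  have hWq : ∀ e : k, wronskian (p - C e * q) q = wronskian p q := by
    intro e; simp only [wronskian, derivative_sub, derivative_mul, derivative_C]; ring
  have hWh : wronskian (p - C e₂ * q) (p - C e₃ * q) = C (e₂ - e₃) * wronskian p q := by
    simp only [wronskian, derivative_sub, derivative_mul, derivative_C, C_sub]; ring
  have hlt1 := natDegree_wronskian_lt_add (a := p - C e₁ * q) (b := q) (by rwa [hWq])
  have hlt2 := natDegree_wronskian_lt_add (a := p - C e₂ * q) (b := p - C e₃ * q)
    (by rw [hWh]; exact mul_ne_zero (C_ne_zero.2 (sub_ne_zero.2 h₂₃)) hW)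
  rw [hWq] at hlt1
  rw [hWh, natDegree_C_mul (sub_ne_zero.2 h₂₃)] at hlt2
  have hcop : ∀ {a b f g x y : k[X]}, IsCoprime a b → a = f * x ^ 2 → b = g * y ^ 2 →
      IsCoprime x y := by
    rintro a b f g x y hab rfl rfl
    exact (IsCoprime.pow_iff two_pos two_pos).1 hab.of_mul_left_right.of_mul_right_right
  have c01 := hcop (hpq.pencil_left e₁) e0 e1
  have c02 := hcop (hpq.pencil_left e₂) e0 e2
  have c03 := hcop (hpq.pencil_left e₃) e0 e3
  have c12 := hcop (hpq.pencil h₁₂) e1 e2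
  have c13 := hcop (hpq.pencil h₁₃) e1 e3
  have c23 := hcop (hpq.pencil h₂₃) e2 e3
  have d0 : b₀ ∣ wronskian p q := by
    rw [← neg_neg (wronskian p q), wronskian_neg_eq, dvd_neg]
    exact dvd_wronskian_left e0
  have d1 : b₁ ∣ wronskian p q := hWq e₁ ▸ dvd_wronskian_left e1
  have d2 : b₂ ∣ wronskian p q := hWq e₂ ▸ dvd_wronskian_left e2
  have d3 : b₃ ∣ wronskian p q := hWq e₃ ▸ dvd_wronskian_left e3
  have hd : b₀ * b₁ * b₂ * b₃ ∣ wronskian p q :=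
    ((c03.mul_left c13).mul_left c23).mul_dvd (((c02.mul_left c12)).mul_dvd (c01.mul_dvd d0 d1) d2)
      d3
  have hle := natDegree_le_of_dvd hd hW
  have hRne : q * (p - C e₁ * q) * (p - C e₂ * q) * (p - C e₃ * q) ≠ 0 := by
    rw [h]; exact pow_ne_zero 2 hR
  have n3 := right_ne_zero_of_mul hRne
  have n2 := right_ne_zero_of_mul (left_ne_zero_of_mul hRne)
  have n1 := right_ne_zero_of_mul (left_ne_zero_of_mul (left_ne_zero_of_mul hRne))
  have hfne : f₀ * f₁ * f₂ * f₃ ≠ 0 := by rw [hf, mul_one]; exact C_ne_zero.2 hu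
  have m3 := right_ne_zero_of_mul hfne
  have m2 := right_ne_zero_of_mul (left_ne_zero_of_mul hfne)
  have m1 := right_ne_zero_of_mul (left_ne_zero_of_mul (left_ne_zero_of_mul hfne))
  have m0 := left_ne_zero_of_mul (left_ne_zero_of_mul (left_ne_zero_of_mul hfne))
  have hfdeg : f₀.natDegree + f₁.natDegree + f₂.natDegree + f₃.natDegree = 0 := by
    rw [← natDegree_mul m0 m1, ← natDegree_mul (mul_ne_zero m0 m1) m2,
      ← natDegree_mul (mul_ne_zero (mul_ne_zero m0 m1) m2) m3, hf, mul_one, natDegree_C]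
  have deg : ∀ {a f x : k[X]}, a ≠ 0 → a = f * x ^ 2 →
      x ≠ 0 ∧ a.natDegree = f.natDegree + 2 * x.natDegree := by
    rintro a f x ha rfl
    have hx : x ≠ 0 := by rintro rfl; simp at ha
    exact ⟨hx, by rw [natDegree_mul (left_ne_zero_of_mul ha) (pow_ne_zero 2 hx), natDegree_pow]⟩
  obtain ⟨x0, D0⟩ := deg hq e0
  obtain ⟨x1, D1⟩ := deg n1 e1
  obtain ⟨x2, D2⟩ := deg n2 e2
  obtain ⟨x3, D3⟩ := deg n3 e3
  rw [natDegree_mul (mul_ne_zero (mul_ne_zero x0 x1) x2) x3, natDegree_mul (mul_ne_zero x0 x1) x2,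
    natDegree_mul x0 x1] at hle
  omega

end SquareParts

/-! ### Function fields of hyperelliptic curves -/

section Models

open Polynomial IntermediateField

variable {k F M : Type*} [Field k] [Field F] [Field M] [Algebra k F] [Algebra k M]

/-- `F` is the function field of the affine curve `y² = f(x)`: it is generated over `k` by a
transcendental `x` and a `y` with `y² = f(x)`. -/
structure IsHyperellipticModel (f : k[X]) (x y : F) : Prop where
  transcendental : Transcendental k x
  equation : y ^ 2 = aeval x f
  adjoin_eq_top : adjoin k {x, y} = ⊤

theorem Polynomial.aeval_ne_zero_of_transcendental {x : F} (hx : Transcendental k x) {p : k[X]}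
    (hp : p ≠ 0) : Polynomial.aeval x p ≠ 0 := fun h => hp (transcendental_iff.1 hx p h)

/-- Elements of `k(x)` are quotients of coprime polynomials in `x`. -/
theorem IntermediateField.exists_isCoprime_of_mem_adjoin_simple {x z : F}
    (hx : Transcendental k x) (hz : z ∈ k⟮x⟯) :
    ∃ p q : k[X], IsCoprime p q ∧ q ≠ 0 ∧ z * aeval x q = aeval x p := by
  have hu := RatFunc.algEquivOfTranscendental_apply x hx
    ((RatFunc.algEquivOfTranscendental x hx).symm ⟨z, hz⟩)
  rw [AlgEquiv.apply_symm_apply] at hu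
  generalize (RatFunc.algEquivOfTranscendental x hx).symm ⟨z, hz⟩ = u at hu
  refine ⟨u.num, u.denom, u.isCoprime_num_denom, u.denom_ne_zero, ?_⟩
  rw [eq_div_iff (aeval_ne_zero_of_transcendental hx u.denom_ne_zero)] at hu
  exact hu

/-- If `f` is squarefree, `b ∈ k(x)` and `b² f(x)` is a polynomial in `x`, then `b` is itself a
polynomial in `x`. -/
theorem exists_aeval_eq_of_sq_mul {x b : F} (hx : Transcendental k x) (hb : b ∈ k⟮x⟯)
    {f g : k[X]} (hf : Squarefree f) (h : b ^ 2 * aeval x f = aeval x g) :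
    ∃ R : k[X], b = aeval x R ∧ g = f * R ^ 2 := by
  obtain ⟨p, q, hpq, hq, hz⟩ := exists_isCoprime_of_mem_adjoin_simple hx hb
  have h2 : p ^ 2 * f = q ^ 2 * g := by
    apply transcendental_iff_injective.1 hx
    simp only [map_mul, map_pow]
    rw [← hz, ← h]; ring
  have h3 : q ^ 2 ∣ f := (hpq.symm.pow (m := 2) (n := 2)).dvd_of_dvd_mul_left ⟨g, h2⟩
  obtain ⟨w, hw, hwq⟩ := Polynomial.isUnit_iff.1 (hf q (by rwa [← sq]))
  have hwi : C w⁻¹ * q = 1 := by rw [← hwq, ← C_mul, inv_mul_cancel₀ hw.ne_zero, C_1]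
  have hb' : b = aeval x (C w⁻¹ * p) := by
    rw [map_mul, ← hz, mul_left_comm, ← map_mul, hwi]; simp
  refine ⟨C w⁻¹ * p, hb', ?_⟩
  apply transcendental_iff_injective.1 hx
  rw [← h, hb']; simp only [map_mul, map_pow]; ring

namespace IsHyperellipticModel

variable {f : k[X]} {x y : F}

theorem notMem (h : IsHyperellipticModel f x y) (hf : Squarefree f) (hd : f.natDegree ≠ 0) :
    y ∉ k⟮x⟯ := by
  intro hy
  obtain ⟨R, -, hR⟩ := exists_aeval_eq_of_sq_mul h.transcendental hy (f := 1) (g := f)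
    squarefree_one (by simp [h.equation])
  rw [one_mul] at hR
  have : IsUnit R := hf R ⟨1, by rw [hR]; ring⟩
  apply hd
  rw [hR]
  exact natDegree_eq_zero_of_isUnit (this.pow 2)

theorem aeval_ne_zero (h : IsHyperellipticModel f x y) (hf : f ≠ 0) : aeval x f ≠ 0 :=
  aeval_ne_zero_of_transcendental h.transcendental hf

theorem ne_zero (h : IsHyperellipticModel f x y) (hf : f ≠ 0) : y ≠ 0 := by
  rintro rfl
  exact h.aeval_ne_zero hf (by rw [← h.equation]; simp)

theorem adjoin_adjoin_eq_top (h : IsHyperellipticModel f x y) : k⟮x⟯⟮y⟯ = ⊤ := by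
  rw [← restrictScalars_eq_top_iff (K := k), adjoin_simple_adjoin_simple, h.adjoin_eq_top]

/-- The minimal polynomial of `y` over `k(x)` is `T² - f(x)`. -/
theorem minpoly_eq (h : IsHyperellipticModel f x y) (hf : Squarefree f) (hd : f.natDegree ≠ 0) :
    minpoly k⟮x⟯ y = X ^ 2 - C (aeval (AdjoinSimple.gen k x) f) := by
  have haev : algebraMap k⟮x⟯ F (aeval (AdjoinSimple.gen k x) f) = y ^ 2 := by
    rw [h.equation, ← aeval_algebraMap_apply, AdjoinSimple.algebraMap_gen]
  symm
  apply minpoly.eq_of_irreducible_of_monic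
  · refine X_pow_sub_C_irreducible_of_prime Nat.prime_two fun r hr => ?_
    apply h.notMem hf hd
    have h2 : (algebraMap k⟮x⟯ F r) ^ 2 = y ^ 2 := by
      rw [← haev, ← hr, map_pow]
    rcases sq_eq_sq_iff_eq_or_eq_neg.1 h2 with h3 | h3
    · rw [← h3]; exact r.2
    · rw [← neg_neg y, ← h3]; exact neg_mem r.2
  · simp [haev]
  · exact monic_X_pow_sub_C _ two_ne_zero

theorem isIntegral (h : IsHyperellipticModel f x y) : IsIntegral k⟮x⟯ y := by
  refine ⟨X ^ 2 - C (aeval (AdjoinSimple.gen k x) f), monic_X_pow_sub_C _ two_ne_zero, ?_⟩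
  have haev : algebraMap k⟮x⟯ F (aeval (AdjoinSimple.gen k x) f) = y ^ 2 := by
    rw [h.equation, ← aeval_algebraMap_apply, AdjoinSimple.algebraMap_gen]
  simp [haev]

theorem finrank_eq (h : IsHyperellipticModel f x y) (hf : Squarefree f) (hd : f.natDegree ≠ 0) :
    Module.finrank k⟮x⟯ F = 2 := by
  rw [← finrank_top', ← h.adjoin_adjoin_eq_top, adjoin.finrank h.isIntegral, h.minpoly_eq hf hd,
    natDegree_X_pow_sub_C]

theorem exists_add_mul (h : IsHyperellipticModel f x y) (hf : Squarefree f) (hd : f.natDegree ≠ 0)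
    (z : F) : ∃ a ∈ k⟮x⟯, ∃ b ∈ k⟮x⟯, z = a + b * y := by
  have hz : z ∈ k⟮x⟯⟮y⟯ := by rw [h.adjoin_adjoin_eq_top]; trivial
  rw [← mem_toSubalgebra, adjoin_simple_toSubalgebra_of_isAlgebraic h.isIntegral.isAlgebraic] at hz
  obtain ⟨p, rfl⟩ := (Algebra.adjoin_singleton_eq_range_aeval k⟮x⟯ y) ▸ hz
  have hm : (X ^ 2 - C (aeval (AdjoinSimple.gen k x) f)).Monic := monic_X_pow_sub_C _ two_ne_zero
  have h0 : aeval y (X ^ 2 - C (aeval (AdjoinSimple.gen k x) f)) = 0 := by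
    rw [← h.minpoly_eq hf hd]; exact minpoly.aeval _ _
  have hdeg := natDegree_modByMonic_lt p hm (by
    intro h1
    have := natDegree_X_pow_sub_C (n := 2) (r := aeval (AdjoinSimple.gen k x) f)
    rw [h1] at this; simp at this)
  rw [natDegree_X_pow_sub_C] at hdeg
  have hp : aeval y p = aeval y (p %ₘ (X ^ 2 - C (aeval (AdjoinSimple.gen k x) f))) := by
    conv_lhs => rw [← modByMonic_add_div p (X ^ 2 - C (aeval (AdjoinSimple.gen k x) f))]
    simp only [map_add, map_mul, h0, zero_mul, add_zero]
  generalize p %ₘ (X ^ 2 - C (aeval (AdjoinSimple.gen k x) f)) = r at hdeg hp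
  refine ⟨_, (r.coeff 0).2, _, (r.coeff 1).2, ?_⟩
  change aeval y p = _
  rw [hp]
  conv_lhs => rw [eq_X_add_C_of_natDegree_le_one (Nat.lt_succ_iff.1 hdeg)]
  simp only [map_add, map_mul, aeval_X, aeval_C]
  rw [add_comm]; rfl

/-- Universal property of the function field of `y² = f(x)`. -/
theorem exists_algHom (h : IsHyperellipticModel f x y) (hf : Squarefree f) (hd : f.natDegree ≠ 0)
    {a b : M} (ha : Transcendental k a) (hb : b ^ 2 = aeval a f) :
    ∃ φ : F →ₐ[k] M, φ x = a ∧ φ y = b := by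
  let φ₀ : k⟮x⟯ →ₐ[k] M := (k⟮a⟯.val.comp (RatFunc.algEquivOfTranscendental a ha).toAlgHom).comp
    (RatFunc.algEquivOfTranscendental x h.transcendental).symm.toAlgHom
  have hφ₀ : φ₀ (AdjoinSimple.gen k x) = a := by
    simp [φ₀, RatFunc.algEquivOfTranscendental_symm_gen, RatFunc.algEquivOfTranscendental_X]
  let : Algebra k⟮x⟯ M := φ₀.toRingHom.toAlgebra
  have : IsScalarTower k k⟮x⟯ M := IsScalarTower.of_algebraMap_eq fun r => (φ₀.commutes r).symm
  have hroot : b ∈ (minpoly k⟮x⟯ y).aroots M := by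
    rw [mem_aroots]
    refine ⟨minpoly.ne_zero h.isIntegral, ?_⟩
    rw [h.minpoly_eq hf hd]
    have : algebraMap k⟮x⟯ M (aeval (AdjoinSimple.gen k x) f) = aeval a f := by
      rw [← aeval_algebraMap_apply]
      exact congrArg (fun t => aeval t f) hφ₀
    simp [this, hb]
  let ψ : k⟮x⟯⟮y⟯ →ₐ[k⟮x⟯] M := (algHomAdjoinIntegralEquiv k⟮x⟯ h.isIntegral).symm ⟨b, hroot⟩
  have hψ : ψ (AdjoinSimple.gen k⟮x⟯ y) = b :=
    algHomAdjoinIntegralEquiv_symm_apply_gen k⟮x⟯ h.isIntegral ⟨b, hroot⟩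
  let e : F ≃ₐ[k⟮x⟯] k⟮x⟯⟮y⟯ := ((equivOfEq h.adjoin_adjoin_eq_top).trans topEquiv).symm
  have hy : e y = AdjoinSimple.gen k⟮x⟯ y := rfl
  refine ⟨(ψ.comp e.toAlgHom).restrictScalars k, ?_, ?_⟩
  · have h1 : (ψ.comp e.toAlgHom) (algebraMap k⟮x⟯ F (AdjoinSimple.gen k x)) =
      algebraMap k⟮x⟯ M (AdjoinSimple.gen k x) := AlgHom.commutes _ _
    rw [AdjoinSimple.algebraMap_gen] at h1
    exact h1.trans hφ₀
  · exact (congrArg ψ hy).trans hψ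

theorem algHom_ext (h : IsHyperellipticModel f x y) {φ ψ : F →ₐ[k] M} (hx : φ x = ψ x)
    (hy : φ y = ψ y) : φ = ψ := by
  have h0 : ∀ z : F, z ∈ adjoin k {x, y} → φ z = ψ z := by
    intro z hz
    induction hz using adjoin_induction with
    | mem z hz =>
      rcases hz with rfl | rfl
      · exact hx
      · exact hy
    | algebraMap c => simp
    | add a b _ _ ha hb => rw [map_add, map_add, ha, hb]
    | mul a b _ _ ha hb => rw [map_mul, map_mul, ha, hb]
    | inv a _ ha => rw [map_inv₀, map_inv₀, ha]
  ext z
  exact h0 z (by rw [h.adjoin_eq_top]; trivial)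

end IsHyperellipticModel

end Models

section Models

open Polynomial IntermediateField

variable {k F F' M : Type*} [Field k] [Field F] [Field F'] [Field M] [Algebra k F] [Algebra k F']
  [Algebra k M]

theorem IntermediateField.aeval_mem_of_mem {L : IntermediateField k F} {x : F} (hx : x ∈ L)
    (p : k[X]) : aeval x p ∈ L := by
  rw [show x = L.val ⟨x, hx⟩ from rfl, aeval_algHom_apply]
  exact (aeval (⟨x, hx⟩ : L) p).2

namespace IsHyperellipticModel

variable {f f' : k[X]} {x y : F} {x' y' : F'}

theorem exists_algEquiv (h : IsHyperellipticModel f x y) (h' : IsHyperellipticModel f x' y')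
    (hf : Squarefree f) (hd : f.natDegree ≠ 0) : ∃ e : F ≃ₐ[k] F', e x = x' ∧ e y = y' := by
  obtain ⟨φ, hφx, hφy⟩ := h.exists_algHom hf hd h'.transcendental h'.equation
  obtain ⟨ψ, hψx, hψy⟩ := h'.exists_algHom hf hd h.transcendental h.equation
  refine ⟨AlgEquiv.ofAlgHom φ ψ ?_ ?_, hφx, hφy⟩
  · exact h'.algHom_ext (by simp [hφx, hψx]) (by simp [hφy, hψy])
  · exact h.algHom_ext (by simp [hφx, hψx]) (by simp [hφy, hψy])

theorem map_algEquiv (h : IsHyperellipticModel f x y) (e : F ≃ₐ[k] F') :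
    IsHyperellipticModel f (e x) (e y) where
  transcendental := fun ha =>
    h.transcendental ((isAlgebraic_algHom_iff (e : F →ₐ[k] F') e.injective).1 ha)
  equation := by
    rw [← map_pow, h.equation]
    exact (aeval_algHom_apply (e : F →ₐ[k] F') x f).symm
  adjoin_eq_top := by
    have h1 := congrArg (IntermediateField.map (e : F →ₐ[k] F')) h.adjoin_eq_top
    rw [adjoin_map, Set.image_pair] at h1
    refine h1.trans ?_
    rw [← AlgHom.fieldRange_eq_map]
    exact (AlgHom.fieldRange_eq_top).2 e.surjective

theorem neg (h : IsHyperellipticModel f x y) : IsHyperellipticModel f x (-y) where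
  transcendental := h.transcendental
  equation := by rw [neg_sq, h.equation]
  adjoin_eq_top := by
    rw [eq_top_iff, ← h.adjoin_eq_top, adjoin_le_iff]
    rintro z (rfl | rfl)
    · exact subset_adjoin _ _ (by simp)
    · rw [← neg_neg z]
      exact neg_mem (subset_adjoin _ _ (by simp))

theorem exists_involution (h : IsHyperellipticModel f x y) (hf : Squarefree f)
    (hd : f.natDegree ≠ 0) : ∃ e : F ≃ₐ[k] F, e x = x ∧ e y = -y :=
  h.exists_algEquiv h.neg hf hd

theorem algHom_eq_of_mem {φ ψ : F →ₐ[k] M} (hx : φ x = ψ x) {z : F}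
    (hz : z ∈ k⟮x⟯) : φ z = ψ z := by
  induction hz using adjoin_induction with
  | mem z hz => rw [Set.mem_singleton_iff.1 hz, hx]
  | algebraMap c => simp
  | add a b _ _ ha hb => rw [map_add, map_add, ha, hb]
  | mul a b _ _ ha hb => rw [map_mul, map_mul, ha, hb]
  | inv a _ ha => rw [map_inv₀, map_inv₀, ha]

theorem algEquiv_apply_of_mem {e : F ≃ₐ[k] F} (hx : e x = x) {z : F} (hz : z ∈ k⟮x⟯) : e z = z :=
  algHom_eq_of_mem (φ := (e : F →ₐ[k] F)) (ψ := AlgHom.id k F) hx hz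

theorem exists_of_involution [CharZero k] (h : IsHyperellipticModel f x y) (hf : Squarefree f)
    (hd : f.natDegree ≠ 0) {e : F ≃ₐ[k] F} (hx : e x = x) (hy : e y = -y) (z : F) :
    (e z = z → z ∈ k⟮x⟯) ∧ (e z = -z → ∃ b ∈ k⟮x⟯, z = b * y) := by
  have : CharZero F := charZero_of_injective_algebraMap (algebraMap k F).injective
  obtain ⟨a, ha, b, hb, rfl⟩ := h.exists_add_mul hf hd z
  rw [map_add, map_mul, algEquiv_apply_of_mem hx ha, algEquiv_apply_of_mem hx hb, hy]
  refine ⟨fun h1 => ?_, fun h1 => ⟨b, hb, ?_⟩⟩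
  · have : b * y = 0 := by
      have : 2 * (b * y) = 0 := by linear_combination -h1
      simpa using this
    rwa [this, add_zero]
  · have : a = 0 := by
      have : 2 * a = 0 := by linear_combination h1
      simpa using this
    rw [this, zero_add]

/-- The subfield generated by `x` and `y` is modelled by any equation between them. -/
theorem of_adjoin {x y : F} (hx : Transcendental k x) (he : y ^ 2 = aeval x f)
    {L : IntermediateField k F} (hL : L = adjoin k {x, y}) (hxL : x ∈ L) (hyL : y ∈ L) :
    IsHyperellipticModel f (⟨x, hxL⟩ : L) (⟨y, hyL⟩ : L) where
  transcendental := by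
    intro h
    exact hx (h.algHom L.val)
  equation := by
    apply Subtype.ext
    have := aeval_algHom_apply L.val ⟨x, hxL⟩ f
    change y ^ 2 = L.val _
    rw [← this, he]; rfl
  adjoin_eq_top := by
    apply lift_injective
    rw [lift_adjoin, lift_top, Set.image_pair]
    exact hL.symm

/-- The degree of the extension given by an embedding of hyperelliptic function fields which maps
`x'` to a rational function of `x` is the degree of this rational function. -/
theorem finrank_fieldRange (h : IsHyperellipticModel f x y) (h' : IsHyperellipticModel f' x' y')
    (hf : Squarefree f) (hd : f.natDegree ≠ 0) (hf' : Squarefree f') (hd' : f'.natDegree ≠ 0)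
    (φ : F' →ₐ[k] F) {p q : k[X]} (hpq : IsCoprime p q) (hq : q ≠ 0)
    (hx : φ x' * aeval x q = aeval x p) :
    Module.finrank φ.fieldRange F = max p.natDegree q.natDegree := by
  have hqx := aeval_ne_zero_of_transcendental h.transcendental hq
  let e := RatFunc.algEquivOfTranscendental x h.transcendental
  let ψ : RatFunc k →ₐ[k] F := k⟮x⟯.val.comp e.toAlgHom
  have hψ : ∀ u : RatFunc k, ψ u = aeval x u.num / aeval x u.denom :=
    RatFunc.algEquivOfTranscendental_apply x h.transcendental
  have hA : φ x' ∈ k⟮x⟯ := (mem_adjoin_simple_iff _ _).2 ⟨p, q, (eq_div_iff hqx).2 hx⟩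
  obtain ⟨u, hu⟩ : ∃ u, ψ u = φ x' := ⟨e.symm ⟨_, hA⟩, by simp [ψ]⟩
  have hrange : ψ.fieldRange = k⟮x⟯ := by
    ext z; constructor
    · rintro ⟨u, rfl⟩; exact (e u).2
    · intro hz; exact ⟨e.symm ⟨z, hz⟩, by simp [ψ]⟩
  have hle : k⟮φ x'⟯ ≤ k⟮x⟯ := by rwa [adjoin_simple_le_iff]
  have hle' : k⟮φ x'⟯ ≤ φ.fieldRange := by rw [adjoin_simple_le_iff]; exact ⟨x', rfl⟩
  have h1 : relfinrank k⟮φ x'⟯ φ.fieldRange = 2 := by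
    rw [AlgHom.fieldRange_eq_map, ← Set.image_singleton, ← adjoin_map, relfinrank_map_map,
      relfinrank_top_right, h'.finrank_eq hf' hd']
  have hdeg : max u.num.natDegree u.denom.natDegree = max p.natDegree q.natDegree := by
    have hden := aeval_ne_zero_of_transcendental h.transcendental u.denom_ne_zero
    have hmul : u.num * q = p * u.denom := by
      apply transcendental_iff_injective.1 h.transcendental
      rw [map_mul, map_mul, ← hx, ← hu, hψ]; field_simp
    have hc := u.isCoprime_num_denom
    have a1 : Associated u.num p := associated_of_dvd_dvd
      (hc.dvd_of_dvd_mul_right ⟨q, hmul.symm⟩) (hpq.dvd_of_dvd_mul_right ⟨u.denom, hmul⟩)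
    have a2 : Associated u.denom q := associated_of_dvd_dvd
      (hc.symm.dvd_of_dvd_mul_left ⟨p, by rw [hmul, mul_comm]⟩)
      (hpq.symm.dvd_of_dvd_mul_left ⟨u.num, by rw [← hmul, mul_comm]⟩)
    rw [natDegree_eq_of_degree_eq (degree_eq_degree_of_associated a1),
      natDegree_eq_of_degree_eq (degree_eq_degree_of_associated a2)]
  have h2 : relfinrank k⟮φ x'⟯ k⟮x⟯ = max p.natDegree q.natDegree := by
    rw [← hdeg, ← RatFunc.finrank_eq_max_natDegree, ← relfinrank_top_right, ← hrange, ← hu,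
      AlgHom.fieldRange_eq_map, ← Set.image_singleton, ← adjoin_map, relfinrank_map_map]
  have h3 := relfinrank_mul_finrank_top hle
  have h4 := relfinrank_mul_finrank_top hle'
  rw [h1] at h4
  rw [h2, h.finrank_eq hf hd] at h3
  omega

end IsHyperellipticModel

end Models

/-! ### Weierstrass models and their function fields -/

section CubicModels

open Polynomial IntermediateField

/-- The monic cubic with roots `e₁, e₂, e₃`. -/
noncomputable def rootCubic {k : Type*} [Field k] (e₁ e₂ e₃ : k) : k[X] :=
  (X - C e₁) * (X - C e₂) * (X - C e₃)

/-- The Weierstrass curve `y² = (x - e₁)(x - e₂)(x - e₃)`. -/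
def rootCurve {k : Type*} [Field k] (e₁ e₂ e₃ : k) : WeierstrassCurve k :=
  ⟨0, -(e₁ + e₂ + e₃), 0, e₁ * e₂ + e₁ * e₃ + e₂ * e₃, -(e₁ * e₂ * e₃)⟩

/-- The `j`-invariant of `y² = (x - e₁)(x - e₂)(x - e₃)` in terms of the roots. -/
def rootJ {k : Type*} [Field k] (e₁ e₂ e₃ : k) : k :=
  256 * (e₁ ^ 2 + e₂ ^ 2 + e₃ ^ 2 - e₁ * e₂ - e₁ * e₃ - e₂ * e₃) ^ 3 /
    ((e₁ - e₂) * (e₁ - e₃) * (e₂ - e₃)) ^ 2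

/-- Three pairwise distinct elements. -/
structure AreDistinct {k : Type*} (e₁ e₂ e₃ : k) : Prop where
  ne₁₂ : e₁ ≠ e₂
  ne₁₃ : e₁ ≠ e₃
  ne₂₃ : e₂ ≠ e₃

/-- The function field `F` is given by a Weierstrass equation `W` in the generators `x`, `y`. -/
structure IsWeierstrassModel {k F : Type*} [Field k] [Field F] [Algebra k F]
    (W : WeierstrassCurve k) (x y : F) : Prop where
  transcendental : Transcendental k x
  equation : y ^ 2 + algebraMap k F W.a₁ * x * y + algebraMap k F W.a₃ * y =
    x ^ 3 + algebraMap k F W.a₂ * x ^ 2 + algebraMap k F W.a₄ * x + algebraMap k F W.a₆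
  adjoin_eq_top : adjoin k {x, y} = ⊤

variable {k F F' : Type*} [Field k] [Field F] [Field F'] [Algebra k F] [Algebra k F']

theorem aeval_rootCubic (e₁ e₂ e₃ : k) (x : F) : aeval x (rootCubic e₁ e₂ e₃) =
    (x - algebraMap k F e₁) * (x - algebraMap k F e₂) * (x - algebraMap k F e₃) := by
  simp [rootCubic]

theorem natDegree_rootCubic (e₁ e₂ e₃ : k) : (rootCubic e₁ e₂ e₃).natDegree = 3 := by
  rw [rootCubic, natDegree_mul (mul_ne_zero (X_sub_C_ne_zero _) (X_sub_C_ne_zero _))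
    (X_sub_C_ne_zero _), natDegree_mul (X_sub_C_ne_zero _) (X_sub_C_ne_zero _)]
  simp

theorem AreDistinct.squarefree {e₁ e₂ e₃ : k} (h : AreDistinct e₁ e₂ e₃) :
    Squarefree (rootCubic e₁ e₂ e₃) := by
  have hc : ∀ {a b : k}, a ≠ b → IsCoprime (X - C a) (X - C b) := fun hab =>
    isCoprime_X_sub_C_of_isUnit_sub (sub_ne_zero.2 hab).isUnit
  refine squarefree_mul_iff.2 ⟨((hc h.ne₁₃).mul_left (hc h.ne₂₃)).isRelPrime, ?_,
    (irreducible_X_sub_C _).squarefree⟩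
  exact squarefree_mul_iff.2 ⟨(hc h.ne₁₂).isRelPrime, (irreducible_X_sub_C _).squarefree,
    (irreducible_X_sub_C _).squarefree⟩

theorem AreDistinct.sq_ne_zero {e₁ e₂ e₃ : k} (h : AreDistinct e₁ e₂ e₃) :
    ((e₁ - e₂) * (e₁ - e₃) * (e₂ - e₃)) ^ 2 ≠ 0 :=
  pow_ne_zero 2 (mul_ne_zero (mul_ne_zero (sub_ne_zero.2 h.ne₁₂) (sub_ne_zero.2 h.ne₁₃))
    (sub_ne_zero.2 h.ne₂₃))

theorem rootCurve_discriminant (e₁ e₂ e₃ : k) :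
    (rootCurve e₁ e₂ e₃).Δ = 16 * ((e₁ - e₂) * (e₁ - e₃) * (e₂ - e₃)) ^ 2 := by
  simp only [WeierstrassCurve.Δ, WeierstrassCurve.b₂, WeierstrassCurve.b₄, WeierstrassCurve.b₆,
    WeierstrassCurve.b₈, rootCurve]
  ring

theorem AreDistinct.isElliptic [CharZero k] {e₁ e₂ e₃ : k} (h : AreDistinct e₁ e₂ e₃) :
    (rootCurve e₁ e₂ e₃).IsElliptic := by
  refine ⟨?_⟩
  rw [rootCurve_discriminant]
  exact (mul_ne_zero (by norm_num) h.sq_ne_zero).isUnit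

theorem AreDistinct.j_rootCurve [CharZero k] {e₁ e₂ e₃ : k} (h : AreDistinct e₁ e₂ e₃)
    [(rootCurve e₁ e₂ e₃).IsElliptic] : (rootCurve e₁ e₂ e₃).j = rootJ e₁ e₂ e₃ := by
  have hc : (rootCurve e₁ e₂ e₃).c₄ =
      16 * (e₁ ^ 2 + e₂ ^ 2 + e₃ ^ 2 - e₁ * e₂ - e₁ * e₃ - e₂ * e₃) := by
    simp only [WeierstrassCurve.c₄, WeierstrassCurve.b₂, WeierstrassCurve.b₄, rootCurve]
    ring
  rw [WeierstrassCurve.j, Units.val_inv_eq_inv_val, WeierstrassCurve.coe_Δ', hc,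
    rootCurve_discriminant, rootJ, inv_mul_eq_div,
    div_eq_div_iff (mul_ne_zero (by norm_num) h.sq_ne_zero) h.sq_ne_zero]
  ring

theorem IsWeierstrassModel.isHyperellipticModel {e₁ e₂ e₃ : k} {x y : F}
    (h : IsWeierstrassModel (rootCurve e₁ e₂ e₃) x y) :
    IsHyperellipticModel (rootCubic e₁ e₂ e₃) x y where
  transcendental := h.transcendental
  adjoin_eq_top := h.adjoin_eq_top
  equation := by
    have := h.equation
    simp only [rootCurve, map_zero, map_neg, map_add, map_mul] at this
    rw [aeval_rootCubic]
    linear_combination this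

theorem IsWeierstrassModel.variableChange {W : WeierstrassCurve k} {x y : F}
    (h : IsWeierstrassModel W x y) (C : WeierstrassCurve.VariableChange k) :
    ∃ x' y' : F, IsWeierstrassModel (C • W) x' y' := by
  obtain ⟨u, r, s, t⟩ := C
  obtain ⟨v, hv⟩ : ∃ v : F, v = algebraMap k F ((u⁻¹ : kˣ) : k) := ⟨_, rfl⟩
  obtain ⟨w, hw⟩ : ∃ w : F, w = algebraMap k F (u : k) := ⟨_, rfl⟩
  have hvw : v * w = 1 := by rw [hv, hw, ← map_mul]; simp
  obtain ⟨x', hx'⟩ : ∃ x', x' = v ^ 2 * (x - algebraMap k F r) := ⟨_, rfl⟩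
  obtain ⟨y', hy'⟩ : ∃ y', y' = v ^ 3 * (y - algebraMap k F s * (x - algebraMap k F r) -
    algebraMap k F t) := ⟨_, rfl⟩
  have hx : x = w ^ 2 * x' + algebraMap k F r := by
    rw [hx']; linear_combination (-(v * w + 1) * (x - algebraMap k F r)) * hvw
  have hy : y = w ^ 3 * y' + algebraMap k F s * (w ^ 2 * x') + algebraMap k F t := by
    rw [hy', hx']
    linear_combination (-(v ^ 2 * w ^ 2 + v * w + 1) * (y - algebraMap k F s *
      (x - algebraMap k F r) - algebraMap k F t) - (v * w + 1) * algebraMap k F s *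
        (x - algebraMap k F r)) * hvw
  refine ⟨x', y', ?_, ?_, ?_⟩
  · intro ha
    apply h.transcendental
    rw [hx, hw]
    exact (((isAlgebraic_algebraMap _).pow 2).mul ha).add (isAlgebraic_algebraMap _)
  · have he := h.equation
    simp only [WeierstrassCurve.variableChange_a₁, WeierstrassCurve.variableChange_a₂,
      WeierstrassCurve.variableChange_a₃, WeierstrassCurve.variableChange_a₄,
      WeierstrassCurve.variableChange_a₆, map_mul, map_pow, map_add, map_sub, map_ofNat, ← hv]
    rw [hx', hy']
    linear_combination v ^ 6 * he
  · rw [eq_top_iff, ← h.adjoin_eq_top, adjoin_le_iff]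
    have hx1 : x' ∈ adjoin k {x', y'} := subset_adjoin _ _ (by simp)
    have hy1 : y' ∈ adjoin k {x', y'} := subset_adjoin _ _ (by simp)
    have hc : ∀ c : k, algebraMap k F c ∈ adjoin k {x', y'} := fun c =>
      IntermediateField.algebraMap_mem _ c
    have hw1 : w ∈ adjoin k {x', y'} := hw ▸ hc _
    rintro z (rfl | rfl)
    · rw [hx]
      exact add_mem (mul_mem (pow_mem hw1 2) hx1) (hc _)
    · rw [hy]
      exact add_mem (add_mem (mul_mem (pow_mem hw1 3) hy1)
        (mul_mem (hc _) (mul_mem (pow_mem hw1 2) hx1))) (hc _)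

theorem IsWeierstrassModel.map_algEquiv {W : WeierstrassCurve k} {x y : F}
    (h : IsWeierstrassModel W x y) (e : F ≃ₐ[k] F') : IsWeierstrassModel W (e x) (e y) where
  transcendental := fun ha =>
    h.transcendental ((isAlgebraic_algHom_iff (e : F →ₐ[k] F') e.injective).1 ha)
  equation := by
    have := congrArg e h.equation
    simpa only [map_add, map_mul, map_pow, AlgEquiv.commutes] using this
  adjoin_eq_top := by
    have h1 := congrArg (IntermediateField.map (e : F →ₐ[k] F')) h.adjoin_eq_top
    rw [adjoin_map, Set.image_pair] at h1
    refine h1.trans ?_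
    rw [← AlgHom.fieldRange_eq_map]
    exact (AlgHom.fieldRange_eq_top).2 e.surjective

theorem exists_isWeierstrassModel_functionField (W : WeierstrassCurve k) :
    ∃ x y : W.toAffine.FunctionField, IsWeierstrassModel W x y := by
  let ι := algebraMap W.toAffine.CoordinateRing W.toAffine.FunctionField
  have hι : Function.Injective ι := IsFractionRing.injective _ _
  let x₀ : W.toAffine.CoordinateRing := algebraMap k[X] _ X
  let y₀ : W.toAffine.CoordinateRing := WeierstrassCurve.Affine.CoordinateRing.mk W.toAffine X
  have haev : ∀ p : k[X], aeval (ι x₀) p = ι (algebraMap k[X] _ p) := by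
    intro p
    rw [show ι x₀ = algebraMap W.toAffine.CoordinateRing W.toAffine.FunctionField x₀ from rfl,
      aeval_algebraMap_apply, show x₀ = algebraMap k[X] W.toAffine.CoordinateRing X from rfl,
      aeval_algebraMap_apply, aeval_X_left_apply]
  have hC : ∀ c : k, algebraMap k W.toAffine.FunctionField c =
      ι (WeierstrassCurve.Affine.CoordinateRing.mk W.toAffine (C (C c))) := fun c => rfl
  refine ⟨ι x₀, ι y₀, ?_, ?_, ?_⟩
  · rw [transcendental_iff_injective]
    intro p q hpq
    rw [haev, haev] at hpq
    exact FaithfulSMul.algebraMap_injective k[X] W.toAffine.CoordinateRing (hι hpq)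
  · rw [hC, hC, hC, hC, hC, show x₀ = WeierstrassCurve.Affine.CoordinateRing.mk W.toAffine (C X)
      from rfl]
    simp only [← map_mul, ← map_pow, ← map_add, y₀]
    congr 1
    rw [← sub_eq_zero, ← map_sub, AdjoinRoot.mk_eq_zero, WeierstrassCurve.Affine.polynomial]
    refine ⟨1, ?_⟩
    simp only [map_add, map_mul, map_pow]
    ring
  · rw [eq_top_iff]
    rintro z -
    have hx1 : ι x₀ ∈ adjoin k {ι x₀, ι y₀} := subset_adjoin _ _ (by simp)
    have hy1 : ι y₀ ∈ adjoin k {ι x₀, ι y₀} := subset_adjoin _ _ (by simp)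
    have hp : ∀ p : k[X], ι (algebraMap k[X] _ p) ∈ adjoin k {ι x₀, ι y₀} := by
      intro p
      have := aeval_mem_of_mem hx1 p
      rwa [haev p] at this
    have hall : ∀ w : W.toAffine.CoordinateRing, ι w ∈ adjoin k {ι x₀, ι y₀} := by
      intro w
      obtain ⟨p, q, rfl⟩ := WeierstrassCurve.Affine.CoordinateRing.exists_smul_basis_eq w
      rw [Algebra.smul_def, Algebra.smul_def, mul_one, map_add, map_mul]
      exact add_mem (hp p) (mul_mem (hp q) hy1)
    obtain ⟨a, b, -, rfl⟩ := IsFractionRing.div_surjective (A := W.toAffine.CoordinateRing) z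
    exact div_mem (hall a) (hall b)

variable [CharZero k]

/-- A function field of an elliptic curve with the `j`-invariant of `y² = (x - e₁)(x - e₂)(x - e₃)`
is given by this equation. -/
theorem HasJInvariant.exists_model [IsAlgClosed k] {e₁ e₂ e₃ : k} (he : AreDistinct e₁ e₂ e₃)
    (h : HasJInvariant k F (rootJ e₁ e₂ e₃)) :
    ∃ x y : F, IsHyperellipticModel (rootCubic e₁ e₂ e₃) x y := by
  obtain ⟨W, hW, hj, ⟨φ⟩⟩ := h
  have := he.isElliptic
  obtain ⟨D, hD⟩ := WeierstrassCurve.exists_variableChange_of_j_eq W (rootCurve e₁ e₂ e₃)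
    (by rw [hj, he.j_rootCurve])
  obtain ⟨x₀, y₀, h₀⟩ := exists_isWeierstrassModel_functionField W
  obtain ⟨x, y, hxy⟩ := (h₀.map_algEquiv φ.symm).variableChange D
  rw [hD] at hxy
  exact ⟨x, y, hxy.isHyperellipticModel⟩

theorem IsHyperellipticModel.hasJInvariant {e₁ e₂ e₃ : k} (he : AreDistinct e₁ e₂ e₃) {x y : F}
    (h : IsHyperellipticModel (rootCubic e₁ e₂ e₃) x y) :
    HasJInvariant k F (rootJ e₁ e₂ e₃) := by
  have := he.isElliptic
  obtain ⟨x₀, y₀, h₀⟩ := exists_isWeierstrassModel_functionField (rootCurve e₁ e₂ e₃)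
  obtain ⟨e, -, -⟩ := h.exists_algEquiv h₀.isHyperellipticModel he.squarefree
    (by rw [natDegree_rootCubic]; decide)
  exact ⟨rootCurve e₁ e₂ e₃, this, he.j_rootCurve, ⟨e⟩⟩

/-- Every `j`-invariant comes from a Legendre curve `y² = x(x - 1)(x - t)`. -/
theorem exists_rootJ_eq [IsAlgClosed k] (j : k) :
    ∃ e₁ e₂ e₃ : k, AreDistinct e₁ e₂ e₃ ∧ rootJ e₁ e₂ e₃ = j := by
  obtain ⟨t, ht⟩ := IsAlgClosed.exists_root
    (C 256 * (X ^ 2 - X + 1) ^ 3 - C j * (X * (X - 1)) ^ 2 : k[X]) (by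
      have hd : (C 256 * (X ^ 2 - X + 1) ^ 3 - C j * (X * (X - 1)) ^ 2 : k[X]).natDegree = 6 := by
        compute_degree!
      intro h
      exact absurd (hd.symm.trans (natDegree_eq_of_degree_eq_some h)) (by norm_num))
  simp only [IsRoot.def, eval_sub, eval_mul, eval_C, eval_pow, eval_add, eval_X, eval_one] at ht
  have h0 : t ≠ 0 := by rintro rfl; norm_num at ht
  have h1 : t ≠ 1 := by rintro rfl; norm_num at ht
  have hd : AreDistinct (0 : k) 1 t := ⟨zero_ne_one, h0.symm, h1.symm⟩
  refine ⟨0, 1, t, hd, ?_⟩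
  rw [rootJ, div_eq_iff hd.sq_ne_zero]
  linear_combination ht

end CubicModels

/-! ### Points over the function field -/

section Points

open Polynomial IntermediateField
open WeierstrassCurve.Affine (Point)

variable {k F F' : Type*} [Field k] [Field F] [Field F'] [Algebra k F] [Algebra k F']

theorem baseChange_rootCurve_a₁ (e₁ e₂ e₃ : k) :
    ((rootCurve e₁ e₂ e₃).baseChange F).toAffine.a₁ = 0 := map_zero (algebraMap k F)

theorem baseChange_rootCurve_a₂ (e₁ e₂ e₃ : k) :
    ((rootCurve e₁ e₂ e₃).baseChange F).toAffine.a₂ = algebraMap k F (-(e₁ + e₂ + e₃)) := rfl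

theorem baseChange_rootCurve_a₃ (e₁ e₂ e₃ : k) :
    ((rootCurve e₁ e₂ e₃).baseChange F).toAffine.a₃ = 0 := map_zero (algebraMap k F)

theorem baseChange_rootCurve_a₄ (e₁ e₂ e₃ : k) :
    ((rootCurve e₁ e₂ e₃).baseChange F).toAffine.a₄ =
      algebraMap k F (e₁ * e₂ + e₁ * e₃ + e₂ * e₃) := rfl

theorem baseChange_rootCurve_a₆ (e₁ e₂ e₃ : k) :
    ((rootCurve e₁ e₂ e₃).baseChange F).toAffine.a₆ = algebraMap k F (-(e₁ * e₂ * e₃)) := rfl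

theorem baseChange_rootCurve_equation {e₁ e₂ e₃ : k} {x y : F} :
    ((rootCurve e₁ e₂ e₃).baseChange F).toAffine.Equation x y ↔
      y ^ 2 = aeval x (rootCubic e₁ e₂ e₃) := by
  rw [WeierstrassCurve.Affine.equation_iff, aeval_rootCubic]
  simp only [baseChange_rootCurve_a₁, baseChange_rootCurve_a₂, baseChange_rootCurve_a₃,
    baseChange_rootCurve_a₄, baseChange_rootCurve_a₆, map_neg, map_add, map_mul]
  constructor <;> intro h <;> linear_combination h

theorem AreDistinct.nonsingular [CharZero k] {e₁ e₂ e₃ : k} (he : AreDistinct e₁ e₂ e₃) {x y : F}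
    (h : y ^ 2 = aeval x (rootCubic e₁ e₂ e₃)) :
    ((rootCurve e₁ e₂ e₃).baseChange F).toAffine.Nonsingular x y := by
  have := he.isElliptic
  have : ((rootCurve e₁ e₂ e₃).baseChange F).toAffine.IsElliptic :=
    inferInstanceAs ((rootCurve e₁ e₂ e₃).map (algebraMap k F)).IsElliptic
  exact WeierstrassCurve.Affine.equation_iff_nonsingular.1 (baseChange_rootCurve_equation.2 h)

/-- A point of `y² = (x - e₁)(x - e₂)(x - e₃)` with coordinates in `k(t)` is constant. -/
theorem exists_eq_algebraMap_of_mem_adjoin_simple [CharZero k] [IsAlgClosed k] {e₁ e₂ e₃ : k}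
    (he : AreDistinct e₁ e₂ e₃) {t A B : F} (ht : Transcendental k t) (hA : A ∈ k⟮t⟯)
    (hB : B ∈ k⟮t⟯) (h : B ^ 2 = aeval A (rootCubic e₁ e₂ e₃)) :
    ∃ a : k, A = algebraMap k F a := by
  obtain ⟨p, q, hpq, hq, hz⟩ := exists_isCoprime_of_mem_adjoin_simple ht hA
  have ht' : t ∈ k⟮t⟯ := mem_adjoin_simple_self k t
  obtain ⟨R, -, hR⟩ := exists_aeval_eq_of_sq_mul ht (f := 1)
    (g := q * (p - C e₁ * q) * (p - C e₂ * q) * (p - C e₃ * q))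
    (mul_mem hB (pow_mem (aeval_mem_of_mem ht' q) 2)) squarefree_one (by
      rw [aeval_rootCubic] at h
      simp only [map_one, map_mul, map_sub, aeval_C, ← hz, mul_pow, h]
      ring)
  obtain ⟨hp0, hq0⟩ := natDegree_eq_zero_of_pencil_sq hpq he.ne₁₂ he.ne₁₃ he.ne₂₃ hq
    (hR.trans (one_mul _))
  rw [natDegree_eq_zero] at hp0 hq0
  obtain ⟨a, rfl⟩ := hp0
  obtain ⟨b, rfl⟩ := hq0
  have hb : algebraMap k F b ≠ 0 := by simpa using hq
  refine ⟨a / b, ?_⟩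
  rw [map_div₀, eq_div_iff hb]
  simpa using hz

theorem exists_eq_algebraMap_of_sq [IsAlgClosed k] {B : F} {c : k}
    (h : B ^ 2 = algebraMap k F c) : ∃ b : k, B = algebraMap k F b := by
  obtain ⟨b, hb⟩ := IsAlgClosed.exists_pow_nat_eq c two_pos
  rw [← hb, map_pow] at h
  rcases sq_eq_sq_iff_eq_or_eq_neg.1 h with h | h
  · exact ⟨b, h⟩
  · exact ⟨-b, by rw [h, map_neg]⟩

open scoped Classical in
/-- A point with constant abscissa is constant. -/
theorem exists_point_eq_map [CharZero k] [IsAlgClosed k] {e₁ e₂ e₃ : k}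
    (he : AreDistinct e₁ e₂ e₃) {A B : F}
    (hn : ((rootCurve e₁ e₂ e₃).baseChange F).toAffine.Nonsingular A B) {a : k}
    (hA : A = algebraMap k F a) :
    ∃ P : ((rootCurve e₁ e₂ e₃).baseChange k).toAffine.Point,
      Point.some A B hn = Point.map (Algebra.ofId k F) P := by
  have h := baseChange_rootCurve_equation.1 hn.1
  obtain ⟨b, hb⟩ : ∃ b, B = algebraMap k F b := by
    rw [hA, aeval_algebraMap_apply] at h
    exact exists_eq_algebraMap_of_sq h
  have h' : b ^ 2 = aeval a (rootCubic e₁ e₂ e₃) := by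
    apply (algebraMap k F).injective
    rw [← aeval_algebraMap_apply, map_pow, ← hA, ← hb, h]
  refine ⟨Point.some a b (he.nonsingular h'), ?_⟩
  rw [Point.map_some]
  simp only [Point.some.injEq]
  exact ⟨hA, hb⟩

open scoped Classical in
/-- If `F` is the function field of `y² = f(x)` with involution `ι : y ↦ -y`, then `Q + ι Q` is
constant for every point `Q` of an elliptic curve over `F`, because it is a point over `k(x)`. -/
theorem IsHyperellipticModel.exists_add_map_eq [CharZero k] [IsAlgClosed k] {e₁ e₂ e₃ : k}
    (he : AreDistinct e₁ e₂ e₃) {f : k[X]} {x y : F} (h : IsHyperellipticModel f x y)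
    (hf : Squarefree f) (hd : f.natDegree ≠ 0) {ι : F ≃ₐ[k] F} (hx : ι x = x) (hy : ι y = -y)
    (Q : ((rootCurve e₁ e₂ e₃).baseChange F).toAffine.Point) :
    ∃ P : ((rootCurve e₁ e₂ e₃).baseChange k).toAffine.Point,
      Q + Point.map (ι : F →ₐ[k] F) Q = Point.map (Algebra.ofId k F) P := by
  have hιι : (ι : F →ₐ[k] F).comp (ι : F →ₐ[k] F) = AlgHom.id k F :=
    h.algHom_ext (by simp [hx]) (by simp [hy])
  have hQ : Point.map (ι : F →ₐ[k] F) (Point.map (ι : F →ₐ[k] F) Q) = Q := by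
    rw [Point.map_map, hιι]; cases Q <;> rfl
  have hS : Point.map (ι : F →ₐ[k] F) (Q + Point.map (ι : F →ₐ[k] F) Q) =
      Q + Point.map (ι : F →ₐ[k] F) Q := by
    rw [map_add, hQ, add_comm]
  generalize Q + Point.map (ι : F →ₐ[k] F) Q = S at hS
  rcases S with _ | ⟨A, B, hAB⟩
  · exact ⟨0, rfl⟩
  · rw [Point.map_some] at hS
    simp only [Point.some.injEq] at hS
    have hA := (h.exists_of_involution hf hd hx hy A).1 hS.1
    have hB := (h.exists_of_involution hf hd hx hy B).1 hS.2
    obtain ⟨a, ha⟩ := exists_eq_algebraMap_of_mem_adjoin_simple he h.transcendental hA hB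
      (baseChange_rootCurve_equation.1 hAB.1)
    exact exists_point_eq_map he hAB ha

open scoped Classical in
/-- The group of points over an algebraically closed field is divisible by two. -/
theorem exists_add_self_eq [CharZero k] [IsAlgClosed k] {e₁ e₂ e₃ : k} (he : AreDistinct e₁ e₂ e₃)
    (P : ((rootCurve e₁ e₂ e₃).baseChange k).toAffine.Point) : ∃ Q, Q + Q = P := by
  rcases P with _ | ⟨a, b, hab⟩
  · exact ⟨0, by rw [add_zero]; rfl⟩
  -- the roots of this quartic are the abscissas of the points whose double has abscissa `a`
  obtain ⟨q, hq⟩ := IsAlgClosed.exists_root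
    ((C 3 * X ^ 2 + C (-2 * (e₁ + e₂ + e₃)) * X + C (e₁ * e₂ + e₁ * e₃ + e₂ * e₃)) ^ 2 -
      C 4 * (C 2 * X + C (a - (e₁ + e₂ + e₃))) * rootCubic e₁ e₂ e₃ : k[X]) (by
      have hd : ((C 3 * X ^ 2 + C (-2 * (e₁ + e₂ + e₃)) * X +
          C (e₁ * e₂ + e₁ * e₃ + e₂ * e₃)) ^ 2 -
          C 4 * (C 2 * X + C (a - (e₁ + e₂ + e₃))) * rootCubic e₁ e₂ e₃ : k[X]).natDegree = 4 := by
        rw [rootCubic]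
        compute_degree!
      intro h
      exact absurd (hd.symm.trans (natDegree_eq_of_degree_eq_some h)) (by norm_num))
  obtain ⟨r, hr⟩ := IsAlgClosed.exists_pow_nat_eq ((q - e₁) * (q - e₂) * (q - e₃)) two_pos
  simp only [rootCubic, IsRoot.def, eval_sub, eval_mul, eval_C, eval_pow, eval_add, eval_X] at hq
  have hr0 : r ≠ 0 := by
    rintro rfl
    have h0 : (q - e₁) * (q - e₂) * (q - e₃) = 0 := by rw [← hr]; ring
    rw [h0, mul_zero, sub_zero] at hq
    have h1 := pow_eq_zero_iff two_ne_zero |>.1 hq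
    have h2 : ((e₁ - e₂) * (e₁ - e₃) * (e₂ - e₃)) ^ 2 = 0 := by
      rcases mul_eq_zero.1 h0 with h0 | h0
      · rcases mul_eq_zero.1 h0 with h0 | h0
        · obtain rfl := sub_eq_zero.1 h0
          linear_combination ((q - e₂) * (q - e₃) * (e₂ - e₃) ^ 2) * h1
        · obtain rfl := sub_eq_zero.1 h0
          linear_combination (-(e₁ - q) * (q - e₃) * (e₁ - e₃) ^ 2) * h1
      · obtain rfl := sub_eq_zero.1 h0
        linear_combination ((e₁ - q) * (e₂ - q) * (e₁ - e₂) ^ 2) * h1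
    exact he.sq_ne_zero h2
  have hqr : r ^ 2 = aeval q (rootCubic e₁ e₂ e₃) := by rw [aeval_rootCubic]; exact hr
  have hn := he.nonsingular hqr
  have hneg : r ≠ ((rootCurve e₁ e₂ e₃).baseChange k).toAffine.negY q r := by
    simp only [WeierstrassCurve.Affine.negY, baseChange_rootCurve_a₁, baseChange_rootCurve_a₃]
    intro h
    apply hr0
    have : 2 * r = 0 := by linear_combination h
    simpa using this
  have hx : ((rootCurve e₁ e₂ e₃).baseChange k).toAffine.addX q q
      (((rootCurve e₁ e₂ e₃).baseChange k).toAffine.slope q q r r) = a := by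
    rw [WeierstrassCurve.Affine.slope_of_Y_ne rfl hneg]
    simp only [WeierstrassCurve.Affine.addX, WeierstrassCurve.Affine.negY,
      baseChange_rootCurve_a₁, baseChange_rootCurve_a₂, baseChange_rootCurve_a₃,
      baseChange_rootCurve_a₄]
    rw [show r - (-r - 0 * q - 0) = 2 * r by ring]
    field_simp
    simp only [map_neg, map_add, map_mul, Algebra.algebraMap_self, RingHom.id_apply]
    linear_combination hq - 4 * (2 * q + a - (e₁ + e₂ + e₃)) * hr
  have hdbl := Point.add_self_of_Y_ne (h₁ := hn) hneg
  have hor : Point.some q r hn + Point.some q r hn = Point.some a b hab ∨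
      Point.some q r hn + Point.some q r hn = -Point.some a b hab := by
    rw [hdbl]
    exact Point.X_eq_iff.1 hx
  rcases hor with h | h
  · exact ⟨_, h⟩
  · exact ⟨-Point.some q r hn, by rw [← neg_add, h, neg_neg]⟩

end Points

/-! ### Normalising embeddings by translations -/

section Isogenies

open Polynomial IntermediateField
open WeierstrassCurve.Affine (Point)

variable {k F F' : Type*} [Field k] [Field F] [Field F'] [Algebra k F] [Algebra k F']

theorem IsAlgebraic.exists_eq_algebraMap [IsAlgClosed k] {a : F} (ha : IsAlgebraic k a) :
    ∃ c : k, a = algebraMap k F c := by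
  obtain ⟨c, hc⟩ := minpoly.mem_range_of_degree_eq_one k a
    (IsAlgClosed.degree_eq_one_of_irreducible k (minpoly.irreducible ha.isIntegral))
  exact ⟨c, hc.symm⟩

theorem AlgHom.fieldRange_comp_algEquiv (φ : F' →ₐ[k] F) (e : F' ≃ₐ[k] F') :
    (φ.comp (e : F' →ₐ[k] F')).fieldRange = φ.fieldRange := by
  ext z
  constructor
  · rintro ⟨w, rfl⟩; exact ⟨e w, rfl⟩
  · rintro ⟨w, rfl⟩; exact ⟨e.symm w, by simp⟩

namespace IsHyperellipticModel

/-- The generic point of `y² = (x - e₁)(x - e₂)(x - e₃)`, and its images under embeddings. -/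
theorem nonsingular_algHom [CharZero k] {e₁ e₂ e₃ : k} (he : AreDistinct e₁ e₂ e₃) {x y : F}
    (h : IsHyperellipticModel (rootCubic e₁ e₂ e₃) x y) (φ : F →ₐ[k] F') :
    ((rootCurve e₁ e₂ e₃).baseChange F').toAffine.Nonsingular (φ x) (φ y) :=
  he.nonsingular (by rw [← map_pow, h.equation, aeval_algHom_apply])

open scoped Classical in
/-- Translation by a constant point, as an endomorphism of the function field. -/
theorem exists_algHom_translation [CharZero k] [IsAlgClosed k] {e₁ e₂ e₃ : k}
    (he : AreDistinct e₁ e₂ e₃) {x y : F} (h : IsHyperellipticModel (rootCubic e₁ e₂ e₃) x y)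
    (Q : ((rootCurve e₁ e₂ e₃).baseChange k).toAffine.Point) :
    ∃ τ : F →ₐ[k] F, Point.some _ _ (h.nonsingular_algHom he τ) =
      Point.some _ _ (h.nonsingular_algHom he (AlgHom.id k F)) +
        Point.map (Algebra.ofId k F) Q := by
  have hconst : ∀ P : ((rootCurve e₁ e₂ e₃).baseChange k).toAffine.Point,
      Point.some _ _ (h.nonsingular_algHom he (AlgHom.id k F)) ≠
        Point.map (Algebra.ofId k F) P := by
    rintro (_ | ⟨a, b, hab⟩) hP
    · cases hP
    · rw [Point.map_some] at hP
      simp only [Point.some.injEq] at hP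
      refine h.transcendental ?_
      have hx : x = algebraMap k F a := hP.1
      rw [hx]
      exact isAlgebraic_algebraMap a
  have hS : ∀ P : ((rootCurve e₁ e₂ e₃).baseChange k).toAffine.Point,
      Point.some _ _ (h.nonsingular_algHom he (AlgHom.id k F)) +
        Point.map (Algebra.ofId k F) Q ≠ Point.map (Algebra.ofId k F) P := by
    intro P hP
    apply hconst (P - Q)
    rw [map_sub, ← hP, add_sub_cancel_right]
  generalize Point.some _ _ (h.nonsingular_algHom he (AlgHom.id k F)) +
        Point.map (Algebra.ofId k F) Q = S at hS
  rcases S with _ | ⟨a, b, hab⟩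
  · exact absurd rfl (hS 0)
  · have ha : Transcendental k a := by
      intro ha
      obtain ⟨a', ha'⟩ := ha.exists_eq_algebraMap
      obtain ⟨P, hP⟩ := exists_point_eq_map he hab ha'
      exact hS P hP
    obtain ⟨τ, hx, hy⟩ := h.exists_algHom he.squarefree (by rw [natDegree_rootCubic]; decide) ha
      (baseChange_rootCurve_equation.1 hab.1)
    exact ⟨τ, by simp only [Point.some.injEq]; exact ⟨hx, hy⟩⟩

open scoped Classical in
/-- Translations by constant points are invertible. -/
theorem exists_algEquiv_translation [CharZero k] [IsAlgClosed k] {e₁ e₂ e₃ : k}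
    (he : AreDistinct e₁ e₂ e₃) {x y : F} (h : IsHyperellipticModel (rootCubic e₁ e₂ e₃) x y)
    (Q : ((rootCurve e₁ e₂ e₃).baseChange k).toAffine.Point) :
    ∃ τ : F ≃ₐ[k] F, Point.some _ _ (h.nonsingular_algHom he (τ : F →ₐ[k] F)) =
      Point.some _ _ (h.nonsingular_algHom he (AlgHom.id k F)) +
        Point.map (Algebra.ofId k F) Q := by
  have hcomp : ∀ (P P' : ((rootCurve e₁ e₂ e₃).baseChange k).toAffine.Point), P + P' = 0 →
      ∀ τ τ' : F →ₐ[k] F, Point.some _ _ (h.nonsingular_algHom he τ) =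
        Point.some _ _ (h.nonsingular_algHom he (AlgHom.id k F)) +
          Point.map (Algebra.ofId k F) P →
      Point.some _ _ (h.nonsingular_algHom he τ') =
        Point.some _ _ (h.nonsingular_algHom he (AlgHom.id k F)) +
          Point.map (Algebra.ofId k F) P' → τ.comp τ' = AlgHom.id k F := by
    intro P P' hP τ τ' h1 h2
    have h3 : Point.some _ _ (h.nonsingular_algHom he (τ.comp τ')) =
        Point.some _ _ (h.nonsingular_algHom he (AlgHom.id k F)) := by
      have h4 : Point.some _ _ (h.nonsingular_algHom he (τ.comp τ')) =
        Point.map τ (Point.some _ _ (h.nonsingular_algHom he τ')) := rfl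
      have h5 : Point.map τ (Point.some _ _ (h.nonsingular_algHom he (AlgHom.id k F))) =
        Point.some _ _ (h.nonsingular_algHom he τ) := rfl
      rw [h4, h2, map_add, h5, h1, Point.map_map,
        Subsingleton.elim (τ.comp (Algebra.ofId k F)) (Algebra.ofId k F), add_assoc, ← map_add,
        hP, _root_.map_zero, add_zero]
    simp only [Point.some.injEq] at h3
    exact h.algHom_ext h3.1 h3.2
  obtain ⟨τ, hτ⟩ := h.exists_algHom_translation he Q
  obtain ⟨τ', hτ'⟩ := h.exists_algHom_translation he (-Q)
  exact ⟨AlgEquiv.ofAlgHom τ τ' (hcomp Q (-Q) (add_neg_cancel Q) τ τ' hτ hτ')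
    (hcomp (-Q) Q (neg_add_cancel Q) τ' τ hτ' hτ), hτ⟩

end IsHyperellipticModel

open scoped Classical in
/-- After composition with a translation, an embedding of the function field of an elliptic curve
into that of `y² = f(x)` commutes with the involutions `y ↦ -y`: if `S` is the image of the generic
point, then `S + ι S` is a constant point `2Q`, and `S - Q` is negated by `ι`. -/
theorem IsHyperellipticModel.exists_anti_invariant [CharZero k] [IsAlgClosed k] {f : k[X]} {x y : F}
    (h : IsHyperellipticModel f x y) (hf : Squarefree f) (hd : f.natDegree ≠ 0) {ι : F ≃ₐ[k] F}
    (hx : ι x = x) (hy : ι y = -y) {e₁ e₂ e₃ : k} (he : AreDistinct e₁ e₂ e₃) {x' y' : F'}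
    (h' : IsHyperellipticModel (rootCubic e₁ e₂ e₃) x' y') (φ : F' →ₐ[k] F) :
    ∃ ψ : F' →ₐ[k] F, ψ.fieldRange = φ.fieldRange ∧ ι (ψ x') = ψ x' ∧ ι (ψ y') = -ψ y' := by
  obtain ⟨P, hP⟩ := h.exists_add_map_eq he hf hd hx hy
    (Point.some _ _ (h'.nonsingular_algHom he φ))
  obtain ⟨Q, hQ⟩ := exists_add_self_eq he P
  obtain ⟨τ, hτ⟩ := h'.exists_algEquiv_translation he (-Q)
  refine ⟨φ.comp (τ : F' →ₐ[k] F'), AlgHom.fieldRange_comp_algEquiv φ τ, ?_⟩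
  have hψ : Point.some _ _ (h'.nonsingular_algHom he (φ.comp (τ : F' →ₐ[k] F'))) =
      Point.some _ _ (h'.nonsingular_algHom he φ) - Point.map (Algebra.ofId k F) Q := by
    have h4 : Point.some _ _ (h'.nonsingular_algHom he (φ.comp (τ : F' →ₐ[k] F'))) =
        Point.map φ (Point.some _ _ (h'.nonsingular_algHom he (τ : F' →ₐ[k] F'))) := rfl
    have h5 : Point.map φ (Point.some _ _ (h'.nonsingular_algHom he (AlgHom.id k F'))) =
        Point.some _ _ (h'.nonsingular_algHom he φ) := rfl
    rw [h4, hτ, map_add, h5, Point.map_map,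
      Subsingleton.elim (φ.comp (Algebra.ofId k F')) (Algebra.ofId k F), map_neg, sub_eq_add_neg]
  have hι : Point.map (ι : F →ₐ[k] F)
      (Point.some _ _ (h'.nonsingular_algHom he (φ.comp (τ : F' →ₐ[k] F')))) =
      -Point.some _ _ (h'.nonsingular_algHom he (φ.comp (τ : F' →ₐ[k] F'))) := by
    rw [hψ, map_sub, Point.map_map,
      Subsingleton.elim ((ι : F →ₐ[k] F).comp (Algebra.ofId k F)) (Algebra.ofId k F),
      eq_sub_of_add_eq' hP, ← hQ, map_add]
    abel
  rw [Point.neg_some, Point.map_some] at hι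
  simp only [Point.some.injEq, WeierstrassCurve.Affine.negY, baseChange_rootCurve_a₁,
    baseChange_rootCurve_a₃, zero_mul, sub_zero] at hι
  exact hι

end Isogenies

/-! ### Isogenies as rational functions -/

section IsogenyData

open Polynomial IntermediateField

/-- A rational function `p / q` of degree `n` with a pole at infinity through which an embedding of
the function field of `y² = (x - e₁)(x - e₂)(x - e₃)` into that of `y² = (x - r₁)(x - r₂)(x - r₃)`
acts on the abscissa; it is accompanied by `y ↦ y R(x) / q(x)²`. -/
structure IsIsogenyData {k : Type*} [Field k] (r₁ r₂ r₃ e₁ e₂ e₃ : k) (n : ℕ) (p q R : k[X]) :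
    Prop where
  isCoprime : IsCoprime p q
  natDegree_lt : q.natDegree < p.natDegree
  natDegree_eq : p.natDegree = n
  ne_zero : q ≠ 0
  ne_zero' : R ≠ 0
  equation : q * (p - C e₁ * q) * (p - C e₂ * q) * (p - C e₃ * q) = rootCubic r₁ r₂ r₃ * R ^ 2

variable {k F F' : Type*} [Field k] [Field F] [Field F'] [Algebra k F] [Algebra k F']

/-- Translation by the point `(e₁, 0)` of order two, which replaces `p / q` by
`e₁ + (e₁ - e₂)(e₁ - e₃) / (p / q - e₁)`. -/
theorem exists_isIsogenyData_of_natDegree_lt {r₁ r₂ r₃ e₁ e₂ e₃ : k} (he : AreDistinct e₁ e₂ e₃)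
    {p q R : k[X]} (hpq : IsCoprime p q) (hR : R ≠ 0) (h1 : p - C e₁ * q ≠ 0)
    (hlt : (p - C e₁ * q).natDegree < q.natDegree)
    (h : q * (p - C e₁ * q) * (p - C e₂ * q) * (p - C e₃ * q) = rootCubic r₁ r₂ r₃ * R ^ 2) :
    ∃ p' q' R', IsIsogenyData r₁ r₂ r₃ e₁ e₂ e₃ q.natDegree p' q' R' := by
  have hc : (e₁ - e₂) * (e₁ - e₃) ≠ 0 :=
    mul_ne_zero (sub_ne_zero.2 he.ne₁₂) (sub_ne_zero.2 he.ne₁₃)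
  obtain ⟨c, hcc⟩ : ∃ c, c = (e₁ - e₂) * (e₁ - e₃) := ⟨_, rfl⟩
  rw [← hcc] at hc
  have hdeg : (C e₁ * (p - C e₁ * q) + C c * q).natDegree = q.natDegree := by
    rw [natDegree_add_eq_right_of_natDegree_lt, natDegree_C_mul hc]
    rw [natDegree_C_mul hc]
    exact (natDegree_C_mul_le _ _).trans_lt hlt
  refine ⟨C e₁ * (p - C e₁ * q) + C c * q, p - C e₁ * q, C c * R, ?_, ?_, hdeg, h1,
    mul_ne_zero (C_ne_zero.2 hc) hR, ?_⟩
  · have h2 := (hpq.pencil_left e₁)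
    have h3 : IsCoprime (C c * q) (p - C e₁ * q) :=
      (isCoprime_mul_unit_left_left (isUnit_C.2 hc.isUnit) _ _).2 h2
    have := h3.add_mul_left_left (C e₁)
    rwa [add_comm, mul_comm (p - C e₁ * q)] at this
  · rw [hdeg]; exact hlt
  · rw [mul_pow, mul_left_comm, ← h, hcc]
    simp only [C_mul, C_sub]
    ring

/-- Every embedding of elliptic function fields gives rise to isogeny data of the same degree. The
normalised embedding sends `x'` to some `p(x) / q(x)`; composing it with the translation by a point
of order two, if necessary, moves a pole to infinity. -/
theorem exists_isIsogenyData [CharZero k] [IsAlgClosed k] {r₁ r₂ r₃ e₁ e₂ e₃ : k}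
    (hr : AreDistinct r₁ r₂ r₃) (he : AreDistinct e₁ e₂ e₃) {x y : F} {x' y' : F'}
    (h : IsHyperellipticModel (rootCubic r₁ r₂ r₃) x y)
    (h' : IsHyperellipticModel (rootCubic e₁ e₂ e₃) x' y') (φ : F' →ₐ[k] F) :
    ∃ p q R, IsIsogenyData r₁ r₂ r₃ e₁ e₂ e₃ (Module.finrank φ.fieldRange F) p q R := by
  have hd : (rootCubic r₁ r₂ r₃).natDegree ≠ 0 := by rw [natDegree_rootCubic]; decide
  have hd' : (rootCubic e₁ e₂ e₃).natDegree ≠ 0 := by rw [natDegree_rootCubic]; decide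
  obtain ⟨ι, hx, hy⟩ := h.exists_involution hr.squarefree hd
  obtain ⟨ψ, hψ, hA, hB⟩ := h.exists_anti_invariant hr.squarefree hd hx hy he h' φ
  have hA' := (h.exists_of_involution hr.squarefree hd hx hy _).1 hA
  obtain ⟨b, hb, hby⟩ := (h.exists_of_involution hr.squarefree hd hx hy _).2 hB
  obtain ⟨p, q, hpq, hq, hz⟩ := exists_isCoprime_of_mem_adjoin_simple h.transcendental hA'
  have hfin := h.finrank_fieldRange h' hr.squarefree hd he.squarefree hd' ψ hpq hq hz
  rw [hψ] at hfin
  have hE : (ψ y') ^ 2 = aeval (ψ x') (rootCubic e₁ e₂ e₃) := by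
    rw [← map_pow, h'.equation, aeval_algHom_apply]
  have hqx := aeval_ne_zero_of_transcendental h.transcendental hq
  obtain ⟨R, hbR, hR⟩ := exists_aeval_eq_of_sq_mul h.transcendental
    (mul_mem hb (pow_mem (aeval_mem_of_mem (mem_adjoin_simple_self k x) q) 2)) hr.squarefree
    (g := q * (p - C e₁ * q) * (p - C e₂ * q) * (p - C e₃ * q)) (by
      have hy2 := h.equation
      rw [hby, aeval_rootCubic, mul_pow, hy2] at hE
      simp only [map_mul, map_sub, aeval_C, ← hz]
      linear_combination (aeval x q) ^ 4 * hE)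
  have hR0 : R ≠ 0 := by
    rintro rfl
    have hy0 : ψ y' ≠ 0 := by
      simpa using h'.ne_zero he.squarefree.ne_zero
    apply hy0
    rw [map_zero] at hbR
    rw [hby, (mul_eq_zero.1 hbR).resolve_right (pow_ne_zero 2 hqx), zero_mul]
  have hne : q * (p - C e₁ * q) * (p - C e₂ * q) * (p - C e₃ * q) ≠ 0 := by
    rw [hR]; exact mul_ne_zero hr.squarefree.ne_zero (pow_ne_zero 2 hR0)
  have n3 := right_ne_zero_of_mul hne
  have n2 := right_ne_zero_of_mul (left_ne_zero_of_mul hne)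
  have n1 := right_ne_zero_of_mul (left_ne_zero_of_mul (left_ne_zero_of_mul hne))
  rcases lt_or_ge q.natDegree p.natDegree with hlt | hge
  · exact ⟨p, q, R, hpq, hlt, by omega, hq, hR0, hR⟩
  have hle : ∀ e : k, (p - C e * q).natDegree ≤ q.natDegree := fun e =>
    (natDegree_sub_le _ _).trans (max_le hge (natDegree_C_mul_le _ _))
  -- the degrees cannot all be equal, for their sum is odd
  have hsum := congrArg natDegree hR
  rw [natDegree_mul (left_ne_zero_of_mul hne) n3,
    natDegree_mul (left_ne_zero_of_mul (left_ne_zero_of_mul hne)) n2, natDegree_mul hq n1,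
    natDegree_mul hr.squarefree.ne_zero (pow_ne_zero 2 hR0), natDegree_pow,
    natDegree_rootCubic] at hsum
  have l1 := hle e₁
  have l2 := hle e₂
  have l3 := hle e₃
  rw [hfin, max_eq_right hge]
  by_cases c1 : (p - C e₁ * q).natDegree < q.natDegree
  · exact exists_isIsogenyData_of_natDegree_lt he hpq hR0 n1 c1 hR
  by_cases c2 : (p - C e₂ * q).natDegree < q.natDegree
  · obtain ⟨p', q', R', a1, a2, a3, a4, a5, a6⟩ := exists_isIsogenyData_of_natDegree_lt
      (r₁ := r₁) (r₂ := r₂) (r₃ := r₃) (e₁ := e₂) (e₂ := e₁) (e₃ := e₃)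
      ⟨he.ne₁₂.symm, he.ne₂₃, he.ne₁₃⟩ hpq hR0 n2 c2 (by rw [← hR]; ring)
    exact ⟨p', q', R', a1, a2, a3, a4, a5, by rw [← a6]; ring⟩
  by_cases c3 : (p - C e₃ * q).natDegree < q.natDegree
  · obtain ⟨p', q', R', a1, a2, a3, a4, a5, a6⟩ := exists_isIsogenyData_of_natDegree_lt
      (r₁ := r₁) (r₂ := r₂) (r₃ := r₃) (e₁ := e₃) (e₂ := e₁) (e₃ := e₂)
      ⟨he.ne₁₃.symm, he.ne₂₃.symm, he.ne₁₂⟩ hpq hR0 n3 c3 (by rw [← hR]; ring)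
    exact ⟨p', q', R', a1, a2, a3, a4, a5, by rw [← a6]; ring⟩
  omega

/-- Conversely, isogeny data define an embedding by the universal property of the function field. -/
theorem IsIsogenyData.isogenousOfDegree {r₁ r₂ r₃ e₁ e₂ e₃ : k}
    (hr : AreDistinct r₁ r₂ r₃) (he : AreDistinct e₁ e₂ e₃) {x y : F} {x' y' : F'}
    (h : IsHyperellipticModel (rootCubic r₁ r₂ r₃) x y)
    (h' : IsHyperellipticModel (rootCubic e₁ e₂ e₃) x' y') {n : ℕ} {p q R : k[X]}
    (hD : IsIsogenyData r₁ r₂ r₃ e₁ e₂ e₃ n p q R) [IsAlgClosed k] :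
    IsogenousOfDegree k F F' n := by
  have hd : (rootCubic r₁ r₂ r₃).natDegree ≠ 0 := by rw [natDegree_rootCubic]; decide
  have hd' : (rootCubic e₁ e₂ e₃).natDegree ≠ 0 := by rw [natDegree_rootCubic]; decide
  have hqx := aeval_ne_zero_of_transcendental h.transcendental hD.ne_zero
  have hA : Transcendental k (aeval x p / aeval x q) := by
    intro hal
    obtain ⟨c, hc⟩ := hal.exists_eq_algebraMap
    rw [div_eq_iff hqx, ← aeval_C (A := F) x c, ← map_mul] at hc
    have hc' := transcendental_iff_injective.1 h.transcendental hc
    have := natDegree_C_mul_le c q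
    rw [← hc'] at this
    exact absurd hD.natDegree_lt (by omega)
  obtain ⟨φ, hφ, -⟩ := h'.exists_algHom he.squarefree hd' (b := y * aeval x R / aeval x q ^ 2) hA
    (by
      have hE := congrArg (aeval x) hD.equation
      rw [map_mul (aeval x) (rootCubic r₁ r₂ r₃), ← h.equation] at hE
      simp only [map_mul, map_sub, map_pow, aeval_C] at hE
      rw [aeval_rootCubic, div_pow, mul_pow, ← hE]
      field_simp)
  refine ⟨φ, ?_⟩
  rw [h.finrank_fieldRange h' hr.squarefree hd he.squarefree hd' φ hD.isCoprime hD.ne_zero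
    (by rw [hφ, div_mul_cancel₀ _ hqx]), max_eq_left hD.natDegree_lt.le, hD.natDegree_eq]

end IsogenyData

/-! ### The `j`-invariant in terms of the roots -/

section RootJ

open Polynomial IntermediateField

variable {k : Type*} [Field k]

theorem rootJ_mul_add (e₁ e₂ e₃ : k) {c : k} (hc : c ≠ 0) (d : k) :
    rootJ (c * e₁ + d) (c * e₂ + d) (c * e₃ + d) = rootJ e₁ e₂ e₃ := by
  rw [rootJ, rootJ, show ((c * e₁ + d - (c * e₂ + d)) * (c * e₁ + d - (c * e₃ + d)) *
    (c * e₂ + d - (c * e₃ + d))) ^ 2 = c ^ 6 * ((e₁ - e₂) * (e₁ - e₃) * (e₂ - e₃)) ^ 2 by ring,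
    show 256 * ((c * e₁ + d) ^ 2 + (c * e₂ + d) ^ 2 + (c * e₃ + d) ^ 2 -
      (c * e₁ + d) * (c * e₂ + d) - (c * e₁ + d) * (c * e₃ + d) -
      (c * e₂ + d) * (c * e₃ + d)) ^ 3 = c ^ 6 * (256 * (e₁ ^ 2 + e₂ ^ 2 + e₃ ^ 2 - e₁ * e₂ -
      e₁ * e₃ - e₂ * e₃) ^ 3) by ring]
  exact mul_div_mul_left _ _ (pow_ne_zero 6 hc)

theorem coeff_rootCubic (e₁ e₂ e₃ : k) : (rootCubic e₁ e₂ e₃).coeff 2 = -(e₁ + e₂ + e₃) ∧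
    (rootCubic e₁ e₂ e₃).coeff 1 = e₁ * e₂ + e₁ * e₃ + e₂ * e₃ ∧
    (rootCubic e₁ e₂ e₃).coeff 0 = -(e₁ * e₂ * e₃) := by
  have : rootCubic e₁ e₂ e₃ = X ^ 3 + C (-(e₁ + e₂ + e₃)) * X ^ 2 +
      C (e₁ * e₂ + e₁ * e₃ + e₂ * e₃) * X + C (-(e₁ * e₂ * e₃)) := by
    simp only [rootCubic, C_neg, C_add, C_mul]; ring
  rw [this]
  generalize -(e₁ + e₂ + e₃) = a
  generalize e₁ * e₂ + e₁ * e₃ + e₂ * e₃ = b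
  generalize -(e₁ * e₂ * e₃) = c
  refine ⟨?_, ?_, ?_⟩ <;> simp [coeff_X, coeff_C, coeff_X_pow]

/-- The `j`-invariant in terms of the coefficients of the cubic. -/
theorem rootJ_eq (e₁ e₂ e₃ : k) {a b c : k} (ha : a = e₁ + e₂ + e₃)
    (hb : b = e₁ * e₂ + e₁ * e₃ + e₂ * e₃) (hc : c = e₁ * e₂ * e₃) :
    rootJ e₁ e₂ e₃ = 256 * (a ^ 2 - 3 * b) ^ 3 /
      (a ^ 2 * b ^ 2 - 4 * b ^ 3 - 4 * a ^ 3 * c + 18 * a * b * c - 27 * c ^ 2) := by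
  rw [rootJ, ha, hb, hc]
  congr 1 <;> ring

theorem rootJ_eq_of_rootCubic_eq {e₁ e₂ e₃ r₁ r₂ r₃ : k}
    (h : rootCubic e₁ e₂ e₃ = rootCubic r₁ r₂ r₃) : rootJ e₁ e₂ e₃ = rootJ r₁ r₂ r₃ := by
  obtain ⟨h2, h1, h0⟩ := coeff_rootCubic e₁ e₂ e₃
  obtain ⟨g2, g1, g0⟩ := coeff_rootCubic r₁ r₂ r₃
  rw [h] at h2 h1 h0
  rw [rootJ_eq e₁ e₂ e₃ rfl rfl rfl]
  exact (rootJ_eq r₁ r₂ r₃ (neg_injective (h2.symm.trans g2)) (h1.symm.trans g1)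
    (neg_injective (h0.symm.trans g0))).symm

/-- The `j`-invariants of the two curves of the universal isogeny of degree two, in terms of the
Hauptmodul `h = 16 (t₁ - t₂)² / (t₁ t₂)`. -/
theorem rootJ_two {t₁ t₂ a : k} (ha : a ^ 2 = t₁ * t₂) (h0 : t₁ * t₂ ≠ 0) (h12 : t₁ ≠ t₂)
    [CharZero k] : ∃ h : k, h ≠ 0 ∧ h * (t₁ * t₂) = 16 * (t₁ - t₂) ^ 2 ∧
      rootJ 0 t₁ t₂ = (h + 16) ^ 3 / h ∧
      rootJ (t₁ + t₂) (2 * a) (-(2 * a)) = (h + 256) ^ 3 / h ^ 2 := by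
  have hs : t₁ - t₂ ≠ 0 := sub_ne_zero.2 h12
  have ht1 := left_ne_zero_of_mul h0
  have ht2 := right_ne_zero_of_mul h0
  have hd : ((t₁ + t₂ - 2 * a) * (t₁ + t₂ - -(2 * a)) * (2 * a - -(2 * a))) ^ 2 =
      16 * (t₁ * t₂) * (t₁ - t₂) ^ 4 := by
    have : (t₁ + t₂ - 2 * a) * (t₁ + t₂ - -(2 * a)) = (t₁ - t₂) ^ 2 := by
      linear_combination -4 * ha
    rw [this, show (2 * a - -(2 * a)) = 4 * a by ring, mul_pow, mul_pow, ha]; ring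
  have hn : (t₁ + t₂) ^ 2 + (2 * a) ^ 2 + (-(2 * a)) ^ 2 - (t₁ + t₂) * (2 * a) -
      (t₁ + t₂) * -(2 * a) - 2 * a * -(2 * a) = (t₁ - t₂) ^ 2 + 16 * (t₁ * t₂) := by
    linear_combination 12 * ha
  refine ⟨16 * (t₁ - t₂) ^ 2 / (t₁ * t₂), ?_, ?_, ?_, ?_⟩
  · exact div_ne_zero (mul_ne_zero (by norm_num) (pow_ne_zero 2 hs)) h0
  · field_simp
  · rw [rootJ]
    have : (0 - t₁) * (0 - t₂) * (t₁ - t₂) ≠ 0 := by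
      rw [zero_sub, zero_sub, neg_mul_neg]; exact mul_ne_zero h0 hs
    field_simp
    ring
  · rw [rootJ, hd, hn]
    field_simp
    ring

/-- The `j`-invariants of the two curves of the universal isogeny of degree three, in terms of the
Hauptmodul `h`, which is the discriminant of the cubic with roots `a₁, a₂, a₃` divided by
`(a₁ a₂ a₃)²`. -/
theorem rootJ_three [CharZero k] {a₁ a₂ a₃ : k} (hs : a₁ + a₂ + a₃ = 0) (ha : AreDistinct a₁ a₂ a₃)
    (h0 : a₁ * a₂ * a₃ ≠ 0) :
    ∃ h : k, h ≠ 0 ∧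
      (h + 27) * (a₁ * a₂ * a₃) ^ 2 = 4 * (a₁ ^ 2 + a₁ * a₂ + a₂ ^ 2) ^ 3 ∧
      rootJ (-(a₂ * a₃ / (2 * a₁))) (-(a₁ * a₃ / (2 * a₂))) (-(a₁ * a₂ / (2 * a₃))) =
        (h + 27) * (h + 3) ^ 3 / h ∧
      rootJ (-(a₂ * a₃ / (2 * a₁)) + 2 * a₁) (-(a₁ * a₃ / (2 * a₂)) + 2 * a₂)
        (-(a₁ * a₂ / (2 * a₃)) + 2 * a₃) = (h + 27) * (h + 243) ^ 3 / h ^ 3 := by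
  obtain ⟨w, hw⟩ : ∃ w, w = a₁ * a₂ * a₃ := ⟨_, rfl⟩
  have hw0 : w ≠ 0 := hw ▸ h0
  have h1 : a₁ ≠ 0 := by rintro rfl; simp at h0
  have h2 : a₂ ≠ 0 := by rintro rfl; simp at h0
  have h3 : a₃ ≠ 0 := by rintro rfl; simp at h0
  obtain rfl : a₃ = -a₁ - a₂ := by linear_combination hs
  obtain ⟨z, hz⟩ : ∃ z, z = a₁ ^ 2 + a₁ * a₂ + a₂ ^ 2 := ⟨_, rfl⟩
  obtain ⟨D, hD⟩ : ∃ D, D = 4 * z ^ 3 - 27 * w ^ 2 := ⟨_, rfl⟩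
  have hD' : D = ((a₁ - a₂) * (a₁ - (-a₁ - a₂)) * (a₂ - (-a₁ - a₂))) ^ 2 := by
    rw [hD, hz, hw]; ring
  have hD0 : D ≠ 0 := by rw [hD']; exact ha.sq_ne_zero
  have hc : (-(2 * w))⁻¹ ≠ 0 := inv_ne_zero (neg_ne_zero.2 (mul_ne_zero two_ne_zero hw0))
  refine ⟨D / w ^ 2, div_ne_zero hD0 (pow_ne_zero 2 hw0), ?_, ?_, ?_⟩
  · rw [← hw, ← hz]; field_simp; rw [hD]; ring
  · have := rootJ_mul_add ((a₂ * (-a₁ - a₂)) ^ 2) ((a₁ * (-a₁ - a₂)) ^ 2) ((a₁ * a₂) ^ 2) hc 0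
    rw [show (-(2 * w))⁻¹ * (a₂ * (-a₁ - a₂)) ^ 2 + 0 = -(a₂ * (-a₁ - a₂) / (2 * a₁)) by
        rw [hw]; field_simp; ring,
      show (-(2 * w))⁻¹ * (a₁ * (-a₁ - a₂)) ^ 2 + 0 = -(a₁ * (-a₁ - a₂) / (2 * a₂)) by
        rw [hw]; field_simp; ring,
      show (-(2 * w))⁻¹ * (a₁ * a₂) ^ 2 + 0 = -(a₁ * a₂ / (2 * (-a₁ - a₂))) by
        rw [hw]; field_simp; ring] at this
    rw [this, rootJ, show (((a₂ * (-a₁ - a₂)) ^ 2 - (a₁ * (-a₁ - a₂)) ^ 2) *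
      ((a₂ * (-a₁ - a₂)) ^ 2 - (a₁ * a₂) ^ 2) *
      ((a₁ * (-a₁ - a₂)) ^ 2 - (a₁ * a₂) ^ 2)) ^ 2 = w ^ 6 * D by rw [hD', hw]; ring,
      show ((a₂ * (-a₁ - a₂)) ^ 2) ^ 2 + ((a₁ * (-a₁ - a₂)) ^ 2) ^ 2 + ((a₁ * a₂) ^ 2) ^ 2 -
        (a₂ * (-a₁ - a₂)) ^ 2 * (a₁ * (-a₁ - a₂)) ^ 2 - (a₂ * (-a₁ - a₂)) ^ 2 * (a₁ * a₂) ^ 2 -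
        (a₁ * (-a₁ - a₂)) ^ 2 * (a₁ * a₂) ^ 2 = z * (z ^ 3 - 6 * w ^ 2) by rw [hz, hw]; ring]
    field_simp
    rw [hD]
    ring
  · have := rootJ_mul_add ((a₂ * (-a₁ - a₂)) ^ 2 - 4 * w * a₁) ((a₁ * (-a₁ - a₂)) ^ 2 - 4 * w * a₂)
      ((a₁ * a₂) ^ 2 - 4 * w * (-a₁ - a₂)) hc 0
    rw [show (-(2 * w))⁻¹ * ((a₂ * (-a₁ - a₂)) ^ 2 - 4 * w * a₁) + 0 =
          -(a₂ * (-a₁ - a₂) / (2 * a₁)) + 2 * a₁ by rw [hw]; field_simp; ring,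
      show (-(2 * w))⁻¹ * ((a₁ * (-a₁ - a₂)) ^ 2 - 4 * w * a₂) + 0 =
          -(a₁ * (-a₁ - a₂) / (2 * a₂)) + 2 * a₂ by rw [hw]; field_simp; ring,
      show (-(2 * w))⁻¹ * ((a₁ * a₂) ^ 2 - 4 * w * (-a₁ - a₂)) + 0 =
          -(a₁ * a₂ / (2 * (-a₁ - a₂))) + 2 * (-a₁ - a₂) by rw [hw]; field_simp; ring] at this
    rw [this, rootJ, show (((a₂ * (-a₁ - a₂)) ^ 2 - 4 * w * a₁ -
        ((a₁ * (-a₁ - a₂)) ^ 2 - 4 * w * a₂)) * ((a₂ * (-a₁ - a₂)) ^ 2 - 4 * w * a₁ -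
        ((a₁ * a₂) ^ 2 - 4 * w * (-a₁ - a₂))) * ((a₁ * (-a₁ - a₂)) ^ 2 - 4 * w * a₂ -
        ((a₁ * a₂) ^ 2 - 4 * w * (-a₁ - a₂)))) ^ 2 = w ^ 2 * D ^ 3 by rw [hD', hw]; ring,
      show ((a₂ * (-a₁ - a₂)) ^ 2 - 4 * w * a₁) ^ 2 + ((a₁ * (-a₁ - a₂)) ^ 2 - 4 * w * a₂) ^ 2 +
        ((a₁ * a₂) ^ 2 - 4 * w * (-a₁ - a₂)) ^ 2 -
        ((a₂ * (-a₁ - a₂)) ^ 2 - 4 * w * a₁) * ((a₁ * (-a₁ - a₂)) ^ 2 - 4 * w * a₂) -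
        ((a₂ * (-a₁ - a₂)) ^ 2 - 4 * w * a₁) * ((a₁ * a₂) ^ 2 - 4 * w * (-a₁ - a₂)) -
        ((a₁ * (-a₁ - a₂)) ^ 2 - 4 * w * a₂) * ((a₁ * a₂) ^ 2 - 4 * w * (-a₁ - a₂)) =
        z * (z ^ 3 + 54 * w ^ 2) by rw [hz, hw]; ring]
    field_simp
    rw [hD]
    ring

end RootJ

/-! ### Ramification of the abscissa of an isogeny -/

section Degrees

open Polynomial IntermediateField

variable {k : Type*} [Field k]

theorem Polynomial.exists_eq_C_mul_X_sub_C {f : k[X]} (h : f.natDegree = 1) :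
    ∃ a r : k, a ≠ 0 ∧ f = C a * (X - C r) := by
  obtain ⟨a, ha, b, rfl⟩ := natDegree_eq_one.1 h
  refine ⟨a, -b / a, ha, ?_⟩
  rw [mul_sub, ← C_mul, mul_div_cancel₀ _ ha, C_neg]; ring

theorem Polynomial.natDegree_and_ne_zero_of_eq_mul_sq {a f b : k[X]} (ha : a ≠ 0)
    (h : a = f * b ^ 2) : f ≠ 0 ∧ b ≠ 0 ∧ a.natDegree = f.natDegree + 2 * b.natDegree := by
  subst h
  have hb : b ≠ 0 := by rintro rfl; simp at ha
  have hf := left_ne_zero_of_mul ha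
  exact ⟨hf, hb, by rw [natDegree_mul hf (pow_ne_zero 2 hb), natDegree_pow]⟩

theorem rootCubic_monic (e₁ e₂ e₃ : k) : (rootCubic e₁ e₂ e₃).Monic :=
  ((monic_X_sub_C _).mul (monic_X_sub_C _)).mul (monic_X_sub_C _)

namespace IsIsogenyData

variable {r₁ r₂ r₃ e₁ e₂ e₃ : k} {n : ℕ} {p q R : k[X]}

theorem natDegree_sub (h : IsIsogenyData r₁ r₂ r₃ e₁ e₂ e₃ n p q R) (e : k) :
    (p - C e * q).natDegree = n ∧ (p - C e * q).leadingCoeff = p.leadingCoeff := by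
  have hlt : (C e * q).degree < p.degree :=
    degree_lt_degree ((natDegree_C_mul_le _ _).trans_lt h.natDegree_lt)
  exact ⟨by rw [natDegree_eq_of_degree_eq (degree_sub_eq_left_of_degree_lt hlt), h.natDegree_eq],
    leadingCoeff_sub_of_degree_lt hlt⟩

theorem sub_ne_zero (h : IsIsogenyData r₁ r₂ r₃ e₁ e₂ e₃ n p q R) (e : k) :
    p - C e * q ≠ 0 := by
  intro h0
  have h1 := (h.natDegree_sub e).2
  rw [h0, leadingCoeff_zero, eq_comm, leadingCoeff_eq_zero] at h1
  have h2 := h.natDegree_lt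
  rw [h1] at h2
  simp at h2

/-- The squarefree parts of the denominator and of the three numerators, with their degrees. -/
theorem exists_squarefree_parts (h : IsIsogenyData r₁ r₂ r₃ e₁ e₂ e₃ n p q R)
    (hr : AreDistinct r₁ r₂ r₃) (he : AreDistinct e₁ e₂ e₃) :
    ∃ f₀ f₁ f₂ f₃ b₀ b₁ b₂ b₃ : k[X], q = f₀ * b₀ ^ 2 ∧ p - C e₁ * q = f₁ * b₁ ^ 2 ∧
      p - C e₂ * q = f₂ * b₂ ^ 2 ∧ p - C e₃ * q = f₃ * b₃ ^ 2 ∧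
      (∃ u : k, u ≠ 0 ∧ f₀ * f₁ * f₂ * f₃ = C u * rootCubic r₁ r₂ r₃) ∧
      (f₀.natDegree + f₁.natDegree + f₂.natDegree + f₃.natDegree = 3) ∧
      (b₀ ≠ 0 ∧ b₁ ≠ 0 ∧ b₂ ≠ 0 ∧ b₃ ≠ 0) ∧
      q.natDegree = f₀.natDegree + 2 * b₀.natDegree ∧ n = f₁.natDegree + 2 * b₁.natDegree ∧
      n = f₂.natDegree + 2 * b₂.natDegree ∧ n = f₃.natDegree + 2 * b₃.natDegree := by
  obtain ⟨f₀, f₁, f₂, f₃, b₀, b₁, b₂, b₃, E0, E1, E2, E3, u, hu, hf⟩ :=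
    Polynomial.exists_squarefree_parts (h.isCoprime.pencil_left e₁) (h.isCoprime.pencil_left e₂)
      (h.isCoprime.pencil_left e₃) (h.isCoprime.pencil he.ne₁₂) (h.isCoprime.pencil he.ne₁₃)
      (h.isCoprime.pencil he.ne₂₃) hr.squarefree h.ne_zero' h.equation
  obtain ⟨z0, c0, d0⟩ := natDegree_and_ne_zero_of_eq_mul_sq h.ne_zero E0
  obtain ⟨z1, c1, d1⟩ := natDegree_and_ne_zero_of_eq_mul_sq (h.sub_ne_zero e₁) E1
  obtain ⟨z2, c2, d2⟩ := natDegree_and_ne_zero_of_eq_mul_sq (h.sub_ne_zero e₂) E2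
  obtain ⟨z3, c3, d3⟩ := natDegree_and_ne_zero_of_eq_mul_sq (h.sub_ne_zero e₃) E3
  rw [(h.natDegree_sub _).1] at d1 d2 d3
  refine ⟨f₀, f₁, f₂, f₃, b₀, b₁, b₂, b₃, E0, E1, E2, E3, ⟨u, hu, hf⟩, ?_, ⟨c0, c1, c2, c3⟩, d0,
    d1, d2, d3⟩
  have := congrArg natDegree hf
  rwa [natDegree_mul (mul_ne_zero (mul_ne_zero z0 z1) z2) z3,
    natDegree_mul (mul_ne_zero z0 z1) z2, natDegree_mul z0 z1, natDegree_C_mul hu,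
    natDegree_rootCubic] at this

/-- In odd degree the three numerators carry one branch point each, and the denominator is a
square. -/
theorem exists_of_odd (h : IsIsogenyData r₁ r₂ r₃ e₁ e₂ e₃ n p q R)
    (hr : AreDistinct r₁ r₂ r₃) (he : AreDistinct e₁ e₂ e₃) (hn : Odd n) :
    ∃ (t₁ t₂ t₃ : k) (b₀ b₁ b₂ b₃ : k[X]), rootCubic t₁ t₂ t₃ = rootCubic r₁ r₂ r₃ ∧
      (∃ g : k, g ≠ 0 ∧ q = C g * b₀ ^ 2) ∧
      (∃ g : k, p - C e₁ * q = C g * (X - C t₁) * b₁ ^ 2) ∧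
      (∃ g : k, p - C e₂ * q = C g * (X - C t₂) * b₂ ^ 2) ∧
      (∃ g : k, p - C e₃ * q = C g * (X - C t₃) * b₃ ^ 2) ∧
      n = 1 + 2 * b₁.natDegree ∧ n = 1 + 2 * b₂.natDegree ∧ n = 1 + 2 * b₃.natDegree := by
  obtain ⟨f₀, f₁, f₂, f₃, b₀, b₁, b₂, b₃, E0, E1, E2, E3, ⟨u, hu, hf⟩, hsum, -, d0,
    d1, d2, d3⟩ := h.exists_squarefree_parts hr he
  obtain ⟨m, hm⟩ := hn
  have g1 : f₁.natDegree = 1 := by omega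
  have g2 : f₂.natDegree = 1 := by omega
  have g3 : f₃.natDegree = 1 := by omega
  have g0 : f₀.natDegree = 0 := by omega
  obtain ⟨c₁, t₁, hc1, rfl⟩ := exists_eq_C_mul_X_sub_C g1
  obtain ⟨c₂, t₂, hc2, rfl⟩ := exists_eq_C_mul_X_sub_C g2
  obtain ⟨c₃, t₃, hc3, rfl⟩ := exists_eq_C_mul_X_sub_C g3
  obtain ⟨c₀, rfl⟩ := natDegree_eq_zero.1 g0
  have hc0 : c₀ ≠ 0 := by
    rintro rfl
    exact h.ne_zero (by rw [E0, C_0, zero_mul])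
  refine ⟨t₁, t₂, t₃, b₀, b₁, b₂, b₃, ?_, ⟨c₀, hc0, E0⟩, ⟨c₁, E1⟩, ⟨c₂, E2⟩, ⟨c₃, E3⟩,
    by omega, by omega, by omega⟩
  have h1 : C (c₀ * c₁ * c₂ * c₃) * rootCubic t₁ t₂ t₃ = C u * rootCubic r₁ r₂ r₃ := by
    rw [← hf, rootCubic]; simp only [C_mul]; ring
  have h2 := congrArg leadingCoeff h1
  rw [leadingCoeff_mul, leadingCoeff_mul, rootCubic_monic, rootCubic_monic, leadingCoeff_C,
    leadingCoeff_C, mul_one, mul_one] at h2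
  rw [h2] at h1
  exact mul_left_cancel₀ (C_ne_zero.2 hu) h1

/-- An isogeny of degree one preserves the `j`-invariant. -/
theorem rootJ_eq_of_one (h : IsIsogenyData r₁ r₂ r₃ e₁ e₂ e₃ 1 p q R)
    (hr : AreDistinct r₁ r₂ r₃) (he : AreDistinct e₁ e₂ e₃) :
    rootJ r₁ r₂ r₃ = rootJ e₁ e₂ e₃ := by
  obtain ⟨t₁, t₂, t₃, b₀, b₁, b₂, b₃, ht, -, ⟨g₁, h1⟩, ⟨g₂, h2⟩, ⟨g₃, h3⟩, -, -, -⟩ :=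
    h.exists_of_odd hr he odd_one
  obtain ⟨m, r, hm, hp⟩ := exists_eq_C_mul_X_sub_C h.natDegree_eq
  have hq0 : q.natDegree = 0 := by
    have := h.natDegree_lt; have := h.natDegree_eq; omega
  obtain ⟨g, rfl⟩ := natDegree_eq_zero.1 hq0
  have hg : g ≠ 0 := C_ne_zero.1 h.ne_zero
  have key : ∀ {e t c : k} {b : k[X]}, p - C e * C g = C c * (X - C t) * b ^ 2 →
      e = m / g * t + -(m * r / g) := by
    intro e t c b h
    have h1 := congrArg (eval t) h
    rw [hp] at h1
    simp only [eval_sub, eval_mul, eval_C, eval_X, sub_self, mul_zero, zero_mul] at h1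
    field_simp
    linear_combination -h1
  rw [← rootJ_eq_of_rootCubic_eq ht, key h1, key h2, key h3, rootJ_mul_add _ _ _
    (div_ne_zero hm hg)]

end IsIsogenyData

end Degrees

/-! ### Isogenies of degree two -/

section LowDegree

open Polynomial IntermediateField

variable {k : Type*} [Field k]

theorem AreDistinct.of_squarefree {e₁ e₂ e₃ : k} (h : Squarefree (rootCubic e₁ e₂ e₃)) :
    AreDistinct e₁ e₂ e₃ := by
  have key : ∀ a b : k, (X - C a) * (X - C b) ∣ rootCubic e₁ e₂ e₃ → a ≠ b := by
    rintro a b hd rfl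
    exact not_isUnit_X_sub_C a (h _ hd)
  exact ⟨key _ _ ⟨X - C e₃, rfl⟩, key _ _ ⟨X - C e₂, by rw [rootCubic]; ring⟩,
    key _ _ ⟨X - C e₁, by rw [rootCubic]; ring⟩⟩

theorem rootJ_swap₁₂ (e₁ e₂ e₃ : k) : rootJ e₂ e₁ e₃ = rootJ e₁ e₂ e₃ :=
  rootJ_eq_of_rootCubic_eq (by rw [rootCubic, rootCubic]; ring)

theorem rootJ_swap₁₃ (e₁ e₂ e₃ : k) : rootJ e₃ e₂ e₁ = rootJ e₁ e₂ e₃ :=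
  rootJ_eq_of_rootCubic_eq (by rw [rootCubic, rootCubic]; ring)

theorem Polynomial.exists_eq_C_mul_X_sub_C_mul_X_sub_C [IsAlgClosed k] {f : k[X]}
    (h : f.natDegree = 2) : ∃ a r s : k, a ≠ 0 ∧ f = C a * ((X - C r) * (X - C s)) := by
  obtain ⟨r, hr⟩ := IsAlgClosed.exists_root f (by
    intro h0
    exact absurd (h.symm.trans (natDegree_eq_of_degree_eq_some h0)) (by norm_num))
  obtain ⟨g, rfl⟩ := dvd_iff_isRoot.2 hr
  have hg : g ≠ 0 := by rintro rfl; simp at h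
  rw [natDegree_mul (X_sub_C_ne_zero r) hg, natDegree_X_sub_C] at h
  obtain ⟨a, s, ha, rfl⟩ := exists_eq_C_mul_X_sub_C (f := g) (by omega)
  exact ⟨a, r, s, ha, by ring⟩

namespace IsIsogenyData

variable {r₁ r₂ r₃ e₁ e₂ e₃ : k} {n : ℕ} {p q R : k[X]}

theorem eval_ne_zero (h : IsIsogenyData r₁ r₂ r₃ e₁ e₂ e₃ n p q R) {x : k}
    (hx : p.eval x = 0) : q.eval x ≠ 0 := by
  intro hq
  obtain ⟨a, b, hab⟩ := h.isCoprime
  have := congrArg (eval x) hab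
  simp [hx, hq] at this

variable [CharZero k]

/-- A quadratic function `p / q` whose poles are `d` and infinity, whose fibre over `e₁` consists of
two branch points, and which is ramified over `e₂` and `e₃`, is the abscissa of the universal
isogeny of degree two up to affine changes of coordinates. -/
theorem exists_of_two_of_eq (hr : AreDistinct r₁ r₂ r₃) (he : AreDistinct e₁ e₂ e₃)
    {d t₁ t₂ a b m g : k} (ht : rootCubic d t₁ t₂ = rootCubic r₁ r₂ r₃) (hm : m ≠ 0) (hg : g ≠ 0)
    (hq : q = C g * (X - C d)) (h1 : p - C e₁ * q = C m * ((X - C t₁) * (X - C t₂)))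
    (h2 : p - C e₂ * q = C m * (X - C a) ^ 2) (h3 : p - C e₃ * q = C m * (X - C b) ^ 2) :
    ∃ w : k, w ≠ 0 ∧ rootJ r₁ r₂ r₃ = (w + 16) ^ 3 / w ∧
      rootJ e₁ e₂ e₃ = (w + 256) ^ 3 / w ^ 2 := by
  have hd : AreDistinct d t₁ t₂ := .of_squarefree (ht ▸ hr.squarefree)
  have a1 := congrArg (eval d) h1
  have a2 := congrArg (eval d) h2
  have a3 := congrArg (eval d) h3
  have b1 := congrArg (eval (d + 1)) h1
  have b2 := congrArg (eval (d + 1)) h2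
  have b3 := congrArg (eval (d + 1)) h3
  simp only [hq, eval_sub, eval_mul, eval_C, eval_X, eval_pow, sub_self, mul_zero, sub_zero,
    add_sub_cancel_left, mul_one] at a1 a2 a3 b1 b2 b3
  have hA : (a - d) ^ 2 = (t₁ - d) * (t₂ - d) := by
    apply mul_left_cancel₀ hm; linear_combination a1 - a2
  have hB : (b - d) ^ 2 = (t₁ - d) * (t₂ - d) := by
    apply mul_left_cancel₀ hm; linear_combination a1 - a3
  have h23 : (e₂ - e₃) * g = m * (2 * (a - b)) := by
    linear_combination b3 - b2 + m * (hB - hA)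
  have hne : a ≠ b := by
    rintro rfl
    rw [sub_self, mul_zero, mul_zero] at h23
    exact mul_ne_zero (_root_.sub_ne_zero.2 he.ne₂₃) hg h23
  have hba : b - d = -(a - d) := by
    have : (a - b) * (a - d + (b - d)) = 0 := by linear_combination hA - hB
    linear_combination (mul_eq_zero.1 this).resolve_left (_root_.sub_ne_zero.2 hne)
  have h12 : (e₁ - e₂) * g = m * ((t₁ - d) + (t₂ - d) - 2 * (a - d)) := by
    linear_combination b2 - b1 + m * hA
  obtain ⟨w, hw, -, hw1, hw2⟩ := rootJ_two hA (mul_ne_zero (_root_.sub_ne_zero.2 hd.ne₁₂.symm)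
    (_root_.sub_ne_zero.2 hd.ne₁₃.symm)) (fun h0 => hd.ne₂₃ (sub_left_injective h0))
  refine ⟨w, hw, ?_, ?_⟩
  · rw [← rootJ_eq_of_rootCubic_eq ht, ← hw1, ← rootJ_mul_add 0 (t₁ - d) (t₂ - d) one_ne_zero d]
    congr 1 <;> ring
  · rw [← hw2]
    refine Eq.trans ?_ (rootJ_mul_add _ _ _ (div_ne_zero hm hg) (e₂ - m / g * (2 * (a - d))))
    congr 1
    · field_simp; linear_combination h12
    · ring
    · field_simp; linear_combination -h23 + 2 * m * hba

/-- The case of isogeny data of degree two in which the numerator `p - e₁ q` is squarefree, stated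
in terms of the degrees of the squarefree parts. -/
theorem exists_of_two_of_natDegree (h : IsIsogenyData r₁ r₂ r₃ e₁ e₂ e₃ 2 p q R) [IsAlgClosed k]
    (hr : AreDistinct r₁ r₂ r₃) (he : AreDistinct e₁ e₂ e₃) {f₀ f₁ f₂ f₃ b₀ b₁ b₂ b₃ : k[X]}
    (E0 : q = f₀ * b₀ ^ 2) (E1 : p - C e₁ * q = f₁ * b₁ ^ 2) (E2 : p - C e₂ * q = f₂ * b₂ ^ 2)
    (E3 : p - C e₃ * q = f₃ * b₃ ^ 2) {u : k} (hu : u ≠ 0)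
    (hf : f₀ * f₁ * f₂ * f₃ = C u * rootCubic r₁ r₂ r₃)
    (d0 : f₀.natDegree = 1) (c0 : b₀.natDegree = 0) (d1 : f₁.natDegree = 2)
    (c1 : b₁.natDegree = 0) (d2 : f₂.natDegree = 0) (c2 : b₂.natDegree = 1)
    (d3 : f₃.natDegree = 0) (c3 : b₃.natDegree = 1) :
    ∃ w : k, w ≠ 0 ∧ rootJ r₁ r₂ r₃ = (w + 16) ^ 3 / w ∧
      rootJ e₁ e₂ e₃ = (w + 256) ^ 3 / w ^ 2 := by
  obtain ⟨x₀, d, hx0, rfl⟩ := exists_eq_C_mul_X_sub_C d0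
  obtain ⟨x₁, t₁, t₂, hx1, rfl⟩ := exists_eq_C_mul_X_sub_C_mul_X_sub_C d1
  obtain ⟨x₂, rfl⟩ := natDegree_eq_zero.1 d2
  obtain ⟨x₃, rfl⟩ := natDegree_eq_zero.1 d3
  obtain ⟨y₀, rfl⟩ := natDegree_eq_zero.1 c0
  obtain ⟨y₁, rfl⟩ := natDegree_eq_zero.1 c1
  obtain ⟨y₂, a, hy2, rfl⟩ := exists_eq_C_mul_X_sub_C c2
  obtain ⟨y₃, b, hy3, rfl⟩ := exists_eq_C_mul_X_sub_C c3
  obtain ⟨m, hm⟩ : ∃ m, m = p.leadingCoeff := ⟨_, rfl⟩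
  have lead : ∀ {e c : k} {f : k[X]}, f.Monic → p - C e * q = C c * f →
      p - C e * q = C m * f := by
    intro e c f hf0 hE
    have := (h.natDegree_sub e).2
    rw [hE, leadingCoeff_mul, leadingCoeff_C, hf0, mul_one, ← hm] at this
    rw [hE, this]
  have hm0 : m ≠ 0 := by
    rw [hm, leadingCoeff_ne_zero]
    rintro rfl
    simpa using h.natDegree_eq
  refine exists_of_two_of_eq (g := x₀ * y₀ ^ 2) (d := d) hr he ?_ hm0 ?_ ?_
    (lead (c := x₁ * y₁ ^ 2) ((monic_X_sub_C t₁).mul (monic_X_sub_C t₂)) ?_)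
    (lead (c := x₂ * y₂ ^ 2) ((monic_X_sub_C a).pow 2) ?_)
    (lead (c := x₃ * y₃ ^ 2) ((monic_X_sub_C b).pow 2) ?_)
  · have h1 : C (x₀ * x₁ * x₂ * x₃) * rootCubic d t₁ t₂ = C u * rootCubic r₁ r₂ r₃ := by
      rw [← hf, rootCubic]; simp only [C_mul]; ring
    have h2 := congrArg leadingCoeff h1
    rw [leadingCoeff_mul, leadingCoeff_mul, rootCubic_monic, rootCubic_monic, leadingCoeff_C,
      leadingCoeff_C, mul_one, mul_one] at h2
    rw [h2] at h1
    exact mul_left_cancel₀ (C_ne_zero.2 hu) h1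
  · intro h0
    apply h.ne_zero
    rw [E0]
    have : (C (x₀ * y₀ ^ 2) : k[X]) = 0 := by rw [h0, C_0]
    rw [C_mul, C_pow] at this
    linear_combination (X - C d) * this
  · rw [E0]; simp only [C_mul, C_pow]; ring
  · rw [E1]; simp only [C_mul, C_pow]; ring
  · rw [E2]; simp only [C_mul, C_pow]; ring
  · rw [E3]; simp only [C_mul, C_pow]; ring

/-- The `j`-invariants of curves related by isogeny data of degree two. Of the four polynomials `q`
and `p - eᵢ q`, the degrees of the squarefree parts are odd only for `q` and add up to three, so
exactly one numerator is squarefree and the other two are squares up to constants. -/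
theorem exists_of_two (h : IsIsogenyData r₁ r₂ r₃ e₁ e₂ e₃ 2 p q R) [IsAlgClosed k]
    (hr : AreDistinct r₁ r₂ r₃) (he : AreDistinct e₁ e₂ e₃) :
    ∃ w : k, w ≠ 0 ∧ rootJ r₁ r₂ r₃ = (w + 16) ^ 3 / w ∧
      rootJ e₁ e₂ e₃ = (w + 256) ^ 3 / w ^ 2 := by
  obtain ⟨f₀, f₁, f₂, f₃, b₀, b₁, b₂, b₃, E0, E1, E2, E3, ⟨u, hu, hf⟩, hsum, -, d0,
    d1, d2, d3⟩ := h.exists_squarefree_parts hr he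
  have hlt := h.natDegree_lt
  rw [h.natDegree_eq] at hlt
  by_cases c1 : f₁.natDegree = 2
  · exact h.exists_of_two_of_natDegree hr he E0 E1 E2 E3 hu hf (by omega) (by omega) c1 (by omega)
      (by omega) (by omega) (by omega) (by omega)
  by_cases c2 : f₂.natDegree = 2
  · have h' : IsIsogenyData r₁ r₂ r₃ e₂ e₁ e₃ 2 p q R :=
      ⟨h.isCoprime, h.natDegree_lt, h.natDegree_eq, h.ne_zero, h.ne_zero',
        by rw [← h.equation]; ring⟩
    rw [← rootJ_swap₁₂ e₁ e₂ e₃]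
    exact h'.exists_of_two_of_natDegree hr ⟨he.ne₁₂.symm, he.ne₂₃, he.ne₁₃⟩ E0 E2 E1 E3 hu
      (by rw [← hf]; ring) (by omega) (by omega) c2 (by omega)
      (by omega) (by omega) (by omega) (by omega)
  · have h' : IsIsogenyData r₁ r₂ r₃ e₃ e₂ e₁ 2 p q R :=
      ⟨h.isCoprime, h.natDegree_lt, h.natDegree_eq, h.ne_zero, h.ne_zero',
        by rw [← h.equation]; ring⟩
    rw [← rootJ_swap₁₃ e₁ e₂ e₃]
    exact h'.exists_of_two_of_natDegree hr ⟨he.ne₂₃.symm, he.ne₁₃.symm, he.ne₁₂.symm⟩ E0 E3 E2 E1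
      hu (by rw [← hf]; ring) (by omega) (by omega) (by omega) (by omega)
      (by omega) (by omega) (by omega) (by omega)

end IsIsogenyData

end LowDegree

/-! ### Isogenies of degree three -/

section DegreeThree

open Polynomial IntermediateField

variable {k : Type*} [Field k]

namespace IsIsogenyData

variable {r₁ r₂ r₃ e₁ e₂ e₃ : k} {n : ℕ} {p q R : k[X]}

/-- Members of the pencil have no common roots. -/
theorem ne_of_eval (h : IsIsogenyData r₁ r₂ r₃ e₁ e₂ e₃ n p q R) {e e' s s' : k} (he : e ≠ e')
    (h1 : (p - C e * q).eval s = 0) (h2 : (p - C e' * q).eval s' = 0) : s ≠ s' := by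
  rintro rfl
  simp only [eval_sub, eval_mul, eval_C] at h1 h2
  have hq : q.eval s = 0 := by
    have : (e - e') * q.eval s = 0 := by linear_combination h2 - h1
    exact (mul_eq_zero.1 this).resolve_left (_root_.sub_ne_zero.2 he)
  rw [hq, mul_zero, sub_zero] at h1
  exact h.eval_ne_zero h1 hq

variable [CharZero k]

/-- The `j`-invariants of curves related by isogeny data of degree three. Each numerator has one
simple and one double root, and `q` has a double root `d`; the distances `aᵢ` of the double roots
from `d` have sum zero and determine the isogeny. -/
theorem exists_of_three (h : IsIsogenyData r₁ r₂ r₃ e₁ e₂ e₃ 3 p q R)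
    (hr : AreDistinct r₁ r₂ r₃) (he : AreDistinct e₁ e₂ e₃) :
    ∃ w : k, w ≠ 0 ∧ rootJ r₁ r₂ r₃ = (w + 27) * (w + 3) ^ 3 / w ∧
      rootJ e₁ e₂ e₃ = (w + 27) * (w + 243) ^ 3 / w ^ 3 := by
  obtain ⟨t₁, t₂, t₃, b₀, b₁, b₂, b₃, ht, ⟨c, hc, E0⟩, ⟨g₁, E1⟩, ⟨g₂, E2⟩, ⟨g₃, E3⟩, d1, d2, d3⟩ :=
    h.exists_of_odd hr he (by decide)
  obtain ⟨y₁, s₁, -, rfl⟩ := exists_eq_C_mul_X_sub_C (f := b₁) (by omega)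
  obtain ⟨y₂, s₂, -, rfl⟩ := exists_eq_C_mul_X_sub_C (f := b₂) (by omega)
  obtain ⟨y₃, s₃, -, rfl⟩ := exists_eq_C_mul_X_sub_C (f := b₃) (by omega)
  obtain ⟨m, hm⟩ : ∃ m, m = p.leadingCoeff := ⟨_, rfl⟩
  have hm0 : m ≠ 0 := by
    rw [hm, leadingCoeff_ne_zero]
    rintro rfl
    simpa using h.natDegree_eq
  have lead : ∀ {e g y t s : k}, p - C e * q = C g * (X - C t) * (C y * (X - C s)) ^ 2 →
      ∀ x : k, p.eval x - e * q.eval x = m * ((x - t) * (x - s) ^ 2) := by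
    intro e g y t s hE x
    have h1 : p - C e * q = C (g * y ^ 2) * ((X - C t) * (X - C s) ^ 2) := by
      rw [hE]; simp only [C_mul, C_pow]; ring
    have := (h.natDegree_sub e).2
    rw [h1, leadingCoeff_mul, leadingCoeff_C,
      ((monic_X_sub_C t).mul ((monic_X_sub_C s).pow 2)), mul_one, ← hm] at this
    rw [this] at h1
    have := congrArg (eval x) h1
    simpa only [eval_sub, eval_mul, eval_C, eval_X, eval_pow] using this
  have L1 := lead E1
  have L2 := lead E2
  have L3 := lead E3
  have hs12 : s₁ ≠ s₂ := h.ne_of_eval he.ne₁₂ (by rw [E1]; simp) (by rw [E2]; simp)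
  have hs13 : s₁ ≠ s₃ := h.ne_of_eval he.ne₁₃ (by rw [E1]; simp) (by rw [E3]; simp)
  have hs23 : s₂ ≠ s₃ := h.ne_of_eval he.ne₂₃ (by rw [E2]; simp) (by rw [E3]; simp)
  have hq2 : q.natDegree < 3 := h.natDegree_eq ▸ h.natDegree_lt
  have hb0 : b₀.natDegree = 0 ∨ b₀.natDegree = 1 := by
    rw [E0, natDegree_C_mul hc, natDegree_pow] at hq2
    omega
  rcases hb0 with hb0 | hb0
  · -- a cubic polynomial cannot be ramified over three finite points
    exfalso
    obtain ⟨y₀, rfl⟩ := natDegree_eq_zero.1 hb0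
    have hqx : ∀ x, q.eval x = c * y₀ ^ 2 := fun x => by rw [E0]; simp
    simp only [hqx] at L1 L2 L3
    have key : ∀ {e e' t t' s s' : k},
        (∀ x, p.eval x - e * (c * y₀ ^ 2) = m * ((x - t) * (x - s) ^ 2)) →
        (∀ x, p.eval x - e' * (c * y₀ ^ 2) = m * ((x - t') * (x - s') ^ 2)) →
        t + 2 * s = t' + 2 * s' ∧ s ^ 2 + 2 * s * t = s' ^ 2 + 2 * s' * t' := by
      intro e e' t t' s s' h h'
      have hm2 : m * 2 ≠ 0 := mul_ne_zero hm0 two_ne_zero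
      constructor
      · apply mul_left_cancel₀ hm2
        linear_combination h 1 + h (-1) - 2 * h 0 - (h' 1 + h' (-1) - 2 * h' 0)
      · apply mul_left_cancel₀ hm2
        linear_combination h' 1 - h' (-1) - (h 1 - h (-1))
    obtain ⟨k1, k2⟩ := key L1 L2
    obtain ⟨k3, k4⟩ := key L1 L3
    have m1 : 3 * (s₁ + s₂) = 2 * (t₁ + 2 * s₁) := by
      apply mul_left_cancel₀ (_root_.sub_ne_zero.2 hs12)
      linear_combination -k2 + 2 * s₂ * k1
    have m2 : 3 * (s₁ + s₃) = 2 * (t₁ + 2 * s₁) := by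
      apply mul_left_cancel₀ (_root_.sub_ne_zero.2 hs13)
      linear_combination -k4 + 2 * s₃ * k3
    apply hs23
    have : (3 : k) * (s₂ - s₃) = 0 := by linear_combination m1 - m2
    have h3 : (3 : k) ≠ 0 := by norm_num
    exact sub_eq_zero.1 ((mul_eq_zero.1 this).resolve_left h3)
  · obtain ⟨y₀, d, hy0, rfl⟩ := exists_eq_C_mul_X_sub_C hb0
    have hqx : ∀ x, q.eval x = c * y₀ ^ 2 * (x - d) ^ 2 := fun x => by
      rw [E0]; simp only [eval_mul, eval_C, eval_pow, eval_sub, eval_X]; ring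
    have hg : c * y₀ ^ 2 ≠ 0 := mul_ne_zero hc (pow_ne_zero 2 hy0)
    generalize c * y₀ ^ 2 = g at hqx hg
    simp only [hqx] at L1 L2 L3
    have hpd : p.eval d ≠ 0 := by
      intro hp
      exact h.eval_ne_zero hp (by rw [hqx]; simp)
    have key : ∀ {e t s : k},
        (∀ x, p.eval x - e * (g * (x - d) ^ 2) = m * ((x - t) * (x - s) ^ 2)) →
        m * ((t - d) * (s - d) ^ 2) = -p.eval d ∧
        m * (2 + 2 * ((s - d) ^ 2 + 2 * (t - d) * (s - d))) = p.eval (d + 1) - p.eval (d - 1) ∧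
        2 * e * g = p.eval (d + 1) + p.eval (d - 1) - 2 * p.eval d +
          m * 2 * ((t - d) + 2 * (s - d)) := by
      intro e t s h
      have h0 := h d
      have h1 := h (d + 1)
      have h2 := h (d - 1)
      refine ⟨?_, ?_, ?_⟩
      · linear_combination h0
      · linear_combination h2 - h1
      · linear_combination -h1 - h2 + 2 * h0
    obtain ⟨u1, v1, w1⟩ := key L1
    obtain ⟨u2, v2, w2⟩ := key L2
    obtain ⟨u3, v3, w3⟩ := key L3
    obtain ⟨a₁, ha1⟩ : ∃ a, a = s₁ - d := ⟨_, rfl⟩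
    obtain ⟨a₂, ha2⟩ : ∃ a, a = s₂ - d := ⟨_, rfl⟩
    obtain ⟨a₃, ha3⟩ : ∃ a, a = s₃ - d := ⟨_, rfl⟩
    have hd : AreDistinct a₁ a₂ a₃ := by
      rw [ha1, ha2, ha3]
      exact ⟨fun h => hs12 (sub_left_injective h), fun h => hs13 (sub_left_injective h),
        fun h => hs23 (sub_left_injective h)⟩
    rw [← ha1] at u1 v1 w1
    rw [← ha2] at u2 v2 w2
    rw [← ha3] at u3 v3 w3
    have hne : ∀ {t a : k}, m * ((t - d) * a ^ 2) = -p.eval d → a ≠ 0 := by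
      rintro t a h rfl
      apply hpd
      linear_combination h
    have n1 := hne u1
    have n2 := hne u2
    have n3 := hne u3
    have hm2 : m * 2 ≠ 0 := mul_ne_zero hm0 two_ne_zero
    -- the points `aᵢ` are the roots of one cubic `a³ - z a + 2w`
    have z12 : a₁ ^ 2 + 2 * (t₁ - d) * a₁ = a₂ ^ 2 + 2 * (t₂ - d) * a₂ := by
      apply mul_left_cancel₀ hm2; linear_combination v1 - v2
    have z13 : a₁ ^ 2 + 2 * (t₁ - d) * a₁ = a₃ ^ 2 + 2 * (t₃ - d) * a₃ := by
      apply mul_left_cancel₀ hm2; linear_combination v1 - v3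
    have x12 : (t₁ - d) * a₁ ^ 2 = (t₂ - d) * a₂ ^ 2 := by
      apply mul_left_cancel₀ hm0; linear_combination u1 - u2
    have x13 : (t₁ - d) * a₁ ^ 2 = (t₃ - d) * a₃ ^ 2 := by
      apply mul_left_cancel₀ hm0; linear_combination u1 - u3
    have q12 : a₁ ^ 2 + a₁ * a₂ + a₂ ^ 2 = a₁ ^ 2 + 2 * (t₁ - d) * a₁ := by
      apply mul_left_cancel₀ (_root_.sub_ne_zero.2 hd.ne₁₂)
      linear_combination a₂ * z12 - 2 * x12
    have q13 : a₁ ^ 2 + a₁ * a₃ + a₃ ^ 2 = a₁ ^ 2 + 2 * (t₁ - d) * a₁ := by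
      apply mul_left_cancel₀ (_root_.sub_ne_zero.2 hd.ne₁₃)
      linear_combination a₃ * z13 - 2 * x13
    have hsum : a₁ + a₂ + a₃ = 0 := by
      apply mul_left_cancel₀ (_root_.sub_ne_zero.2 hd.ne₂₃)
      linear_combination q12 - q13
    have T1 : t₁ - d = -(a₂ * a₃ / (2 * a₁)) := by
      field_simp; linear_combination -q12 + a₂ * hsum
    have T2 : t₂ - d = -(a₁ * a₃ / (2 * a₂)) := by
      field_simp; linear_combination -q12 - z12 + a₁ * hsum
    have T3 : t₃ - d = -(a₁ * a₂ / (2 * a₃)) := by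
      field_simp; linear_combination -q13 - z13 + a₁ * hsum
    obtain ⟨w, hw, -, hw1, hw2⟩ := rootJ_three hsum hd (mul_ne_zero (mul_ne_zero n1 n2) n3)
    refine ⟨w, hw, ?_, ?_⟩
    · rw [← hw1, ← rootJ_eq_of_rootCubic_eq ht, ← T1, ← T2, ← T3]
      refine Eq.trans ?_ (rootJ_mul_add _ _ _ one_ne_zero d)
      congr 1 <;> ring
    · rw [← hw2, ← T1, ← T2, ← T3]
      refine Eq.trans ?_ (rootJ_mul_add _ _ _ (div_ne_zero hm0 hg)
        ((p.eval (d + 1) + p.eval (d - 1) - 2 * p.eval d) / (2 * g)))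
      congr 1
      · field_simp; linear_combination w1
      · field_simp; linear_combination w2
      · field_simp; linear_combination w3

end IsIsogenyData

/-- The universal isogeny of degree two, with kernel generated by `(0, 0)`. -/
theorem isIsogenyData_two {t₁ t₂ a : k} (ha : a ^ 2 = t₁ * t₂) (h0 : t₁ * t₂ ≠ 0) :
    IsIsogenyData 0 t₁ t₂ (t₁ + t₂) (2 * a) (-(2 * a)) 2 (X ^ 2 + C (t₁ * t₂)) X
      (X ^ 2 - C (t₁ * t₂)) where
  isCoprime := by
    have hC : C (t₁ * t₂)⁻¹ * C (t₁ * t₂) = (1 : k[X]) := by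
      rw [← C_mul, inv_mul_cancel₀ h0, C_1]
    exact ⟨C (t₁ * t₂)⁻¹, -(C (t₁ * t₂)⁻¹ * X), by linear_combination hC⟩
  natDegree_lt := by rw [natDegree_X_pow_add_C, natDegree_X]; decide
  natDegree_eq := natDegree_X_pow_add_C
  ne_zero := X_ne_zero
  ne_zero' := X_pow_sub_C_ne_zero two_pos _
  equation := by
    have hC : C a ^ 2 = C t₁ * C t₂ := by rw [← C_pow, ha, C_mul]
    simp only [rootCubic, C_add, C_mul, C_neg, C_0, C_ofNat]
    linear_combination (-4 * X ^ 3 * (X ^ 2 + C t₁ * C t₂ - (C t₁ + C t₂) * X)) * hC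

/-- The universal isogeny of degree three, with kernel the two points of abscissa `0` and the point
at infinity. -/
theorem isIsogenyData_three [CharZero k] {a₁ a₂ a₃ : k} (hs : a₁ + a₂ + a₃ = 0)
    (h0 : a₁ * a₂ * a₃ ≠ 0) :
    IsIsogenyData (-(a₂ * a₃ / (2 * a₁))) (-(a₁ * a₃ / (2 * a₂))) (-(a₁ * a₂ / (2 * a₃)))
      (-(a₂ * a₃ / (2 * a₁)) + 2 * a₁) (-(a₁ * a₃ / (2 * a₂)) + 2 * a₂)
      (-(a₁ * a₂ / (2 * a₃)) + 2 * a₃) 3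
      (X ^ 3 + C (a₁ ^ 2 + a₁ * a₂ + a₂ ^ 2) * X + C (a₁ * a₂ * a₃ / 2)) (X ^ 2)
      (X * rootCubic a₁ a₂ a₃) where
  isCoprime := by
    have h2 : a₁ * a₂ * a₃ / 2 ≠ 0 := div_ne_zero h0 two_ne_zero
    generalize a₁ * a₂ * a₃ / 2 = c at h2
    generalize a₁ ^ 2 + a₁ * a₂ + a₂ ^ 2 = b
    apply IsCoprime.pow_right
    have hC : C c⁻¹ * C c = (1 : k[X]) := by
      rw [← C_mul, inv_mul_cancel₀ h2, C_1]
    exact ⟨C c⁻¹, -(C c⁻¹ * (X ^ 2 + C b)), by linear_combination hC⟩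
  natDegree_lt := by
    have : (X ^ 3 + C (a₁ ^ 2 + a₁ * a₂ + a₂ ^ 2) * X +
        C (a₁ * a₂ * a₃ / 2) : k[X]).natDegree = 3 := by
      compute_degree!
    rw [this, natDegree_X_pow]; decide
  natDegree_eq := by compute_degree!
  ne_zero := pow_ne_zero 2 X_ne_zero
  ne_zero' := mul_ne_zero X_ne_zero (rootCubic_monic _ _ _).ne_zero
  equation := by
    have h1 : a₁ ≠ 0 := by rintro rfl; simp at h0
    have h2 : a₂ ≠ 0 := by rintro rfl; simp at h0
    have h3 : a₃ ≠ 0 := by rintro rfl; simp at h0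
    have key : ∀ a b c : k, a ≠ 0 → a + b + c = 0 →
        X ^ 3 + C (a ^ 2 + a * b + b ^ 2) * X + C (a * b * c / 2) -
          C (-(b * c / (2 * a)) + 2 * a) * X ^ 2 =
            (X - C (-(b * c / (2 * a)))) * (X - C a) ^ 2 := by
      intro a b c ha hsum
      have e1 : C (a * b * c / 2) = C (b * c / (2 * a)) * C a ^ 2 := by
        rw [← C_pow, ← C_mul]; congr 1; field_simp
      have e2 : C (a ^ 2 + a * b + b ^ 2) = C a ^ 2 - 2 * C (b * c / (2 * a)) * C a := by
        rw [show (2 : k[X]) = C 2 from rfl, ← C_pow, ← C_mul, ← C_mul, ← C_sub]; congr 1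
        field_simp; linear_combination b * hsum
      rw [e1, e2]
      simp only [C_add, C_neg, C_mul, C_ofNat]
      ring
    have k1 := key a₁ a₂ a₃ h1 hs
    have k2 := key a₂ a₁ a₃ h2 (by rw [← hs]; ring)
    have k3 := key a₃ a₁ a₂ h3 (by rw [← hs]; ring)
    rw [show a₂ ^ 2 + a₂ * a₁ + a₁ ^ 2 = a₁ ^ 2 + a₁ * a₂ + a₂ ^ 2 by ring,
      show a₂ * a₁ * a₃ = a₁ * a₂ * a₃ by ring] at k2
    rw [show a₃ ^ 2 + a₃ * a₁ + a₁ ^ 2 = a₁ ^ 2 + a₁ * a₂ + a₂ ^ 2 by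
        linear_combination (a₃ - a₂) * hs,
      show a₃ * a₁ * a₂ = a₁ * a₂ * a₃ by ring] at k3
    rw [k1, k2, k3, rootCubic, rootCubic]
    ring

end DegreeThree

/-! ### Modular polynomials -/

section Elimination

open Polynomial IntermediateField

variable {k : Type*} [Field k]

theorem exists_add_mul_eq [IsAlgClosed k] (a b : k) : ∃ x y : k, x + y = a ∧ x * y = b := by
  obtain ⟨x, hx⟩ := IsAlgClosed.exists_root (X ^ 2 - C a * X + C b : k[X]) (by
    have : (X ^ 2 - C a * X + C b : k[X]).degree = 2 := by compute_degree!
    rw [this]; decide)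
  simp only [IsRoot.def, eval_add, eval_sub, eval_mul, eval_C, eval_pow, eval_X] at hx
  exact ⟨x, a - x, by ring, by linear_combination -hx⟩

theorem exists_cubic_roots [IsAlgClosed k] (a b c : k) :
    ∃ x y z : k, x + y + z = a ∧ x * y + x * z + y * z = b ∧ x * y * z = c := by
  obtain ⟨x, hx⟩ := IsAlgClosed.exists_root (X ^ 3 - C a * X ^ 2 + C b * X - C c : k[X]) (by
    have : (X ^ 3 - C a * X ^ 2 + C b * X - C c : k[X]).degree = 3 := by compute_degree!
    rw [this]; decide)
  simp only [IsRoot.def, eval_add, eval_sub, eval_mul, eval_C, eval_pow, eval_X] at hx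
  obtain ⟨y, z, h1, h2⟩ := exists_add_mul_eq (a - x) (b - x * (a - x))
  exact ⟨x, y, z, by linear_combination h1, by linear_combination x * h1 + h2,
    by linear_combination x * h2 + hx⟩

theorem exists_quartic_roots [IsAlgClosed k] (a b c d : k) :
    ∃ x y z w : k, x + y + z + w = a ∧ x * y + x * z + x * w + y * z + y * w + z * w = b ∧
      x * y * z + x * y * w + x * z * w + y * z * w = c ∧ x * y * z * w = d := by
  obtain ⟨x, hx⟩ := IsAlgClosed.exists_root
    (X ^ 4 - C a * X ^ 3 + C b * X ^ 2 - C c * X + C d : k[X]) (by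
    have : (X ^ 4 - C a * X ^ 3 + C b * X ^ 2 - C c * X + C d : k[X]).degree = 4 := by
      compute_degree!
    rw [this]; decide)
  simp only [IsRoot.def, eval_add, eval_sub, eval_mul, eval_C, eval_pow, eval_X] at hx
  obtain ⟨y, z, w, h1, h2, h3⟩ :=
    exists_cubic_roots (a - x) (b - x * (a - x)) (c - x * (b - x * (a - x)))
  exact ⟨x, y, z, w, by linear_combination h1, by linear_combination x * h1 + h2,
    by linear_combination x * h2 + h3, by linear_combination x * h3 - hx⟩

/-- The product of the values of a quadratic polynomial at the roots of a monic cubic, that is,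
their resultant. -/
theorem prod_quadratic_eq {e₁ e₂ e₃ x y z : k} (a b c : k) (h1 : x + y + z = e₁)
    (h2 : x * y + x * z + y * z = e₂) (h3 : x * y * z = e₃) :
    (a * x ^ 2 + b * x + c) * (a * y ^ 2 + b * y + c) * (a * z ^ 2 + b * z + c) =
      a * a * a * (e₃ ^ 2) + a * a * b * (e₂ * e₃) + a * a * c * (-2 * e₁ * e₃ + e₂ ^ 2) +
      a * b * b * (e₁ * e₃) + a * b * c * (e₁ * e₂ - 3 * e₃) + a * c * c * (e₁ ^ 2 - 2 * e₂) +
      b * b * b * e₃ + b * b * c * e₂ + b * c * c * e₁ + c * c * c := by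
  subst h1 h2 h3; ring

set_option maxHeartbeats 1000000 in
/-- The product of the values of a cubic polynomial at the roots of a monic quartic, that is, their
resultant. -/
theorem prod_cubic_eq {e₁ e₂ e₃ e₄ x y z w : k} (a b c d : k) (h1 : x + y + z + w = e₁)
    (h2 : x * y + x * z + x * w + y * z + y * w + z * w = e₂)
    (h3 : x * y * z + x * y * w + x * z * w + y * z * w = e₃) (h4 : x * y * z * w = e₄) :
    (a * x ^ 3 + b * x ^ 2 + c * x + d) * (a * y ^ 3 + b * y ^ 2 + c * y + d) *
        (a * z ^ 3 + b * z ^ 2 + c * z + d) * (a * w ^ 3 + b * w ^ 2 + c * w + d) =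
      a * a * a * a * (e₄ ^ 3) + a * a * a * b * (e₃ * e₄ ^ 2) +
      a * a * a * c * (-2 * e₂ * e₄ ^ 2 + e₃ ^ 2 * e₄) +
      a * a * a * d * (3 * e₁ * e₄ ^ 2 - 3 * e₂ * e₃ * e₄ + e₃ ^ 3) +
      a * a * b * b * (e₂ * e₄ ^ 2) + a * a * b * c * (-3 * e₁ * e₄ ^ 2 + e₂ * e₃ * e₄) +
      a * a * b * d * (-1 * e₁ * e₃ * e₄ - 2 * e₂ ^ 2 * e₄ + e₂ * e₃ ^ 2 + 4 * e₄ ^ 2) +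
      a * a * c * c * (-2 * e₁ * e₃ * e₄ + e₂ ^ 2 * e₄ + 2 * e₄ ^ 2) +
      a * a * c * d * (-1 * e₁ * e₂ * e₄ - 2 * e₁ * e₃ ^ 2 + e₂ ^ 2 * e₃ + 5 * e₃ * e₄) +
      a * a * d * d * (3 * e₁ ^ 2 * e₄ - 3 * e₁ * e₂ * e₃ + e₂ ^ 3 - 3 * e₂ * e₄ + 3 * e₃ ^ 2) +
      a * b * b * b * (e₁ * e₄ ^ 2) + a * b * b * c * (e₁ * e₃ * e₄ - 4 * e₄ ^ 2) +
      a * b * b * d * (-2 * e₁ * e₂ * e₄ + e₁ * e₃ ^ 2 - 1 * e₃ * e₄) +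
      a * b * c * c * (e₁ * e₂ * e₄ - 3 * e₃ * e₄) +
      a * b * c * d * (-3 * e₁ ^ 2 * e₄ + e₁ * e₂ * e₃ + 4 * e₂ * e₄ - 3 * e₃ ^ 2) +
      a * b * d * d * (-2 * e₁ ^ 2 * e₃ + e₁ * e₂ ^ 2 + 5 * e₁ * e₄ - 1 * e₂ * e₃) +
      a * c * c * c * (e₁ ^ 2 * e₄ - 2 * e₂ * e₄) +
      a * c * c * d * (e₁ ^ 2 * e₃ - 1 * e₁ * e₄ - 2 * e₂ * e₃) +
      a * c * d * d * (e₁ ^ 2 * e₂ - 1 * e₁ * e₃ - 2 * e₂ ^ 2 + 4 * e₄) +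
      a * d * d * d * (e₁ ^ 3 - 3 * e₁ * e₂ + 3 * e₃) + b * b * b * b * (e₄ ^ 2) +
      b * b * b * c * (e₃ * e₄) + b * b * b * d * (-2 * e₂ * e₄ + e₃ ^ 2) +
      b * b * c * c * (e₂ * e₄) + b * b * c * d * (-3 * e₁ * e₄ + e₂ * e₃) +
      b * b * d * d * (-2 * e₁ * e₃ + e₂ ^ 2 + 2 * e₄) + b * c * c * c * (e₁ * e₄) +
      b * c * c * d * (e₁ * e₃ - 4 * e₄) + b * c * d * d * (e₁ * e₂ - 3 * e₃) +
      b * d * d * d * (e₁ ^ 2 - 2 * e₂) + c * c * c * c * e₄ + c * c * c * d * e₃ +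
      c * c * d * d * e₂ + c * d * d * d * e₁ + d * d * d * d := by
  subst h1 h2 h3 h4; ring

/-- The classical modular polynomial of level two. -/
def modularTwo (x y : k) : k :=
  x ^ 3 + y ^ 3 - x ^ 2 * y ^ 2 + 1488 * (x ^ 2 * y + x * y ^ 2) - 162000 * (x ^ 2 + y ^ 2) +
    40773375 * (x * y) + 8748000000 * (x + y) - 157464000000000

/-- The classical modular polynomial of level three. -/
def modularThree (x y : k) : k :=
  x ^ 4 + y ^ 4 - x ^ 3 * y ^ 3 + 2232 * (x ^ 3 * y ^ 2 + x ^ 2 * y ^ 3) -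
    1069956 * (x ^ 3 * y + x * y ^ 3) + 36864000 * (x ^ 3 + y ^ 3) + 2587918086 * (x ^ 2 * y ^ 2) +
    8900222976000 * (x ^ 2 * y + x * y ^ 2) + 452984832000000 * (x ^ 2 + y ^ 2) -
    770845966336000000 * (x * y) + 1855425871872000000000 * (x + y)

/-- The modular curve of level two is parametrised by a Hauptmodul `w`. The converse is the
vanishing of the product of `y w² - (w + 256)³` over the roots of `(w + 16)³ - x w`. -/
theorem exists_iff_modularTwo_eq_zero [IsAlgClosed k] [CharZero k] (x y : k) :
    (∃ w : k, w ≠ 0 ∧ x = (w + 16) ^ 3 / w ∧ y = (w + 256) ^ 3 / w ^ 2) ↔ modularTwo x y = 0 := by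
  constructor
  · rintro ⟨w, hw, rfl, rfl⟩
    rw [modularTwo]
    field_simp
    ring
  · intro h
    obtain ⟨w₁, w₂, w₃, h1, h2, h3⟩ := exists_cubic_roots (-48) (768 - x) (-4096)
    -- the quadratic polynomial is the remainder of `y w² - (w + 256)³` modulo `(w + 16)³ - x w`
    have hP := prod_quadratic_eq (y - 720) (-(195840 + x)) (-(16777216 - 4096)) h1 h2 h3
    have hroot : ∀ w : k, w ^ 3 + 48 * w ^ 2 + (768 - x) * w + 4096 = 0 →
        (y - 720) * w ^ 2 + -(195840 + x) * w + -(16777216 - 4096) = 0 →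
        ∃ w : k, w ≠ 0 ∧ x = (w + 16) ^ 3 / w ∧ y = (w + 256) ^ 3 / w ^ 2 := by
      intro w hw hw'
      have h0 : w ≠ 0 := by rintro rfl; norm_num at hw
      refine ⟨w, h0, ?_, ?_⟩
      · rw [eq_div_iff h0]; linear_combination -hw
      · rw [eq_div_iff (pow_ne_zero 2 h0)]; linear_combination hw' - hw
    rw [modularTwo] at h
    have hz : ((y - 720) * w₁ ^ 2 + -(195840 + x) * w₁ + -(16777216 - 4096)) *
        ((y - 720) * w₂ ^ 2 + -(195840 + x) * w₂ + -(16777216 - 4096)) *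
        ((y - 720) * w₃ ^ 2 + -(195840 + x) * w₃ + -(16777216 - 4096)) = 0 := by
      rw [hP]; linear_combination 16777216 * h
    rcases mul_eq_zero.1 hz with hz | hz
    · rcases mul_eq_zero.1 hz with hz | hz
      · exact hroot w₁ (by linear_combination w₁ ^ 2 * h1 - w₁ * h2 + h3) hz
      · exact hroot w₂ (by linear_combination w₂ ^ 2 * h1 - w₂ * h2 + h3) hz
    · exact hroot w₃ (by linear_combination w₃ ^ 2 * h1 - w₃ * h2 + h3) hz

/-- The modular curve of level three is parametrised by a Hauptmodul `w`. The converse is the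
vanishing of the product of `y w³ - (w + 27)(w + 243)³` over the roots of
`(w + 27)(w + 3)³ - x w`. -/
theorem exists_iff_modularThree_eq_zero [IsAlgClosed k] [CharZero k] (x y : k) :
    (∃ w : k, w ≠ 0 ∧ x = (w + 27) * (w + 3) ^ 3 / w ∧ y = (w + 27) * (w + 243) ^ 3 / w ^ 3) ↔
      modularThree x y = 0 := by
  constructor
  · rintro ⟨w, hw, rfl, rfl⟩
    rw [modularThree]
    field_simp
    ring
  · intro h
    obtain ⟨w₁, w₂, w₃, w₄, h1, h2, h3, h4⟩ := exists_quartic_roots (-36) 270 (x - 756) 729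
    -- the cubic polynomial is the remainder of `y w³ - (w + 27)(w + 243)³` modulo
    -- `(w + 27)(w + 3)³ - x w`
    have hP := prod_cubic_eq (y - 720) (-196560) (-(19131120 + x)) (-387419760) h1 h2 h3 h4
    have hroot : ∀ w : k, w ^ 4 + 36 * w ^ 3 + 270 * w ^ 2 + (756 - x) * w + 729 = 0 →
        (y - 720) * w ^ 3 + -196560 * w ^ 2 + -(19131120 + x) * w + -387419760 = 0 →
        ∃ w : k, w ≠ 0 ∧ x = (w + 27) * (w + 3) ^ 3 / w ∧
          y = (w + 27) * (w + 243) ^ 3 / w ^ 3 := by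
      intro w hw hw'
      have h0 : w ≠ 0 := by rintro rfl; norm_num at hw
      refine ⟨w, h0, ?_, ?_⟩
      · rw [eq_div_iff h0]; linear_combination -hw
      · rw [eq_div_iff (pow_ne_zero 3 h0)]; linear_combination hw' - hw
    rw [modularThree] at h
    have hz : ((y - 720) * w₁ ^ 3 + -196560 * w₁ ^ 2 + -(19131120 + x) * w₁ + -387419760) *
        ((y - 720) * w₂ ^ 3 + -196560 * w₂ ^ 2 + -(19131120 + x) * w₂ + -387419760) *
        ((y - 720) * w₃ ^ 3 + -196560 * w₃ ^ 2 + -(19131120 + x) * w₃ + -387419760) *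
        ((y - 720) * w₄ ^ 3 + -196560 * w₄ ^ 2 + -(19131120 + x) * w₄ + -387419760) = 0 := by
      rw [hP]; linear_combination 387420489 * h
    have hw : ∀ w : k, w ^ 4 + 36 * w ^ 3 + 270 * w ^ 2 + (756 - x) * w + 729 =
        (w - w₁) * (w - w₂) * (w - w₃) * (w - w₄) := by
      intro w
      linear_combination w ^ 3 * h1 - w ^ 2 * h2 + w * h3 - h4
    rcases mul_eq_zero.1 hz with hz | hz
    · rcases mul_eq_zero.1 hz with hz | hz
      · rcases mul_eq_zero.1 hz with hz | hz
        · exact hroot w₁ (by rw [hw]; ring) hz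
        · exact hroot w₂ (by rw [hw]; ring) hz
      · exact hroot w₃ (by rw [hw]; ring) hz
    · exact hroot w₄ (by rw [hw]; ring) hz

end Elimination

/-! ### Isogeny criteria in terms of `j`-invariants -/

section Isogenies

open Polynomial IntermediateField

variable {k F F' : Type*} [Field k] [Field F] [Field F'] [Algebra k F] [Algebra k F']
  [IsAlgClosed k] [CharZero k] {j j' : k}

theorem HasJInvariant.exists_isIsogenyData (h : HasJInvariant k F j) (h' : HasJInvariant k F' j')
    {n : ℕ} (hn : IsogenousOfDegree k F F' n) :
    ∃ (r₁ r₂ r₃ e₁ e₂ e₃ : k) (p q R : k[X]), AreDistinct r₁ r₂ r₃ ∧ AreDistinct e₁ e₂ e₃ ∧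
      rootJ r₁ r₂ r₃ = j ∧ rootJ e₁ e₂ e₃ = j' ∧ IsIsogenyData r₁ r₂ r₃ e₁ e₂ e₃ n p q R := by
  obtain ⟨r₁, r₂, r₃, hr, rfl⟩ := exists_rootJ_eq j
  obtain ⟨e₁, e₂, e₃, he, rfl⟩ := exists_rootJ_eq j'
  obtain ⟨x, y, hxy⟩ := h.exists_model hr
  obtain ⟨x', y', hxy'⟩ := h'.exists_model he
  obtain ⟨φ, rfl⟩ := hn
  obtain ⟨p, q, R, hD⟩ := _root_.exists_isIsogenyData hr he hxy hxy' φ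
  exact ⟨r₁, r₂, r₃, e₁, e₂, e₃, p, q, R, hr, he, rfl, rfl, hD⟩

theorem HasJInvariant.isogenousOfDegree {r₁ r₂ r₃ e₁ e₂ e₃ : k} {n : ℕ} {p q R : k[X]}
    (hr : AreDistinct r₁ r₂ r₃) (he : AreDistinct e₁ e₂ e₃)
    (hD : IsIsogenyData r₁ r₂ r₃ e₁ e₂ e₃ n p q R)
    (h : HasJInvariant k F (rootJ r₁ r₂ r₃)) (h' : HasJInvariant k F' (rootJ e₁ e₂ e₃)) :
    IsogenousOfDegree k F F' n := by
  obtain ⟨x, y, hxy⟩ := h.exists_model hr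
  obtain ⟨x', y', hxy'⟩ := h'.exists_model he
  exact hD.isogenousOfDegree hr he hxy hxy'

/-- Elliptic function fields over an algebraically closed field are classified by their
`j`-invariant. -/
theorem HasJInvariant.nonempty_algEquiv_iff (h : HasJInvariant k F j) (h' : HasJInvariant k F' j') :
    Nonempty (F ≃ₐ[k] F') ↔ j = j' := by
  constructor
  · rintro ⟨e⟩
    have hn : IsogenousOfDegree k F F' 1 := by
      refine ⟨(e.symm : F' →ₐ[k] F), ?_⟩
      have : (e.symm : F' →ₐ[k] F).fieldRange = ⊤ :=
        AlgHom.fieldRange_eq_top.2 e.symm.surjective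
      rw [this, IntermediateField.finrank_top]
    obtain ⟨_, _, _, _, _, _, _, _, _, hr, he, rfl, rfl, hD⟩ := h.exists_isIsogenyData h' hn
    exact hD.rootJ_eq_of_one hr he
  · rintro rfl
    obtain ⟨r₁, r₂, r₃, hr, rfl⟩ := exists_rootJ_eq j
    obtain ⟨x, y, hxy⟩ := h.exists_model hr
    obtain ⟨x', y', hxy'⟩ := h'.exists_model hr
    obtain ⟨e, -, -⟩ := hxy.exists_algEquiv hxy' hr.squarefree (by rw [natDegree_rootCubic]; decide)
    exact ⟨e⟩

theorem HasJInvariant.eq (h : HasJInvariant k F j) (h' : HasJInvariant k F j') : j = j' :=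
  (h.nonempty_algEquiv_iff h').1 ⟨AlgEquiv.refl⟩

/-- Elliptic function fields are `2`-isogenous if and only if their `j`-invariants satisfy the
modular equation of level two. -/
theorem HasJInvariant.isogenousOfDegree_two_iff (h : HasJInvariant k F j)
    (h' : HasJInvariant k F' j') : IsogenousOfDegree k F F' 2 ↔ modularTwo j j' = 0 := by
  rw [← exists_iff_modularTwo_eq_zero]
  constructor
  · intro hn
    obtain ⟨_, _, _, _, _, _, _, _, _, hr, he, rfl, rfl, hD⟩ := h.exists_isIsogenyData h' hn
    exact hD.exists_of_two hr he
  · rintro ⟨w, hw, rfl, rfl⟩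
    -- `t` and `t⁻¹` are the roots of `16 (t - 1)² = w t`
    obtain ⟨t, s, hts, hts1⟩ := exists_add_mul_eq ((32 + w) / 16) (1 : k)
    have h16 : (16 : k) ≠ 0 := by norm_num
    have ht : 16 * (t - 1) ^ 2 = w * t := by
      rw [eq_div_iff h16] at hts
      linear_combination t * hts - 16 * hts1
    have ht0 : t ≠ 0 := left_ne_zero_of_mul (hts1 ▸ one_ne_zero)
    have ht1 : t ≠ 1 := by
      rintro rfl
      apply hw
      linear_combination -ht
    obtain ⟨a, ha⟩ := IsAlgClosed.exists_pow_nat_eq t (n := 2) two_pos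
    have ha' : a ^ 2 = t * 1 := by rw [ha, mul_one]
    have ht0' : t * 1 ≠ 0 := by rwa [mul_one]
    obtain ⟨w', -, hw', hj, hj'⟩ := rootJ_two ha' ht0' ht1
    obtain rfl : w' = w := by
      apply mul_right_cancel₀ ht0
      linear_combination hw' + ht
    rw [← hj] at h
    rw [← hj'] at h'
    have hne : (t + 1 - 2 * a) * (t + 1 - -(2 * a)) ≠ 0 := by
      rw [show (t + 1 - 2 * a) * (t + 1 - -(2 * a)) = (t - 1) ^ 2 by
        linear_combination -4 * ha]
      exact pow_ne_zero 2 (sub_ne_zero.2 ht1)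
    refine HasJInvariant.isogenousOfDegree ⟨ht0.symm, zero_ne_one, ht1⟩
      ⟨sub_ne_zero.1 (left_ne_zero_of_mul hne), sub_ne_zero.1 (right_ne_zero_of_mul hne), ?_⟩
      (isIsogenyData_two ha' ht0') h h'
    intro h2
    have : (4 : k) * a = 0 := by linear_combination h2
    have ha0 : a = 0 := (mul_eq_zero.1 this).resolve_left (by norm_num)
    exact ht0 (by rw [← ha, ha0]; ring)

/-- Elliptic function fields are `3`-isogenous if and only if their `j`-invariants satisfy the
modular equation of level three. -/
theorem HasJInvariant.isogenousOfDegree_three_iff (h : HasJInvariant k F j)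
    (h' : HasJInvariant k F' j') : IsogenousOfDegree k F F' 3 ↔ modularThree j j' = 0 := by
  rw [← exists_iff_modularThree_eq_zero]
  constructor
  · intro hn
    obtain ⟨_, _, _, _, _, _, _, _, _, hr, he, rfl, rfl, hD⟩ := h.exists_isIsogenyData h' hn
    exact hD.exists_of_three hr he
  · rintro ⟨w, hw, rfl, rfl⟩
    -- a triple `1, a, -1 - a` with the given invariant
    obtain ⟨a, ha⟩ : ∃ a : k, 4 * (1 + a + a ^ 2) ^ 3 = (w + 27) * (a * (1 + a)) ^ 2 := by
      obtain ⟨a, ha⟩ := IsAlgClosed.exists_root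
        (C 4 * (1 + X + X ^ 2) ^ 3 - C (w + 27) * (X * (1 + X)) ^ 2 : k[X]) (by
          have hd : (C 4 * (1 + X + X ^ 2) ^ 3 - C (w + 27) * (X * (1 + X)) ^ 2 :
              k[X]).natDegree = 6 := by
            compute_degree!
          intro h
          exact absurd (hd.symm.trans (natDegree_eq_of_degree_eq_some h)) (by norm_num))
      simp only [IsRoot.def, eval_sub, eval_mul, eval_C, eval_pow, eval_add, eval_X,
        eval_one] at ha
      exact ⟨a, sub_eq_zero.1 ha⟩
    have hsum : 1 + a + (-1 - a) = 0 := by ring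
    have ha0 : a ≠ 0 := by rintro rfl; norm_num at ha
    have ha1 : -1 - a ≠ 0 := by
      intro h1
      obtain rfl : a = -1 := by linear_combination -h1
      norm_num at ha
    have hw2 : w * (a * (1 + a)) ^ 2 = ((1 - a) * (1 - (-1 - a)) * (a - (-1 - a))) ^ 2 := by
      linear_combination -ha
    have hdisc : (1 - a) * (1 - (-1 - a)) * (a - (-1 - a)) ≠ 0 := by
      intro h0
      rw [h0, zero_pow two_ne_zero] at hw2
      refine mul_ne_zero hw (pow_ne_zero 2 (mul_ne_zero ha0 ?_)) hw2
      intro h1; apply ha1; linear_combination -h1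
    have hdis : AreDistinct 1 a (-1 - a) :=
      ⟨sub_ne_zero.1 (left_ne_zero_of_mul (left_ne_zero_of_mul hdisc)),
        sub_ne_zero.1 (right_ne_zero_of_mul (left_ne_zero_of_mul hdisc)),
        sub_ne_zero.1 (right_ne_zero_of_mul hdisc)⟩
    have h0 : 1 * a * (-1 - a) ≠ 0 := mul_ne_zero (mul_ne_zero one_ne_zero ha0) ha1
    obtain ⟨w', -, hw', hj, hj'⟩ := rootJ_three hsum hdis h0
    obtain rfl : w' = w := by
      apply mul_right_cancel₀ (pow_ne_zero 2 h0)
      linear_combination hw' + ha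
    rw [← hj] at h
    rw [← hj'] at h'
    have key : ∀ a b c : k, a + b + c = 0 → a ≠ 0 → b ≠ 0 → c ≠ 0 → a ≠ b →
        -(b * c / (2 * a)) ≠ -(a * c / (2 * b)) ∧
        -(b * c / (2 * a)) + 2 * a ≠ -(a * c / (2 * b)) + 2 * b := by
      intro a b c hs ha hb hc hab
      have hab' := sub_ne_zero.2 hab
      obtain rfl : c = -(a + b) := by linear_combination hs
      constructor
      · intro h
        field_simp at h
        apply mul_ne_zero hab' (pow_ne_zero 2 hc)
        linear_combination -h
      · intro h
        field_simp at h
        apply pow_ne_zero 3 hab'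
        linear_combination -h
    obtain ⟨k12, l12⟩ := key 1 a (-1 - a) (by ring) one_ne_zero ha0 ha1 hdis.ne₁₂
    obtain ⟨k13, l13⟩ := key 1 (-1 - a) a (by ring) one_ne_zero ha1 ha0 hdis.ne₁₃
    obtain ⟨k23, l23⟩ := key a (-1 - a) 1 (by ring) ha0 ha1 one_ne_zero hdis.ne₂₃
    refine HasJInvariant.isogenousOfDegree ⟨k12, ?_, ?_⟩ ⟨l12, ?_, ?_⟩
      (isIsogenyData_three hsum h0) h h'
    · rwa [mul_comm (-1 - a) a] at k13
    · rwa [mul_comm (-1 - a) 1, mul_comm a 1] at k23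
    · rwa [mul_comm (-1 - a) a] at l13
    · rwa [mul_comm (-1 - a) 1, mul_comm a 1] at l23

end Isogenies

/-! ### Subfields of index two -/

section Involutions

open Polynomial IntermediateField

variable {k K : Type*} [Field k] [Field K] [Algebra k K]

theorem mem_fixedField_zpowers {τ : K ≃ₐ[k] K} {z : K} :
    z ∈ fixedField (Subgroup.zpowers τ) ↔ τ z = z := by
  rw [mem_fixedField_iff]
  constructor
  · exact fun h => h τ (Subgroup.mem_zpowers τ)
  · intro h g hg
    obtain ⟨n, rfl⟩ := Subgroup.mem_zpowers_iff.1 hg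
    have : τ ∈ MulAction.stabilizer (K ≃ₐ[k] K) z := h
    exact Subgroup.zpow_mem _ this n

theorem finrank_fixedField_zpowers {τ : K ≃ₐ[k] K} (hτ : orderOf τ = 2) :
    Module.finrank (fixedField (Subgroup.zpowers τ)) K = 2 := by
  have hc : Nat.card (Subgroup.zpowers τ) = 2 := by rw [Nat.card_zpowers, hτ]
  have : Finite (Subgroup.zpowers τ) := Nat.finite_of_card_ne_zero (by rw [hc]; decide)
  have := Fintype.ofFinite (Subgroup.zpowers τ)
  rw [← hc, Nat.card_eq_fintype_card]
  exact FixedPoints.finrank_eq_card (Subgroup.zpowers τ) K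

/-- A subfield of index two is the fixed field of an involution. -/
theorem IntermediateField.exists_eq_fixedField_of_finrank_eq_two [CharZero k]
    {F : IntermediateField k K} (hF : Module.finrank F K = 2) :
    ∃ τ : K ≃ₐ[k] K, orderOf τ = 2 ∧ F = fixedField (Subgroup.zpowers τ) := by
  have : Algebra.IsQuadraticExtension F K := ⟨hF⟩
  have : CharZero F := charZero_of_injective_algebraMap (algebraMap k F).injective
  have : FiniteDimensional F K := Module.finite_of_finrank_eq_succ hF
  have hcard : Nat.card (K ≃ₐ[F] K) = 2 := by rw [IsGalois.card_aut_eq_finrank, hF]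
  have : Finite (K ≃ₐ[F] K) := Nat.finite_of_card_ne_zero (by rw [hcard]; decide)
  have : Nontrivial (K ≃ₐ[F] K) := Finite.one_lt_card_iff_nontrivial.1 (by rw [hcard]; decide)
  obtain ⟨g, hg⟩ := exists_ne (1 : K ≃ₐ[F] K)
  have hord : orderOf g = 2 :=
    orderOf_eq_prime (by rw [← hcard]; exact pow_card_eq_one') hg
  refine ⟨g.restrictScalars k, ?_, ?_⟩
  · refine orderOf_eq_prime ?_ ?_
    · ext z
      have := pow_orderOf_eq_one g
      rw [hord] at this
      exact DFunLike.congr_fun this z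
    · intro h
      apply hg
      ext z
      exact DFunLike.congr_fun h z
  · have hle : F ≤ fixedField (Subgroup.zpowers (g.restrictScalars k)) := by
      intro z hz
      rw [mem_fixedField_zpowers]
      exact g.commutes ⟨z, hz⟩
    refine eq_of_le_of_finrank_eq' hle ?_
    rw [hF, finrank_fixedField_zpowers]
    refine orderOf_eq_prime ?_ ?_
    · ext z
      have := pow_orderOf_eq_one g
      rw [hord] at this
      exact DFunLike.congr_fun this z
    · intro h
      apply hg
      ext z
      exact DFunLike.congr_fun h z

/-- Recognition of the fixed field of an involution: a field `k(S)` fixed by `τ` is the whole fixed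
field if `K` is generated over it by a square root of one of its elements, since then `K` has degree
at most two over it. -/
theorem IntermediateField.adjoin_eq_fixedField {S : Set K} {τ : K ≃ₐ[k] K} (hτ : orderOf τ = 2)
    (hS : ∀ x ∈ S, τ x = x) {z : K} (hz : z ^ 2 ∈ adjoin k S) (hgen : adjoin k (insert z S) = ⊤) :
    adjoin k S = fixedField (Subgroup.zpowers τ) := by
  have hle : adjoin k S ≤ fixedField (Subgroup.zpowers τ) := by
    rw [adjoin_le_iff]
    exact fun x hx => mem_fixedField_zpowers.2 (hS x hx)
  have haev : aeval z (X ^ 2 - C (⟨z ^ 2, hz⟩ : adjoin k S)) = 0 := by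
    simp only [map_sub, map_pow, aeval_X, aeval_C]
    exact sub_self _
  have hm : (X ^ 2 - C (⟨z ^ 2, hz⟩ : adjoin k S)).Monic := monic_X_pow_sub_C _ two_ne_zero
  have hint : IsIntegral (adjoin k S) z := ⟨_, hm, haev⟩
  have htop : (adjoin k S)⟮z⟯ = ⊤ := by
    rw [← restrictScalars_eq_top_iff (K := k), eq_top_iff, ← hgen, adjoin_le_iff,
      Set.insert_subset_iff]
    refine ⟨mem_adjoin_simple_self (adjoin k S) z, fun x hx => ?_⟩
    exact ((adjoin k S)⟮z⟯).algebraMap_mem ⟨x, subset_adjoin k S hx⟩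
  have hfin : FiniteDimensional (adjoin k S) K := by
    have h1 := adjoin.finiteDimensional hint
    rw [htop] at h1
    exact Module.Finite.equiv (topEquiv (F := adjoin k S) (E := K)).toLinearEquiv
  refine eq_of_le_of_finrank_le' hle ?_
  rw [finrank_fixedField_zpowers hτ, ← finrank_top', ← htop, adjoin.finrank hint]
  calc _ ≤ _ := natDegree_le_of_dvd (minpoly.dvd _ _ haev) hm.ne_zero
    _ = 2 := natDegree_X_pow_sub_C

/-- An automorphism carries the fixed field of `τ` to that of the conjugate of `τ`. -/
theorem map_fixedField_zpowers (τ g : K ≃ₐ[k] K) :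
    (fixedField (Subgroup.zpowers τ)).map (g : K →ₐ[k] K) =
      fixedField (Subgroup.zpowers (g * τ * g⁻¹)) := by
  ext z
  rw [mem_map, mem_fixedField_zpowers]
  constructor
  · rintro ⟨w, hw, rfl⟩
    rw [mem_fixedField_zpowers] at hw
    change g (τ (g.symm (g w))) = g w
    rw [g.symm_apply_apply, hw]
  · intro hz
    refine ⟨g.symm z, mem_fixedField_zpowers.2 ?_, g.apply_symm_apply z⟩
    apply g.injective
    rw [g.apply_symm_apply]
    exact hz

theorem areConjugate_fixedField {τ τ' g : K ≃ₐ[k] K} (h : g * τ * g⁻¹ = τ') :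
    AreConjugate (fixedField (Subgroup.zpowers τ)) (fixedField (Subgroup.zpowers τ')) :=
  ⟨g, h ▸ map_fixedField_zpowers τ g⟩

theorem orderOf_eq_two_apply {τ : K ≃ₐ[k] K} (hτ : orderOf τ = 2) (z : K) : τ (τ z) = z := by
  have h := pow_orderOf_eq_one τ
  rw [hτ, pow_two] at h
  exact DFunLike.congr_fun h z

/-- An involution is determined by its fixed field. -/
theorem fixedField_zpowers_injective [CharZero k] {τ τ' : K ≃ₐ[k] K} (hτ : orderOf τ = 2)
    (h : fixedField (Subgroup.zpowers τ) = fixedField (Subgroup.zpowers τ')) : τ = τ' := by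
  have : CharZero K := charZero_of_injective_algebraMap (algebraMap k K).injective
  have hfix : ∀ {z : K}, τ z = z → τ' z = z := fun hz => by
    rwa [← mem_fixedField_zpowers, ← h, mem_fixedField_zpowers]
  have hfix' : ∀ {z : K}, τ' z = z → τ z = z := fun hz => by
    rwa [← mem_fixedField_zpowers, h, mem_fixedField_zpowers]
  have hne : τ ≠ 1 := by rintro rfl; simp at hτ
  obtain ⟨w₀, hw₀⟩ := DFunLike.ne_iff.1 hne
  have hinv := orderOf_eq_two_apply hτ
  -- an eigenvector of `τ` is one of `τ'` as well
  obtain ⟨z, hz, hτz⟩ : ∃ z : K, z ≠ 0 ∧ τ z = -z :=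
    ⟨w₀ - τ w₀, sub_ne_zero.2 (Ne.symm hw₀), by rw [map_sub, hinv, neg_sub]⟩
  have hz' : τ' z = -z := by
    have h1 : τ' (z ^ 2) = z ^ 2 := hfix (by rw [map_pow, hτz, neg_sq])
    rw [map_pow] at h1
    refine (sq_eq_sq_iff_eq_or_eq_neg.1 h1).resolve_left fun h2 => hz ?_
    have h3 := hfix' h2
    rw [hτz] at h3
    exact self_eq_neg.1 h3.symm
  ext w
  have h1 := hfix (z := w + τ w) (by rw [map_add, hinv, add_comm])
  have h2 := hfix (z := (w - τ w) * z) (by rw [map_mul, map_sub, hinv, hτz]; ring)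
  rw [map_mul, hz'] at h2
  have h3 : τ' (w - τ w) = -(w - τ w) := by
    apply mul_right_cancel₀ hz
    linear_combination -h2
  rw [map_add] at h1
  rw [map_sub] at h3
  apply mul_left_cancel₀ (two_ne_zero (α := K))
  linear_combination -h1 - h3

end Involutions

/-! ### The sextic and its two elliptic subfields -/

section Sextic

open Polynomial IntermediateField

variable {k K : Type*} [Field k] [Field K] [Algebra k K]

/-- The sextic `t⁶ - s₁ t⁴ + s₂ t² - 1`. -/
noncomputable def sextic (s₁ s₂ : k) : k[X] := X ^ 6 - C s₁ * X ^ 4 + C s₂ * X ^ 2 - 1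

theorem aeval_sextic (s₁ s₂ : k) (x : K) : aeval x (sextic s₁ s₂) =
    x ^ 6 - algebraMap k K s₁ * x ^ 4 + algebraMap k K s₂ * x ^ 2 - 1 := by
  simp [sextic]

theorem natDegree_sextic (s₁ s₂ : k) : (sextic s₁ s₂).natDegree = 6 := by
  rw [sextic]; compute_degree!

theorem natDegree_sextic_ne_zero (s₁ s₂ : k) : (sextic s₁ s₂).natDegree ≠ 0 := by
  rw [natDegree_sextic]; decide

/-- The elements `e₁, e₂, e₃` are the roots of `t³ - s₁ t² + s₂ t - 1`. -/
structure AreRoots (s₁ s₂ e₁ e₂ e₃ : k) : Prop where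
  distinct : AreDistinct e₁ e₂ e₃
  sum_eq : e₁ + e₂ + e₃ = s₁
  sum_mul_eq : e₁ * e₂ + e₁ * e₃ + e₂ * e₃ = s₂
  prod_eq : e₁ * e₂ * e₃ = 1

theorem exists_areRoots [IsAlgClosed k] {s₁ s₂ : k}
    (hs : 27 - 18 * s₁ * s₂ - s₁ ^ 2 * s₂ ^ 2 + 4 * s₁ ^ 3 + 4 * s₂ ^ 3 ≠ 0) :
    ∃ e₁ e₂ e₃, AreRoots s₁ s₂ e₁ e₂ e₃ := by
  obtain ⟨e₁, e₂, e₃, h1, h2, h3⟩ := exists_cubic_roots s₁ s₂ 1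
  have h : ((e₁ - e₂) * (e₁ - e₃) * (e₂ - e₃)) ^ 2 ≠ 0 := by
    intro h0
    apply hs
    have h4 : 27 * (e₁ * e₂ * e₃) ^ 2 - 18 * s₁ * s₂ * (e₁ * e₂ * e₃) - s₁ ^ 2 * s₂ ^ 2 +
        4 * s₁ ^ 3 * (e₁ * e₂ * e₃) + 4 * s₂ ^ 3 = 0 := by
      rw [← h1, ← h2]; linear_combination -h0
    rw [h3] at h4
    linear_combination h4
  have h' := ne_zero_pow two_ne_zero h
  exact ⟨e₁, e₂, e₃, ⟨sub_ne_zero.1 (left_ne_zero_of_mul (left_ne_zero_of_mul h')),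
    sub_ne_zero.1 (right_ne_zero_of_mul (left_ne_zero_of_mul h')),
    sub_ne_zero.1 (right_ne_zero_of_mul h')⟩, h1, h2, h3⟩

/-- The `j`-invariant of the elliptic subfield `k(x², y)` in terms of `s₁` and `s₂`; that of
`k(x², yx)` is obtained by interchanging the arguments. -/
def subcoverJ (s₁ s₂ : k) : k :=
  256 * (s₁ ^ 2 - 3 * s₂) ^ 3 / (s₁ ^ 2 * s₂ ^ 2 + 18 * (s₁ * s₂) - 4 * (s₁ ^ 3 + s₂ ^ 3) - 27)

namespace AreRoots

variable {s₁ s₂ e₁ e₂ e₃ : k}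

theorem rootCubic_eq (h : AreRoots s₁ s₂ e₁ e₂ e₃) :
    rootCubic e₁ e₂ e₃ = X ^ 3 - C s₁ * X ^ 2 + C s₂ * X - 1 := by
  have h3 : C e₁ * C e₂ * C e₃ = (1 : k[X]) := by rw [← C_mul, ← C_mul, h.prod_eq, C_1]
  rw [rootCubic, ← h.sum_eq, ← h.sum_mul_eq]
  simp only [C_add, C_mul]
  linear_combination -h3

/-- Passing to the reciprocal roots interchanges `s₁` and `s₂`. -/
theorem inv (h : AreRoots s₁ s₂ e₁ e₂ e₃) : AreRoots s₂ s₁ (e₂ * e₃) (e₁ * e₃) (e₁ * e₂) := by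
  have h3 := h.prod_eq
  have h0 : e₁ * e₂ * e₃ ≠ 0 := by rw [h3]; exact one_ne_zero
  have hz1 := left_ne_zero_of_mul (left_ne_zero_of_mul h0)
  have hz2 := right_ne_zero_of_mul (left_ne_zero_of_mul h0)
  have hz3 := right_ne_zero_of_mul h0
  refine ⟨⟨fun h' => ?_, fun h' => ?_, fun h' => ?_⟩, ?_, ?_, ?_⟩
  · exact h.distinct.ne₁₂ (mul_right_cancel₀ hz3 h').symm
  · exact h.distinct.ne₁₃ (mul_left_cancel₀ hz2 (by linear_combination -h'))
  · exact h.distinct.ne₂₃ (mul_left_cancel₀ hz1 h').symm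
  · rw [← h.sum_mul_eq]; ring
  · rw [← h.sum_eq]; linear_combination (e₁ + e₂ + e₃) * h3
  · linear_combination (e₁ * e₂ * e₃ + 1) * h3

theorem rootJ_eq (h : AreRoots s₁ s₂ e₁ e₂ e₃) : rootJ e₁ e₂ e₃ = subcoverJ s₁ s₂ := by
  rw [_root_.rootJ_eq e₁ e₂ e₃ h.sum_eq.symm h.sum_mul_eq.symm h.prod_eq.symm, subcoverJ]
  congr 1; ring

theorem squarefree_sextic [CharZero k] (h : AreRoots s₁ s₂ e₁ e₂ e₃) :
    Squarefree (sextic s₁ s₂) := by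
  have h1 : sextic s₁ s₂ = expand k 2 (rootCubic e₁ e₂ e₃) := by
    rw [h.rootCubic_eq, sextic]
    simp only [map_sub, map_add, map_mul, map_pow, expand_X, expand_C, map_one]
    ring
  have hsep : (rootCubic e₁ e₂ e₃).Separable :=
    PerfectField.separable_iff_squarefree.2 h.distinct.squarefree
  apply Separable.squarefree
  rw [Separable, h1, derivative_expand, pow_one]
  refine IsCoprime.mul_right (IsCoprime.map hsep (expand k 2).toRingHom) ?_
  rw [← h1]
  have h2 : IsUnit (C (2 : k)) := isUnit_C.2 (isUnit_iff_ne_zero.2 two_ne_zero)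
  refine (isCoprime_mul_unit_left_right h2 _ _).2 ?_
  refine ⟨-1, X ^ 5 - C s₁ * X ^ 3 + C s₂ * X, ?_⟩
  rw [sextic]; ring

end AreRoots

theorem transcendental_inv {x : K} (hx : Transcendental k x) : Transcendental k x⁻¹ :=
  fun h => hx (by simpa using h.inv)

namespace IsHyperellipticModel

variable {s₁ s₂ e₁ e₂ e₃ : k} {x y : K}

/-- A self-map of the function field whose image contains the generators is an automorphism. -/
theorem exists_algEquiv_self {f : k[X]} (h : IsHyperellipticModel f x y) (hf : Squarefree f)
    (hd : f.natDegree ≠ 0) {x' y' : K} (hx : Transcendental k x') (hy : y' ^ 2 = aeval x' f)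
    (hgen : x ∈ adjoin k {x', y'} ∧ y ∈ adjoin k {x', y'}) :
    ∃ e : K ≃ₐ[k] K, e x = x' ∧ e y = y' := by
  refine h.exists_algEquiv ⟨hx, hy, ?_⟩ hf hd
  rw [eq_top_iff, ← h.adjoin_eq_top, adjoin_le_iff, Set.insert_subset_iff,
    Set.singleton_subset_iff]
  exact hgen

theorem algEquiv_ext {f : k[X]} (h : IsHyperellipticModel f x y) {g g' : K ≃ₐ[k] K}
    (hx : g x = g' x) (hy : g y = g' y) : g = g' := by
  have := h.algHom_ext (φ := (g : K →ₐ[k] K)) (ψ := (g' : K →ₐ[k] K)) hx hy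
  ext z
  exact DFunLike.congr_fun this z

theorem orderOf_eq_two {f : k[X]} (h : IsHyperellipticModel f x y) {g : K ≃ₐ[k] K}
    (hx : g (g x) = x) (hy : g (g y) = y) (hne : ∃ z, g z ≠ z) : orderOf g = 2 := by
  refine orderOf_eq_prime ?_ ?_
  · rw [pow_two]
    exact h.algEquiv_ext hx hy
  · rintro rfl
    obtain ⟨z, hz⟩ := hne
    exact hz rfl

theorem ne_zero_left {f : k[X]} (h : IsHyperellipticModel f x y) : x ≠ 0 := by
  rintro rfl
  exact h.transcendental isAlgebraic_zero

theorem neg_ne_left {f : k[X]} [CharZero k] (h : IsHyperellipticModel f x y) : -x ≠ x := by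
  have : CharZero K := charZero_of_injective_algebraMap (algebraMap k K).injective
  exact fun h' => h.ne_zero_left (self_eq_neg.1 h'.symm)

theorem equation_sextic (h : IsHyperellipticModel (sextic s₁ s₂) x y) :
    y ^ 2 = x ^ 6 - algebraMap k K s₁ * x ^ 4 + algebraMap k K s₂ * x ^ 2 - 1 := by
  rw [h.equation, aeval_sextic]

/-- The automorphism `x ↦ -x`, `y ↦ y`. -/
theorem exists_sigma (h : IsHyperellipticModel (sextic s₁ s₂) x y)
    (hf : Squarefree (sextic s₁ s₂)) : ∃ σ : K ≃ₐ[k] K, σ x = -x ∧ σ y = y := by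
  refine h.exists_algEquiv_self hf (natDegree_sextic_ne_zero _ _) ?_ ?_ ⟨?_, ?_⟩
  · exact fun ha => h.transcendental (by simpa using ha.neg)
  · rw [aeval_sextic, h.equation_sextic]; ring
  · simpa using neg_mem (subset_adjoin k {-x, y} (Set.mem_insert _ _))
  · exact subset_adjoin k _ (by simp)

variable [CharZero k]

theorem orderOf_sigma (h : IsHyperellipticModel (sextic s₁ s₂) x y) {σ : K ≃ₐ[k] K}
    (hx : σ x = -x) (hy : σ y = y) : orderOf σ = 2 :=
  h.orderOf_eq_two (by rw [hx, map_neg, hx, neg_neg]) (by rw [hy, hy])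
    ⟨x, by rw [hx]; exact h.neg_ne_left⟩

theorem orderOf_sigma_neg (h : IsHyperellipticModel (sextic s₁ s₂) x y) {σ : K ≃ₐ[k] K}
    (hx : σ x = -x) (hy : σ y = -y) : orderOf σ = 2 :=
  h.orderOf_eq_two (by rw [hx, map_neg, hx, neg_neg]) (by rw [hy, map_neg, hy, neg_neg])
    ⟨x, by rw [hx]; exact h.neg_ne_left⟩

theorem ellipticSubfieldOne_eq (h : IsHyperellipticModel (sextic s₁ s₂) x y) {σ : K ≃ₐ[k] K}
    (hx : σ x = -x) (hy : σ y = y) :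
    ellipticSubfieldOne k x y = fixedField (Subgroup.zpowers σ) := by
  refine adjoin_eq_fixedField (h.orderOf_sigma hx hy) ?_ (z := x) ?_ ?_
  · rintro z (rfl | rfl)
    · rw [map_pow, hx, neg_sq]
    · exact hy
  · exact subset_adjoin k _ (by simp)
  · rw [eq_top_iff, ← h.adjoin_eq_top]
    exact adjoin.mono _ _ _ (by rintro z (rfl | rfl) <;> simp)

theorem ellipticSubfieldTwo_eq (h : IsHyperellipticModel (sextic s₁ s₂) x y) {σ : K ≃ₐ[k] K}
    (hx : σ x = -x) (hy : σ y = -y) :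
    ellipticSubfieldTwo k x y = fixedField (Subgroup.zpowers σ) := by
  refine adjoin_eq_fixedField (h.orderOf_sigma_neg hx hy) ?_ (z := x) ?_ ?_
  · rintro z (rfl | rfl)
    · rw [map_pow, hx, neg_sq]
    · rw [map_mul, hx, hy, neg_mul_neg]
  · exact subset_adjoin k _ (by simp)
  · rw [eq_top_iff, ← h.adjoin_eq_top, adjoin_le_iff, Set.insert_subset_iff,
      Set.singleton_subset_iff]
    have hx' : x ∈ adjoin k (insert x {x ^ 2, y * x}) := subset_adjoin k _ (by simp)
    have hyx : y * x ∈ adjoin k (insert x {x ^ 2, y * x}) := subset_adjoin k _ (by simp)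
    refine ⟨hx', ?_⟩
    have := div_mem hyx hx'
    rwa [mul_div_cancel_right₀ _ h.ne_zero_left] at this

theorem finrank_ellipticSubfieldOne (h : IsHyperellipticModel (sextic s₁ s₂) x y)
    (hf : Squarefree (sextic s₁ s₂)) : Module.finrank (ellipticSubfieldOne k x y) K = 2 := by
  obtain ⟨σ, hx, hy⟩ := h.exists_sigma hf
  rw [h.ellipticSubfieldOne_eq hx hy]
  exact finrank_fixedField_zpowers (h.orderOf_sigma hx hy)

theorem finrank_ellipticSubfieldTwo (h : IsHyperellipticModel (sextic s₁ s₂) x y)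
    (hf : Squarefree (sextic s₁ s₂)) : Module.finrank (ellipticSubfieldTwo k x y) K = 2 := by
  obtain ⟨σ, hx, hy⟩ := h.exists_sigma hf
  obtain ⟨ι, hιx, hιy⟩ := h.exists_involution hf (natDegree_sextic_ne_zero _ _)
  have hx' : (ι * σ) x = -x := by rw [AlgEquiv.mul_apply, hx, map_neg, hιx]
  have hy' : (ι * σ) y = -y := by rw [AlgEquiv.mul_apply, hy, hιy]
  rw [h.ellipticSubfieldTwo_eq hx' hy']
  exact finrank_fixedField_zpowers (h.orderOf_sigma_neg hx' hy')

theorem hasJInvariant_ellipticSubfieldOne (h : IsHyperellipticModel (sextic s₁ s₂) x y)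
    (hr : AreRoots s₁ s₂ e₁ e₂ e₃) :
    HasJInvariant k (ellipticSubfieldOne k x y) (rootJ e₁ e₂ e₃) := by
  refine IsHyperellipticModel.hasJInvariant hr.distinct (of_adjoin (x := x ^ 2) (y := y)
    (h.transcendental.pow two_pos) ?_ rfl (subset_adjoin k _ (by simp))
    (subset_adjoin k _ (by simp)))
  rw [hr.rootCubic_eq, h.equation_sextic]
  simp only [map_sub, map_add, map_mul, map_pow, aeval_X, aeval_C, map_one]
  ring

/-- The subfield `k(x², yx)` is generated by `x⁻²` and `i y x⁻³`, where `i² = -1`; these satisfy the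
equation with `s₁` and `s₂` interchanged. -/
theorem hasJInvariant_ellipticSubfieldTwo [IsAlgClosed k]
    (h : IsHyperellipticModel (sextic s₁ s₂) x y) (hr : AreRoots s₁ s₂ e₁ e₂ e₃) :
    HasJInvariant k (ellipticSubfieldTwo k x y) (rootJ (e₂ * e₃) (e₁ * e₃) (e₁ * e₂)) := by
  obtain ⟨i, hi⟩ := IsAlgClosed.exists_pow_nat_eq (-1 : k) two_pos
  have hi0 : i ≠ 0 := by rintro rfl; norm_num at hi
  have hx0 := h.ne_zero_left
  have hx : x ^ 2 ∈ ellipticSubfieldTwo k x y := subset_adjoin k _ (by simp)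
  have hyx : y * x ∈ ellipticSubfieldTwo k x y := subset_adjoin k _ (by simp)
  have hL : ellipticSubfieldTwo k x y =
      adjoin k {(x ^ 2)⁻¹, algebraMap k K i * (y * x) / (x ^ 2) ^ 2} := by
    apply le_antisymm
    · have h1 : (x ^ 2)⁻¹ ∈ adjoin k {(x ^ 2)⁻¹, algebraMap k K i * (y * x) / (x ^ 2) ^ 2} :=
        subset_adjoin k _ (by simp)
      have h2 : algebraMap k K i * (y * x) / (x ^ 2) ^ 2 ∈
          adjoin k {(x ^ 2)⁻¹, algebraMap k K i * (y * x) / (x ^ 2) ^ 2} :=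
        subset_adjoin k _ (by simp)
      rw [ellipticSubfieldTwo, adjoin_le_iff, Set.insert_subset_iff, Set.singleton_subset_iff]
      have h3 := inv_mem h1
      rw [inv_inv] at h3
      refine ⟨h3, ?_⟩
      have h4 := mul_mem (mul_mem (_root_.algebraMap_mem _ i⁻¹) h2) (pow_mem h3 2)
      have hi' : algebraMap k K i ≠ 0 := (_root_.map_ne_zero _).2 hi0
      rw [map_inv₀] at h4
      have h5 : (algebraMap k K i)⁻¹ * (algebraMap k K i * (y * x) / (x ^ 2) ^ 2) * (x ^ 2) ^ 2 =
          y * x := by field_simp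
      rwa [h5] at h4
    · rw [adjoin_le_iff, Set.insert_subset_iff, Set.singleton_subset_iff]
      exact ⟨inv_mem hx, div_mem (mul_mem (_root_.algebraMap_mem _ i) hyx) (pow_mem hx 2)⟩
  refine IsHyperellipticModel.hasJInvariant hr.inv.distinct (of_adjoin
    (transcendental_inv (h.transcendental.pow two_pos)) ?_ hL (inv_mem hx)
    (div_mem (mul_mem (_root_.algebraMap_mem _ i) hyx) (pow_mem hx 2)))
  have hi2 : algebraMap k K i ^ 2 = -1 := by rw [← map_pow, hi, map_neg, map_one]
  rw [hr.inv.rootCubic_eq, div_pow, mul_pow, mul_pow, h.equation_sextic, hi2]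
  simp only [map_sub, map_add, map_mul, map_pow, aeval_X, aeval_C, map_one]
  field_simp
  ring

end IsHyperellipticModel

end Sextic

/-! ### Identities between the `j`-invariants -/

section Identities

variable {k : Type*} [Field k]

variable {s₁ s₂ u v : k}

theorem subcoverJ_eq (hu : u = s₁ * s₂) (hv : v = s₁ ^ 3 + s₂ ^ 3) :
    subcoverJ s₁ s₂ = 256 * (s₁ ^ 2 - 3 * s₂) ^ 3 / (u ^ 2 + 18 * u - 4 * v - 27) ∧
      subcoverJ s₂ s₁ = 256 * (s₂ ^ 2 - 3 * s₁) ^ 3 / (u ^ 2 + 18 * u - 4 * v - 27) := by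
  constructor <;> rw [subcoverJ, hu, hv] <;> congr 1 <;> ring

theorem subcoverJ_add (hu : u = s₁ * s₂) (hv : v = s₁ ^ 3 + s₂ ^ 3) :
    subcoverJ s₁ s₂ + subcoverJ s₂ s₁ =
      -256 * (2 * u ^ 3 - 54 * u ^ 2 + 9 * u * v - v ^ 2 + 27 * v) /
        (u ^ 2 + 18 * u - 4 * v - 27) := by
  rw [(subcoverJ_eq hu hv).1, (subcoverJ_eq hu hv).2, ← add_div]
  congr 1
  rw [hu, hv]; ring

theorem subcoverJ_mul (hu : u = s₁ * s₂) (hv : v = s₁ ^ 3 + s₂ ^ 3) :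
    subcoverJ s₁ s₂ * subcoverJ s₂ s₁ =
      65536 * (u ^ 2 + 9 * u - 3 * v) ^ 3 / (u ^ 2 + 18 * u - 4 * v - 27) ^ 2 := by
  rw [(subcoverJ_eq hu hv).1, (subcoverJ_eq hu hv).2, div_mul_div_comm]
  congr 1
  · rw [hu, hv]; ring
  · ring

theorem subcoverJ_eq_iff [CharZero k] (hu : u = s₁ * s₂) (hv : v = s₁ ^ 3 + s₂ ^ 3)
    (hD : u ^ 2 + 18 * u - 4 * v - 27 ≠ 0) :
    subcoverJ s₁ s₂ = subcoverJ s₂ s₁ ↔ (v ^ 2 - 4 * u ^ 3) * (v - 9 * u + 27) = 0 := by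
  rw [(subcoverJ_eq hu hv).1, (subcoverJ_eq hu hv).2, div_left_inj' hD]
  have h1 : (v ^ 2 - 4 * u ^ 3) * (v - 9 * u + 27) =
      (s₁ ^ 3 - s₂ ^ 3) ^ 2 * (s₁ ^ 3 + s₂ ^ 3 - 9 * (s₁ * s₂) + 27) := by
    rw [hu, hv]; ring
  have h2 : 256 * (s₁ ^ 2 - 3 * s₂) ^ 3 - 256 * (s₂ ^ 2 - 3 * s₁) ^ 3 =
      256 * ((s₁ ^ 3 - s₂ ^ 3) * (s₁ ^ 3 + s₂ ^ 3 - 9 * (s₁ * s₂) + 27)) := by ring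
  have h256 : (256 : k) ≠ 0 := by norm_num
  rw [← sub_eq_zero, h2, h1, mul_eq_zero, mul_eq_zero, mul_eq_zero, pow_eq_zero_iff two_ne_zero,
    or_iff_right h256]

/-- The modular polynomial of level two, homogenised in the sum and the product of its arguments. -/
theorem modularTwo_eq {x y a b d : k} (hd : d ≠ 0) (ha : x + y = a / d) (hb : x * y = b / d ^ 2) :
    modularTwo x y =
      (a ^ 3 * d - 3 * a * b * d - b ^ 2 + 1488 * (a * b * d) -
        162000 * (a ^ 2 * d ^ 2 - 2 * b * d ^ 2) + 40773375 * (b * d ^ 2) +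
        8748000000 * (a * d ^ 3) - 157464000000000 * d ^ 4) / d ^ 4 := by
  have h : modularTwo x y =
      (x + y) ^ 3 - 3 * (x + y) * (x * y) - (x * y) ^ 2 + 1488 * ((x + y) * (x * y)) -
        162000 * ((x + y) ^ 2 - 2 * (x * y)) + 40773375 * (x * y) + 8748000000 * (x + y) -
        157464000000000 := by
    rw [modularTwo]; ring
  rw [h, ha, hb]
  field_simp

/-- The modular polynomial of level three, homogenised in the sum and the product of its
arguments. -/
theorem modularThree_eq {x y a b d : k} (hd : d ≠ 0) (ha : x + y = a / d)
    (hb : x * y = b / d ^ 2) :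
    modularThree x y =
      (a ^ 4 * d ^ 2 - 4 * a ^ 2 * b * d ^ 2 + 2 * b ^ 2 * d ^ 2 - b ^ 3 + 2232 * (a * b ^ 2 * d) -
        1069956 * (b * (a ^ 2 - 2 * b) * d ^ 2) + 36864000 * (a ^ 3 - 3 * a * b) * d ^ 3 +
        2587918086 * b ^ 2 * d ^ 2 + 8900222976000 * (a * b * d ^ 3) +
        452984832000000 * (a ^ 2 - 2 * b) * d ^ 4 - 770845966336000000 * (b * d ^ 4) +
        1855425871872000000000 * (a * d ^ 5)) / d ^ 6 := by
  have h : modularThree x y =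
      (x + y) ^ 4 - 4 * (x + y) ^ 2 * (x * y) + 2 * (x * y) ^ 2 - (x * y) ^ 3 +
        2232 * ((x + y) * (x * y) ^ 2) - 1069956 * ((x * y) * ((x + y) ^ 2 - 2 * (x * y))) +
        36864000 * ((x + y) ^ 3 - 3 * (x + y) * (x * y)) + 2587918086 * (x * y) ^ 2 +
        8900222976000 * ((x + y) * (x * y)) + 452984832000000 * ((x + y) ^ 2 - 2 * (x * y)) -
        770845966336000000 * (x * y) + 1855425871872000000000 * (x + y) := by
    rw [modularThree]; ring
  rw [h, ha, hb]
  field_simp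

set_option maxHeartbeats 1000000 in
/-- The modular polynomial of level two at the `j`-invariants of the two elliptic subfields. -/
theorem modularTwo_subcoverJ (hu : u = s₁ * s₂) (hv : v = s₁ ^ 3 + s₂ ^ 3)
    (hD : u ^ 2 + 18 * u - 4 * v - 27 ≠ 0) :
    modularTwo (subcoverJ s₁ s₂) (subcoverJ s₂ s₁) =
      -4096 * (fOne u v * fTwo u v) / (u ^ 2 + 18 * u - 4 * v - 27) ^ 4 := by
  rw [modularTwo_eq hD (subcoverJ_add hu hv) (subcoverJ_mul hu hv), fOne, fTwo]
  congr 1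
  ring

set_option maxHeartbeats 1000000 in
/-- The modular polynomial of level three at the `j`-invariants of the two elliptic subfields. -/
theorem modularThree_subcoverJ (hu : u = s₁ * s₂) (hv : v = s₁ ^ 3 + s₂ ^ 3)
    (hD : u ^ 2 + 18 * u - 4 * v - 27 ≠ 0) :
    modularThree (subcoverJ s₁ s₂) (subcoverJ s₂ s₁) =
      4294967296 * ((4 * v - u ^ 2 + 110 * u - 1125) * gOne u v * gTwo u v) /
        (u ^ 2 + 18 * u - 4 * v - 27) ^ 6 := by
  rw [modularThree_eq hD (subcoverJ_add hu hv) (subcoverJ_mul hu hv), gOne, gTwo]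
  congr 1
  ring

variable [CharZero k]

theorem modularTwo_subcoverJ_eq_zero_iff (hu : u = s₁ * s₂) (hv : v = s₁ ^ 3 + s₂ ^ 3)
    (hD : u ^ 2 + 18 * u - 4 * v - 27 ≠ 0) :
    modularTwo (subcoverJ s₁ s₂) (subcoverJ s₂ s₁) = 0 ↔ fOne u v * fTwo u v = 0 := by
  have h : (-4096 : k) ≠ 0 := by norm_num
  rw [modularTwo_subcoverJ hu hv hD, div_eq_zero_iff, or_iff_left (pow_ne_zero 4 hD), mul_eq_zero,
    or_iff_right h]

theorem modularThree_subcoverJ_eq_zero_iff (hu : u = s₁ * s₂) (hv : v = s₁ ^ 3 + s₂ ^ 3)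
    (hD : u ^ 2 + 18 * u - 4 * v - 27 ≠ 0) :
    modularThree (subcoverJ s₁ s₂) (subcoverJ s₂ s₁) = 0 ↔
      (4 * v - u ^ 2 + 110 * u - 1125) * gOne u v * gTwo u v = 0 := by
  have h : (4294967296 : k) ≠ 0 := by norm_num
  rw [modularThree_subcoverJ hu hv hD, div_eq_zero_iff, or_iff_left (pow_ne_zero 6 hD), mul_eq_zero,
    or_iff_right h]

end Identities

/-! ### Automorphisms commuting with the hyperelliptic involution -/

section Automorphisms

open Polynomial IntermediateField

variable {k K : Type*} [Field k] [Field K] [Algebra k K]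

theorem Transcendental.eq_zero_of_quadratic {k F : Type*} [Field k] [Field F] [Algebra k F] {x : F}
    (hx : Transcendental k x) {p q r : k}
    (h : algebraMap k F p * x ^ 2 + algebraMap k F q * x + algebraMap k F r = 0) :
    p = 0 ∧ q = 0 ∧ r = 0 := by
  have h1 : Polynomial.aeval x (C p * X ^ 2 + C q * X + C r) = Polynomial.aeval x (0 : k[X]) := by
    simpa using h
  have h2 := transcendental_iff_injective.1 hx h1
  refine ⟨?_, ?_, ?_⟩
  · simpa using congrArg (coeff · 2) h2
  · simpa [coeff_X, coeff_C] using congrArg (coeff · 1) h2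
  · simpa using congrArg (coeff · 0) h2

theorem HasJInvariant.of_algEquiv {F F' : Type*} [Field F] [Field F'] [Algebra k F] [Algebra k F']
    {j : k} (h : HasJInvariant k F j) (e : F' ≃ₐ[k] F) : HasJInvariant k F' j := by
  obtain ⟨W, hW, hj, ⟨φ⟩⟩ := h
  exact ⟨W, hW, hj, ⟨e.trans φ⟩⟩

theorem AreConjugate.hasJInvariant {F F' : IntermediateField k K} (h : AreConjugate F F') {j : k}
    (hF : HasJInvariant k F j) : HasJInvariant k F' j := by
  obtain ⟨g, rfl⟩ := h
  exact hF.of_algEquiv (equivMap F (g : K →ₐ[k] K)).symm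

theorem AreConjugate.symm {F F' : IntermediateField k K} (h : AreConjugate F F') :
    AreConjugate F' F := by
  obtain ⟨g, rfl⟩ := h
  refine ⟨g.symm, ?_⟩
  ext z
  simp [mem_map]

theorem AreConjugate.trans {F F' F'' : IntermediateField k K} (h : AreConjugate F F')
    (h' : AreConjugate F' F'') : AreConjugate F F'' := by
  obtain ⟨g, rfl⟩ := h
  obtain ⟨g', rfl⟩ := h'
  exact ⟨g' * g, (IntermediateField.map_map F (g : K →ₐ[k] K) (g' : K →ₐ[k] K)).symm⟩

variable [CharZero k]

/-- A rational function field is not the function field of an elliptic curve, because points of an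
elliptic curve over `k(t)` are constant. -/
theorem not_hasJInvariant_adjoin_simple [IsAlgClosed k] {t : K} (ht : Transcendental k t) (j : k) :
    ¬ HasJInvariant k k⟮t⟯ j := by
  intro h
  obtain ⟨e₁, e₂, e₃, he, rfl⟩ := exists_rootJ_eq j
  obtain ⟨x, y, hxy⟩ := h.exists_model he
  have heq : (y : K) ^ 2 = aeval (x : K) (rootCubic e₁ e₂ e₃) := by
    have := congrArg (k⟮t⟯.val) hxy.equation
    rwa [map_pow, ← aeval_algHom_apply] at this
  obtain ⟨a, ha⟩ := exists_eq_algebraMap_of_mem_adjoin_simple he ht x.2 y.2 heq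
  exact hxy.transcendental
    ((isAlgebraic_algHom_iff k⟮t⟯.val k⟮t⟯.val.injective).1
      ((congrArg (IsAlgebraic k) ha).mpr (isAlgebraic_algebraMap a)))

namespace IsHyperellipticModel

variable {s₁ s₂ : k} {x y : K}

theorem orderOf_involution {f : k[X]} (h : IsHyperellipticModel f x y) (hf : f ≠ 0)
    {ι : K ≃ₐ[k] K} (hx : ι x = x) (hy : ι y = -y) : orderOf ι = 2 := by
  have : CharZero K := charZero_of_injective_algebraMap (algebraMap k K).injective
  refine h.orderOf_eq_two (by rw [hx, hx]) (by rw [hy, map_neg, hy, neg_neg]) ⟨y, ?_⟩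
  rw [hy]
  exact fun h' => h.ne_zero hf (self_eq_neg.1 h'.symm)

theorem fixedField_involution {f : k[X]} (h : IsHyperellipticModel f x y) (hf : Squarefree f)
    (hd : f.natDegree ≠ 0) {ι : K ≃ₐ[k] K} (hx : ι x = x) (hy : ι y = -y) :
    fixedField (Subgroup.zpowers ι) = k⟮x⟯ := by
  apply le_antisymm
  · intro z hz
    exact (h.exists_of_involution hf hd hx hy z).1 (mem_fixedField_zpowers.1 hz)
  · rw [adjoin_simple_le_iff]
    exact mem_fixedField_zpowers.2 hx

/-- An automorphism commuting with the hyperelliptic involution acts on `x` by a fractional linear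
transformation, under which the sextic form is semi-invariant. -/
theorem exists_moebius (h : IsHyperellipticModel (sextic s₁ s₂) x y)
    (hf : Squarefree (sextic s₁ s₂)) {ι g : K ≃ₐ[k] K} (hx : ι x = x) (hy : ι y = -y)
    (hg : g * ι = ι * g) : ∃ a b c d r : k,
      algebraMap k K c * x + algebraMap k K d ≠ 0 ∧ r ≠ 0 ∧
      g x * (algebraMap k K c * x + algebraMap k K d) = algebraMap k K a * x + algebraMap k K b ∧
      g y * (algebraMap k K c * x + algebraMap k K d) ^ 3 = algebraMap k K r * y ∧
      ∀ t : k, (a * t + b) ^ 6 - s₁ * (a * t + b) ^ 4 * (c * t + d) ^ 2 +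
        s₂ * (a * t + b) ^ 2 * (c * t + d) ^ 4 - (c * t + d) ^ 6 =
          r ^ 2 * (t ^ 6 - s₁ * t ^ 4 + s₂ * t ^ 2 - 1) := by
  have hd := natDegree_sextic_ne_zero s₁ s₂
  have hA : ι (g x) = g x := by
    have := DFunLike.congr_fun hg x
    rw [AlgEquiv.mul_apply, AlgEquiv.mul_apply, hx] at this
    exact this.symm
  have hB : ι (g y) = -g y := by
    have := DFunLike.congr_fun hg y
    rw [AlgEquiv.mul_apply, AlgEquiv.mul_apply, hy, map_neg] at this
    exact this.symm
  obtain ⟨p, q, hpq, hq, hz⟩ := exists_isCoprime_of_mem_adjoin_simple h.transcendental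
    ((h.exists_of_involution hf hd hx hy _).1 hA)
  obtain ⟨b₀, hb, hby⟩ := (h.exists_of_involution hf hd hx hy _).2 hB
  have hfin := h.finrank_fieldRange h hf hd hf hd (g : K →ₐ[k] K) hpq hq hz
  rw [AlgHom.fieldRange_eq_top.2 g.surjective, IntermediateField.finrank_top] at hfin
  have hp1 : p.natDegree ≤ 1 := hfin ▸ le_max_left _ _
  have hq1 : q.natDegree ≤ 1 := hfin ▸ le_max_right _ _
  have hqx := aeval_ne_zero_of_transcendental h.transcendental hq
  have hxm : x ∈ k⟮x⟯ := mem_adjoin_simple_self k x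
  have hy0 : y ≠ 0 := h.ne_zero hf.ne_zero
  have hb0 : b₀ ≠ 0 := by
    rintro rfl
    rw [zero_mul, EmbeddingLike.map_eq_zero_iff] at hby
    exact hy0 hby
  obtain ⟨R, hR, hF⟩ := exists_aeval_eq_of_sq_mul h.transcendental
    (mul_mem hb (pow_mem (aeval_mem_of_mem hxm q) 3)) hf
    (g := p ^ 6 - C s₁ * p ^ 4 * q ^ 2 + C s₂ * p ^ 2 * q ^ 4 - q ^ 6) (by
      have h1 : (g y) ^ 2 = aeval (g x) (sextic s₁ s₂) := by
        rw [← map_pow, h.equation]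
        exact (aeval_algHom_apply (g : K →ₐ[k] K) x _).symm
      rw [hby, mul_pow, h.equation, aeval_sextic (x := g x)] at h1
      simp only [map_sub, map_add, map_mul, map_pow, aeval_C, ← hz]
      linear_combination (aeval x q) ^ 6 * h1)
  obtain ⟨a, b, rfl⟩ : ∃ a b, p = C a * X + C b := ⟨_, _, eq_X_add_C_of_natDegree_le_one hp1⟩
  obtain ⟨c, d, rfl⟩ : ∃ c d, q = C c * X + C d := ⟨_, _, eq_X_add_C_of_natDegree_le_one hq1⟩
  have hR0 : R ≠ 0 := by
    rintro rfl
    rw [map_zero] at hR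
    exact mul_ne_zero hb0 (pow_ne_zero 3 hqx) hR
  have hdeg : ((C a * X + C b) ^ 6 - C s₁ * (C a * X + C b) ^ 4 * (C c * X + C d) ^ 2 +
      C s₂ * (C a * X + C b) ^ 2 * (C c * X + C d) ^ 4 - (C c * X + C d) ^ 6).natDegree ≤ 6 := by
    compute_degree
  rw [hF, natDegree_mul hf.ne_zero (pow_ne_zero 2 hR0), natDegree_sextic, natDegree_pow] at hdeg
  obtain ⟨r, rfl⟩ := natDegree_eq_zero.1 (show R.natDegree = 0 by omega)
  simp only [map_add, map_mul, aeval_C, aeval_X] at hz hqx hR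
  refine ⟨a, b, c, d, r, hqx, fun h0 => hR0 (by rw [h0, C_0]), hz, ?_, fun t => ?_⟩
  · rw [hby, ← hR]; ring
  · have := congrArg (eval t) hF
    simp only [sextic, eval_sub, eval_add, eval_mul, eval_pow, eval_C, eval_X, eval_one] at this
    rw [this]; ring

end IsHyperellipticModel

end Automorphisms

/-! ### Dihedral automorphism group of order eight -/

section DihedralFour

open Polynomial IntermediateField

/-- In the dihedral group of order eight, of two commuting involutions `a ≠ b` the first is central
or conjugate to `b` or to `a b`. -/
theorem DihedralGroup.exists_conj_or_central : ∀ a b : DihedralGroup 4, a ^ 2 = 1 → b ^ 2 = 1 →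
    a ≠ 1 → b ≠ 1 → a ≠ b → a * b = b * a →
      (∃ g, g * a * g⁻¹ = b) ∨ (∃ g, g * a * g⁻¹ = a * b) ∨ ∀ g, g * a = a * g := by
  decide

/-- In the dihedral group of order eight, a noncentral involution is conjugate to its product with
the central one. -/
theorem DihedralGroup.exists_conj_eq_mul : ∀ a b : DihedralGroup 4, (∀ g, g * a = a * g) →
    a ≠ 1 → b ^ 2 = 1 → b ≠ 1 → b ≠ a → ∃ g, g * b = a * b * g := by
  decide

theorem DihedralGroup.not_conj_of_ne_comm : ∀ b c : DihedralGroup 4, b ^ 2 = 1 → c ^ 2 = 1 →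
    b * c ≠ c * b → ∀ g, g * b * g⁻¹ ≠ c := by
  decide

set_option maxRecDepth 4000 in
/-- In the dihedral group of order eight, every noncentral involution is conjugate to one of two
given noncommuting involutions. -/
theorem DihedralGroup.conj_or_conj : ∀ a : DihedralGroup 4, a ≠ 1 → (∀ g, g * a = a * g) →
    ∀ b c d : DihedralGroup 4, b ^ 2 = 1 → c ^ 2 = 1 → b * c ≠ c * b → d ^ 2 = 1 → d ≠ 1 →
      d ≠ a → (∃ g, g * b * g⁻¹ = d) ∨ ∃ g, g * c * g⁻¹ = d := by
  decide

theorem modularTwo_comm {k : Type*} [Field k] (x y : k) : modularTwo x y = modularTwo y x := by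
  rw [modularTwo, modularTwo]; ring

namespace IsHyperellipticModel

variable {k K : Type*} [Field k] [Field K] [Algebra k K] [CharZero k] {s₁ s₂ s : k} {x y : K}

/-- If the involutions `σ : x ↦ -x, y ↦ y` and `ι σ` are conjugate, then after rescaling `x` the two
parameters of the sextic agree. -/
theorem exists_symmetric (h : IsHyperellipticModel (sextic s₁ s₂) x y)
    (hf : Squarefree (sextic s₁ s₂)) {ι σ g : K ≃ₐ[k] K} (hx : ι x = x) (hy : ι y = -y)
    (hσx : σ x = -x) (hσy : σ y = y) (hgι : g * ι = ι * g) (hg : g * σ = ι * σ * g) :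
    ∃ a : k, a ^ 6 = 1 ∧ s₂ = s₁ * a ^ 4 := by
  obtain ⟨a, b, c, d, r, hne, hr, hm, hn, hP⟩ := h.exists_moebius hf hx hy hgι
  have hx0 := h.ne_zero_left
  have hgx : (ι * σ) (g x) = -g x := by
    have := DFunLike.congr_fun hg x
    rw [AlgEquiv.mul_apply, hσx, map_neg] at this
    exact this.symm
  have hgy : (ι * σ) (g y) = g y := by
    have := DFunLike.congr_fun hg y
    rw [AlgEquiv.mul_apply, hσy] at this
    exact this.symm
  have hτx : (ι * σ) x = -x := by rw [AlgEquiv.mul_apply, hσx, map_neg, hx]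
  have hτy : (ι * σ) y = -y := by rw [AlgEquiv.mul_apply, hσy, hy]
  have hm' := congrArg (ι * σ) hm
  have hn' := congrArg (ι * σ) hn
  simp only [map_mul (ι * σ), map_add, map_pow, AlgEquiv.commutes, hgx, hgy, hτx, hτy] at hm' hn'
  have hgx0 : g x ≠ 0 := (map_ne_zero_iff g g.injective).2 hx0
  have hgy0 : g y ≠ 0 := (map_ne_zero_iff g g.injective).2 (h.ne_zero hf.ne_zero)
  have h2 : (2 : k) ≠ 0 := two_ne_zero
  obtain ⟨-, -, k3⟩ := h.transcendental.eq_zero_of_quadratic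
    (p := 6 * c ^ 2 * d) (q := 0) (r := 2 * d ^ 3) (by
      apply mul_left_cancel₀ hgy0
      simp only [map_mul, map_pow, map_zero, map_ofNat]
      linear_combination hn + hn')
  obtain rfl : d = 0 := pow_eq_zero_iff three_ne_zero |>.1 ((mul_eq_zero.1 k3).resolve_left h2)
  obtain ⟨k1, -, -⟩ := h.transcendental.eq_zero_of_quadratic
    (p := 2 * (a * c)) (q := 0) (r := 0) (by
      simp only [map_mul, map_zero, map_ofNat] at hm hm' ⊢
      linear_combination (algebraMap k K c * x) * (hm' - hm))
  have hc : c ≠ 0 := by rintro rfl; simp at hne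
  obtain rfl : a = 0 := (mul_eq_zero.1 ((mul_eq_zero.1 k1).resolve_left h2)).resolve_right hc
  -- the automorphism acts by `x ↦ b / (c x)`; its effect on the coefficients of the sextic is found
  -- by interpolation from the values at `0, 1, 2, 3`
  have E0 := hP 0
  have E1 := hP 1
  have E2 := hP 2
  have E3 := hP 3
  have q0 : b ^ 6 = -r ^ 2 := by linear_combination E0
  have q6 : -c ^ 6 = r ^ 2 := by
    linear_combination (E3 / 3 - 2 * E2 + 5 * E1 - (1 / 3 - 2 + 5) * E0) / 120
  have q4 : s₂ * b ^ 2 * c ^ 4 = -(r ^ 2 * s₁) := by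
    linear_combination (E2 / 4 - E1 - (1 / 4 - 1) * E0) / 3 - 5 * q6
  have q2 : -(s₁ * b ^ 4 * c ^ 2) = r ^ 2 * s₂ := by
    linear_combination E1 - E0 - q4 - q6
  refine ⟨b / c, ?_, ?_⟩
  · field_simp
    linear_combination q0 + q6
  · field_simp
    apply mul_left_cancel₀ (pow_ne_zero 2 hc)
    linear_combination -s₂ * q6 + q2

theorem rescale (h : IsHyperellipticModel (sextic s₁ s₂) x y) {a : k} (ha : a ^ 6 = 1)
    (hs : s₂ = s₁ * a ^ 4) :
    IsHyperellipticModel (sextic (s₁ * a ^ 2) (s₁ * a ^ 2)) (algebraMap k K a * x) y := by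
  have ha0 : a ≠ 0 := by rintro rfl; simp at ha
  have ha0' : algebraMap k K a ≠ 0 := (_root_.map_ne_zero _).2 ha0
  refine ⟨?_, ?_, ?_⟩
  · intro hal
    have := (isAlgebraic_algebraMap (A := K) a⁻¹).mul hal
    rw [← mul_assoc, ← map_mul, inv_mul_cancel₀ ha0, map_one, one_mul] at this
    exact h.transcendental this
  · have ha' : algebraMap k K a ^ 6 = 1 := by rw [← map_pow, ha, map_one]
    rw [h.equation_sextic, aeval_sextic, hs]
    simp only [map_mul, map_pow]
    linear_combination (-x ^ 6 + algebraMap k K s₁ * x ^ 4) * ha'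
  · rw [eq_top_iff, ← h.adjoin_eq_top, adjoin_le_iff, Set.insert_subset_iff,
      Set.singleton_subset_iff]
    refine ⟨?_, subset_adjoin k _ (by simp)⟩
    have h1 : algebraMap k K a * x ∈ adjoin k {algebraMap k K a * x, y} :=
      subset_adjoin k _ (by simp)
    have h2 := mul_mem (_root_.algebraMap_mem (adjoin k {algebraMap k K a * x, y}) a⁻¹) h1
    rwa [← mul_assoc, ← map_mul, inv_mul_cancel₀ ha0, map_one, one_mul] at h2

/-- The automorphism `x ↦ -1 / x`, `y ↦ i y / x³` of the symmetric sextic, where `i² = -1`. -/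
theorem exists_mu (h : IsHyperellipticModel (sextic s s) x y) (hf : Squarefree (sextic s s)) {i : k}
    (hi : i ^ 2 = -1) : ∃ μ : K ≃ₐ[k] K, μ x = -x⁻¹ ∧ μ y = algebraMap k K i * y / x ^ 3 := by
  have hx0 := h.ne_zero_left
  have hi0 : i ≠ 0 := by rintro rfl; norm_num at hi
  have hi2 : algebraMap k K i ^ 2 = -1 := by rw [← map_pow, hi, map_neg, map_one]
  have hi' : algebraMap k K i ≠ 0 := (_root_.map_ne_zero _).2 hi0
  refine h.exists_algEquiv_self hf (natDegree_sextic_ne_zero _ _) ?_ ?_ ?_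
  · exact fun ha => transcendental_inv h.transcendental (by simpa using ha.neg)
  · rw [aeval_sextic, div_pow, mul_pow, h.equation_sextic, hi2]
    field_simp
    ring
  · have h1 : -x⁻¹ ∈ adjoin k {-x⁻¹, algebraMap k K i * y / x ^ 3} := subset_adjoin k _ (by simp)
    have h2 : algebraMap k K i * y / x ^ 3 ∈ adjoin k {-x⁻¹, algebraMap k K i * y / x ^ 3} :=
      subset_adjoin k _ (by simp)
    have h3 := inv_mem (neg_mem h1)
    rw [neg_neg, inv_inv] at h3
    refine ⟨h3, ?_⟩
    have h4 := mul_mem (mul_mem (_root_.algebraMap_mem _ i⁻¹) h2) (pow_mem h3 3)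
    have h5 : algebraMap k K i⁻¹ * (algebraMap k K i * y / x ^ 3) * x ^ 3 = y := by
      rw [map_inv₀]; field_simp
    rwa [h5] at h4

theorem orderOf_mu (h : IsHyperellipticModel (sextic s s) x y) {i : k} (hi : i ^ 2 = -1)
    {μ : K ≃ₐ[k] K} (hμx : μ x = -x⁻¹) (hμy : μ y = algebraMap k K i * y / x ^ 3) :
    orderOf μ = 2 := by
  have hx0 := h.ne_zero_left
  have hi2 : algebraMap k K i ^ 2 = -1 := by rw [← map_pow, hi, map_neg, map_one]
  refine h.orderOf_eq_two ?_ ?_ ⟨x, ?_⟩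
  · rw [hμx, map_neg, map_inv₀, hμx, inv_neg, inv_inv, neg_neg]
  · rw [hμy, map_div₀, map_mul, AlgEquiv.commutes, hμy, map_pow, hμx]
    field_simp
    linear_combination -y * hi2
  · rw [hμx]
    intro hx
    have h1 := h.transcendental.eq_zero_of_quadratic (p := 1) (q := 0) (r := 1) (by
      simp only [map_one, map_zero]
      field_simp at hx
      linear_combination -hx)
    exact one_ne_zero h1.1

theorem sub_inv_ne_zero {f : k[X]} (h : IsHyperellipticModel f x y) : x - x⁻¹ ≠ 0 := by
  have hx0 := h.ne_zero_left
  intro hx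
  have h1 := h.transcendental.eq_zero_of_quadratic (p := 1) (q := 0) (r := -1) (by
    simp only [map_one, map_zero, map_neg]
    field_simp at hx
    linear_combination hx)
  exact one_ne_zero h1.1

theorem one_add_mul_ne_zero {f : k[X]} (h : IsHyperellipticModel f x y) (i : k) :
    1 + algebraMap k K i * x ≠ 0 := by
  intro hx
  have h1 := h.transcendental.eq_zero_of_quadratic (p := 0) (q := i) (r := 1) (by
    simp only [map_one, map_zero]
    linear_combination hx)
  exact one_ne_zero h1.2.2

/-- The fixed field of `μ : x ↦ -1 / x, y ↦ i y / x³` is generated by `w = x - 1 / x` and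
`z = y (1 + i x) / x²`, which satisfy `z² = (2 i - w) (w² + 3 - s) w`. Sending the root `w = 0` to
infinity gives a Weierstrass equation. -/
theorem hasJInvariant_fixedField_mu [IsAlgClosed k] (h : IsHyperellipticModel (sextic s s) x y)
    {i c : k} (hi : i ^ 2 = -1) (hc : c ^ 2 = 3 - s) (hs : s ≠ 3)
    (hdist : AreDistinct (3 - s) (2 * c) (-(2 * c)))
    {μ : K ≃ₐ[k] K} (hμx : μ x = -x⁻¹) (hμy : μ y = algebraMap k K i * y / x ^ 3) :
    HasJInvariant k (fixedField (Subgroup.zpowers μ)) (rootJ (3 - s) (2 * c) (-(2 * c))) := by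
  have : CharZero K := charZero_of_injective_algebraMap (algebraMap k K).injective
  have hx0 := h.ne_zero_left
  have hi0 : i ≠ 0 := by rintro rfl; norm_num at hi
  have ha0 : 3 - s ≠ 0 := sub_ne_zero.2 hs.symm
  obtain ⟨I, hI⟩ : ∃ I, I = algebraMap k K i := ⟨_, rfl⟩
  obtain ⟨κ, hκ⟩ : ∃ κ, κ = algebraMap k K (2 * i * (3 - s)) := ⟨_, rfl⟩
  have hI2 : I ^ 2 = -1 := by rw [hI, ← map_pow, hi, map_neg, map_one]
  have hκ0 : κ ≠ 0 := by
    rw [hκ]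
    exact (_root_.map_ne_zero _).2 (mul_ne_zero (mul_ne_zero two_ne_zero hi0) ha0)
  have hκ' : κ = 2 * I * (3 - algebraMap k K s) := by
    rw [hκ, hI]; simp only [map_mul, map_sub, map_ofNat]
  have hIx : 1 + I * x ≠ 0 := hI ▸ h.one_add_mul_ne_zero i
  have hw0 := h.sub_inv_ne_zero
  obtain ⟨w, hw⟩ : ∃ w, w = x - x⁻¹ := ⟨_, rfl⟩
  obtain ⟨z, hz⟩ : ∃ z, z = y * (1 + I * x) / x ^ 2 := ⟨_, rfl⟩
  rw [← hw] at hw0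
  have hxw : x ^ 2 = w * x + 1 := by rw [hw]; field_simp; ring
  have hμw : μ w = w := by
    rw [hw, map_sub, map_inv₀, hμx, inv_neg, inv_inv]; ring
  have hμz : μ z = z := by
    rw [hz, map_div₀, map_mul, map_add, map_mul, map_one, map_pow, hμx, hμy, hI, μ.commutes, ← hI]
    field_simp
    linear_combination -y * hI2
  have hμκ : μ κ = κ := by rw [hκ, μ.commutes]
  have heq : z ^ 2 = (2 * I - w) * (w ^ 3 + (3 - algebraMap k K s) * w) := by
    rw [hz, hw, div_pow, mul_pow, h.equation_sextic]
    field_simp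
    linear_combination
      (x ^ 6 - algebraMap k K s * x ^ 4 + algebraMap k K s * x ^ 2 - 1) * x ^ 2 * hI2
  have hmodel : (κ * z / w ^ 2) ^ 2 =
      aeval (κ / w) (rootCubic (3 - s) (2 * c) (-(2 * c))) := by
    have hc' : algebraMap k K c ^ 2 = 3 - algebraMap k K s := by
      rw [← map_pow, hc, map_sub, map_ofNat]
    rw [aeval_rootCubic, div_pow, mul_pow, heq]
    simp only [map_sub, map_mul, map_neg, map_ofNat]
    obtain ⟨A, hA⟩ : ∃ A, A = 3 - algebraMap k K s := ⟨_, rfl⟩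
    rw [← hA] at hc' hκ' ⊢
    have hκ2 : κ ^ 2 = -4 * A ^ 2 := by rw [hκ']; linear_combination 4 * A ^ 2 * hI2
    have key : κ ^ 2 * ((2 * I - w) * (w ^ 2 + A)) =
        (κ - A * w) * (κ ^ 2 - 4 * A * w ^ 2) := by
      rw [hκ2, hκ']; ring
    field_simp
    linear_combination key + 4 * w ^ 2 * (κ - A * w) * hc'
  have htr : Transcendental k (κ / w) := by
    intro hal
    obtain ⟨m, hm⟩ := hal.exists_eq_algebraMap
    rw [div_eq_iff hw0] at hm
    have h1 := h.transcendental.eq_zero_of_quadratic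
      (p := m) (q := -(2 * i * (3 - s))) (r := -m) (by
        rw [map_neg, ← hκ, map_neg]
        linear_combination algebraMap k K m * hxw - x * hm)
    exact mul_ne_zero (mul_ne_zero two_ne_zero hi0) ha0 (neg_eq_zero.1 h1.2.1)
  have hL : adjoin k {κ / w, κ * z / w ^ 2} = fixedField (Subgroup.zpowers μ) := by
    refine adjoin_eq_fixedField (h.orderOf_mu hi hμx hμy) ?_ (z := x + x⁻¹) ?_ ?_
    · rintro t (rfl | rfl)
      · rw [map_div₀, hμw, hμκ]
      · rw [map_div₀, map_mul, map_pow, hμw, hμz, hμκ]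
    · have h1 : κ / w ∈ adjoin k {κ / w, κ * z / w ^ 2} := subset_adjoin k _ (by simp)
      have h2 : κ ∈ adjoin k {κ / w, κ * z / w ^ 2} := hκ ▸ _root_.algebraMap_mem _ _
      have h3 := div_mem h2 h1
      rw [div_div_cancel₀ hκ0] at h3
      have h4 : (x + x⁻¹) ^ 2 = w ^ 2 + 4 := by rw [hw]; field_simp; ring
      rw [h4]
      exact add_mem (pow_mem h3 2) (ofNat_mem _ 4)
    · rw [eq_top_iff, ← h.adjoin_eq_top, adjoin_le_iff, Set.insert_subset_iff,
        Set.singleton_subset_iff]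
      obtain ⟨T, hT⟩ : ∃ T, T = adjoin k (insert (x + x⁻¹) {κ / w, κ * z / w ^ 2}) := ⟨_, rfl⟩
      rw [← hT]
      have h0 : x + x⁻¹ ∈ T := hT ▸ subset_adjoin k _ (by simp)
      have h1 : κ / w ∈ T := hT ▸ subset_adjoin k _ (by simp)
      have h1' : κ * z / w ^ 2 ∈ T := hT ▸ subset_adjoin k _ (by simp)
      have h2 : κ ∈ T := hκ ▸ _root_.algebraMap_mem _ _
      have hI' : I ∈ T := hI ▸ _root_.algebraMap_mem _ _
      have h3 : w ∈ T := by
        have h3 := div_mem h2 h1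
        rwa [div_div_cancel₀ hκ0] at h3
      have h4 : x ∈ T := by
        have h4 := div_mem (add_mem h3 h0) (ofNat_mem T 2)
        rwa [show (w + (x + x⁻¹)) / OfNat.ofNat 2 = x by rw [hw]; ring] at h4
      refine ⟨h4, ?_⟩
      have h5 := div_mem (mul_mem (div_mem (mul_mem h1' (pow_mem h3 2)) h2) (pow_mem h4 2))
        (add_mem (one_mem T) (mul_mem hI' h4))
      rwa [show κ * z / w ^ 2 * w ^ 2 / κ * x ^ 2 / (1 + I * x) = y by
        rw [hz]; field_simp] at h5
  have hmem : ∀ t ∈ ({κ / w, κ * z / w ^ 2} : Set K), t ∈ fixedField (Subgroup.zpowers μ) :=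
    fun t ht => hL ▸ subset_adjoin k _ ht
  exact IsHyperellipticModel.hasJInvariant hdist (of_adjoin htr hmodel hL.symm
    (hmem _ (by simp)) (hmem _ (by simp)))

/-- For the symmetric sextic, `k(x², y)` and the fixed field of `μ : x ↦ -1 / x, y ↦ i y / x³` are
related by the universal isogeny of degree two: with `t = x² - 1`, the former has the equation
`y² = t (t² + (3 - s) t + (3 - s))`. -/
theorem exists_hasJInvariant_symmetric [IsAlgClosed k] (h : IsHyperellipticModel (sextic s s) x y)
    (hs : s ≠ 3) (hs' : s ≠ -1) {i : k} (hi : i ^ 2 = -1) {σ μ : K ≃ₐ[k] K} (hσx : σ x = -x)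
    (hσy : σ y = y) (hμx : μ x = -x⁻¹) (hμy : μ y = algebraMap k K i * y / x ^ 3) :
    ∃ j j' : k, HasJInvariant k (fixedField (Subgroup.zpowers σ)) j ∧
      HasJInvariant k (fixedField (Subgroup.zpowers μ)) j' ∧ modularTwo j j' = 0 := by
  have ha0 : 3 - s ≠ 0 := sub_ne_zero.2 hs.symm
  obtain ⟨c, hc⟩ := IsAlgClosed.exists_pow_nat_eq (3 - s) two_pos
  obtain ⟨e₂, e₃, hsum, hprod⟩ := exists_add_mul_eq (s - 1) 1
  have hdist : AreDistinct 1 e₂ e₃ := by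
    refine ⟨?_, ?_, ?_⟩
    · rintro rfl
      exact hs (by linear_combination hprod - hsum)
    · rintro rfl
      exact hs (by linear_combination hprod - hsum)
    · rintro rfl
      have h1 : (s - 3) * (s + 1) = 0 := by
        linear_combination 4 * hprod - (s - 1 + 2 * e₂) * hsum
      rcases mul_eq_zero.1 h1 with h1 | h1
      · exact hs (by linear_combination h1)
      · exact hs' (by linear_combination h1)
  have hr : AreRoots s s 1 e₂ e₃ :=
    ⟨hdist, by linear_combination hsum, by linear_combination hsum + hprod,
      by linear_combination hprod⟩
  have hdist' : AreDistinct (3 - s) (2 * c) (-(2 * c)) := by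
    have h4 : ∀ d : k, d ^ 2 = 3 - s → 3 - s ≠ 2 * d := by
      intro d hd h1
      have h2 : (3 - s) * (s + 1) = 0 := by linear_combination -4 * hd - (3 - s + 2 * d) * h1
      exact hs' (by linear_combination (mul_eq_zero.1 h2).resolve_left ha0)
    refine ⟨h4 c hc, ?_, ?_⟩
    · rw [← mul_neg]
      exact h4 (-c) (by rw [neg_sq, hc])
    · intro h1
      have h2 : (2 : k) * c = 0 := self_eq_neg.1 h1
      have h3 := (mul_eq_zero.1 h2).resolve_left two_ne_zero
      exact ha0 (by rw [← hc, h3]; ring)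
  refine ⟨_, _, (h.ellipticSubfieldOne_eq hσx hσy) ▸ h.hasJInvariant_ellipticSubfieldOne hr,
    h.hasJInvariant_fixedField_mu hi hc hs hdist' hμx hμy, ?_⟩
  have hmul : (e₂ - 1) * (e₃ - 1) = 3 - s := by linear_combination hprod - hsum
  obtain ⟨w, hw, -, hw1, hw2⟩ := rootJ_two (t₁ := e₂ - 1) (t₂ := e₃ - 1) (a := -c)
    (by rw [hmul, neg_sq, hc]) (by rwa [hmul]) (fun h1 => hdist.ne₂₃ (by linear_combination h1))
  rw [← exists_iff_modularTwo_eq_zero]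
  -- the two cubics agree with those of the universal isogeny up to `t ↦ t + 1` and `t ↦ -t`
  refine ⟨w, hw, ?_, ?_⟩
  · rw [← hw1]
    refine Eq.trans ?_ (rootJ_mul_add _ _ _ one_ne_zero 1)
    congr 1 <;> ring
  · rw [← hw2]
    refine Eq.trans ?_ (rootJ_mul_add _ _ _ (c := -1) (neg_ne_zero.2 one_ne_zero) 0)
    congr 1
    · linear_combination hsum
    · ring
    · ring

/-- The claims on elliptic subfields for a symmetric sextic, once the hyperelliptic involution is
known to be central. The elliptic subfields are the fixed fields of the non-central involutions,
which form the two conjugacy classes of `σ` and `μ`. -/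
theorem elliptic_subfields_of_symmetric [IsAlgClosed k] (h : IsHyperellipticModel (sextic s s) x y)
    (hf : Squarefree (sextic s s)) (hs : s ≠ 3) (hs' : s ≠ -1) {ι : K ≃ₐ[k] K} (hx : ι x = x)
    (hy : ι y = -y) (hι : ∀ g, g * ι = ι * g) (e : (K ≃ₐ[k] K) ≃* DihedralGroup 4) :
    (∃ F F' : IntermediateField k K,
      IsEllipticSubfieldDegTwo F ∧ IsEllipticSubfieldDegTwo F' ∧ ¬ AreConjugate F F' ∧
      ∀ F'' : IntermediateField k K, IsEllipticSubfieldDegTwo F'' →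
        AreConjugate F F'' ∨ AreConjugate F' F'') ∧
    ∀ F F' : IntermediateField k K,
      IsEllipticSubfieldDegTwo F → IsEllipticSubfieldDegTwo F' → ¬ AreConjugate F F' →
      IsogenousOfDegree k F F' 2 := by
  have : CharZero K := charZero_of_injective_algebraMap (algebraMap k K).injective
  obtain ⟨i, hi⟩ := IsAlgClosed.exists_pow_nat_eq (-1 : k) two_pos
  have hi0 : i ≠ 0 := by rintro rfl; norm_num at hi
  have hx0 := h.ne_zero_left
  have hy0 := h.ne_zero hf.ne_zero
  obtain ⟨σ, hσx, hσy⟩ := h.exists_sigma hf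
  obtain ⟨μ, hμx, hμy⟩ := h.exists_mu hf hi
  obtain ⟨j, j', hj, hj', hjj'⟩ := h.exists_hasJInvariant_symmetric hs hs' hi hσx hσy hμx hμy
  have oι := h.orderOf_involution hf.ne_zero hx hy
  have oσ := h.orderOf_sigma hσx hσy
  have oμ := h.orderOf_mu hi hμx hμy
  have hsq : ∀ {τ : K ≃ₐ[k] K}, orderOf τ = 2 → e τ ^ 2 = 1 := fun hτ => by
    rw [← map_pow, ← hτ, pow_orderOf_eq_one, map_one]
  have hne1 : ∀ {τ : K ≃ₐ[k] K}, orderOf τ = 2 → e τ ≠ 1 := fun hτ h1 => by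
    rw [map_eq_one_iff e e.injective] at h1
    rw [h1, orderOf_one] at hτ
    omega
  have hσμ : σ * μ ≠ μ * σ := by
    intro h1
    have h2 := DFunLike.congr_fun h1 y
    rw [AlgEquiv.mul_apply, AlgEquiv.mul_apply, hσy, hμy, map_div₀, map_mul, σ.commutes, map_pow,
      hσx, hσy] at h2
    have h3 : algebraMap k K i * y / x ^ 3 ≠ 0 :=
      div_ne_zero (mul_ne_zero ((_root_.map_ne_zero _).2 hi0) hy0) (pow_ne_zero 3 hx0)
    rw [show algebraMap k K i * y / (-x) ^ 3 = -(algebraMap k K i * y / x ^ 3) by ring] at h2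
    exact h3 (self_eq_neg.1 h2.symm)
  have hσμ' : e σ * e μ ≠ e μ * e σ := by rwa [← map_mul, ← map_mul, e.injective.ne_iff]
  have hnot : ¬ AreConjugate (fixedField (Subgroup.zpowers σ))
      (fixedField (Subgroup.zpowers μ)) := by
    rintro ⟨g, hg⟩
    rw [map_fixedField_zpowers] at hg
    have h1 := fixedField_zpowers_injective oμ hg.symm
    refine DihedralGroup.not_conj_of_ne_comm _ _ (hsq oσ) (hsq oμ) hσμ' (e g) ?_
    rw [← map_inv, ← map_mul, ← map_mul, h1]
  have hclass : ∀ F'' : IntermediateField k K, IsEllipticSubfieldDegTwo F'' →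
      AreConjugate (fixedField (Subgroup.zpowers σ)) F'' ∨
        AreConjugate (fixedField (Subgroup.zpowers μ)) F'' := by
    rintro F ⟨hF, j₀, hj₀⟩
    obtain ⟨τ, oτ, rfl⟩ := exists_eq_fixedField_of_finrank_eq_two hF
    have hτι : τ ≠ ι := by
      rintro rfl
      rw [h.fixedField_involution hf (natDegree_sextic_ne_zero _ _) hx hy] at hj₀
      exact not_hasJInvariant_adjoin_simple h.transcendental _ hj₀
    rcases DihedralGroup.conj_or_conj (e ι) (hne1 oι) (fun g => by
        obtain ⟨g, rfl⟩ := e.surjective g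
        rw [← map_mul, ← map_mul, hι]) (e σ) (e μ) (e τ) (hsq oσ) (hsq oμ) hσμ' (hsq oτ)
        (hne1 oτ) (e.injective.ne hτι) with ⟨g, hg⟩ | ⟨g, hg⟩
    all_goals
      obtain ⟨g, rfl⟩ := e.surjective g
      rw [← map_inv, ← map_mul, ← map_mul, e.injective.eq_iff] at hg
    · exact Or.inl (areConjugate_fixedField hg)
    · exact Or.inr (areConjugate_fixedField hg)
  refine ⟨⟨_, _, ⟨finrank_fixedField_zpowers oσ, _, hj⟩, ⟨finrank_fixedField_zpowers oμ, _, hj'⟩,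
    hnot, hclass⟩, ?_⟩
  intro F F' hF hF' hFF'
  rcases hclass F hF with h1 | h1 <;> rcases hclass F' hF' with h2 | h2
  · exact absurd (h1.symm.trans h2) hFF'
  · exact ((h1.hasJInvariant hj).isogenousOfDegree_two_iff (h2.hasJInvariant hj')).2 hjj'
  · exact ((h1.hasJInvariant hj').isogenousOfDegree_two_iff (h2.hasJInvariant hj)).2
      (modularTwo_comm j j' ▸ hjj')
  · exact absurd (h1.symm.trans h2) hFF'

/-- If the automorphism group is dihedral of order eight, the hyperelliptic involution `ι` is
central and `σ : x ↦ -x, y ↦ y` is conjugate to `ι σ`, so that the sextic is symmetric after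
rescaling `x`. -/
theorem elliptic_subfields_of_mulEquiv_dihedralGroup_four [IsAlgClosed k] {e₁ e₂ e₃ : k}
    (h : IsHyperellipticModel (sextic s₁ s₂) x y) (hr : AreRoots s₁ s₂ e₁ e₂ e₃)
    (hs : 27 - 18 * s₁ * s₂ - s₁ ^ 2 * s₂ ^ 2 + 4 * s₁ ^ 3 + 4 * s₂ ^ 3 ≠ 0)
    (e : (K ≃ₐ[k] K) ≃* DihedralGroup 4) :
    (∃ F F' : IntermediateField k K,
      IsEllipticSubfieldDegTwo F ∧ IsEllipticSubfieldDegTwo F' ∧ ¬ AreConjugate F F' ∧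
      ∀ F'' : IntermediateField k K, IsEllipticSubfieldDegTwo F'' →
        AreConjugate F F'' ∨ AreConjugate F' F'') ∧
    ∀ F F' : IntermediateField k K,
      IsEllipticSubfieldDegTwo F → IsEllipticSubfieldDegTwo F' → ¬ AreConjugate F F' →
      IsogenousOfDegree k F F' 2 := by
  have hf := hr.squarefree_sextic
  have hd := natDegree_sextic_ne_zero s₁ s₂
  obtain ⟨ι, hx, hy⟩ := h.exists_involution hf hd
  obtain ⟨σ, hσx, hσy⟩ := h.exists_sigma hf
  have oι := h.orderOf_involution hf.ne_zero hx hy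
  have oσ := h.orderOf_sigma hσx hσy
  have hsq : ∀ {τ : K ≃ₐ[k] K}, orderOf τ = 2 → e τ ^ 2 = 1 := fun hτ => by
    rw [← map_pow, ← hτ, pow_orderOf_eq_one, map_one]
  have hne1 : ∀ {τ : K ≃ₐ[k] K}, orderOf τ = 2 → e τ ≠ 1 := fun hτ h1 => by
    rw [map_eq_one_iff e e.injective] at h1
    rw [h1, orderOf_one] at hτ
    omega
  have hσι : σ ≠ ι := by
    rintro rfl
    rw [hx] at hσx
    exact h.neg_ne_left hσx.symm
  have hcomm : ι * σ = σ * ι := h.algEquiv_ext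
    (by rw [AlgEquiv.mul_apply, AlgEquiv.mul_apply, hx, hσx, map_neg, hx])
    (by rw [AlgEquiv.mul_apply, AlgEquiv.mul_apply, hy, hσy, hy, map_neg, hσy])
  have hnot : ∀ {g τ : K ≃ₐ[k] K} {j : k}, HasJInvariant k (fixedField (Subgroup.zpowers τ)) j →
      g * ι * g⁻¹ ≠ τ := by
    intro g τ j hj hg
    have h1 := (areConjugate_fixedField hg).symm.hasJInvariant hj
    rw [h.fixedField_involution hf hd hx hy] at h1
    exact not_hasJInvariant_adjoin_simple h.transcendental _ h1
  -- otherwise the rational field `k(x)` would be conjugate to an elliptic one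
  have hcentral : ∀ g, g * ι = ι * g := by
    rcases DihedralGroup.exists_conj_or_central (e ι) (e σ) (hsq oι) (hsq oσ) (hne1 oι) (hne1 oσ)
      (e.injective.ne hσι.symm) (by rw [← map_mul, ← map_mul, hcomm]) with
        ⟨g, hg⟩ | ⟨g, hg⟩ | hg
    · obtain ⟨g, rfl⟩ := e.surjective g
      rw [← map_inv, ← map_mul, ← map_mul, e.injective.eq_iff] at hg
      exact absurd hg (hnot
        ((h.ellipticSubfieldOne_eq hσx hσy) ▸ h.hasJInvariant_ellipticSubfieldOne hr))
    · obtain ⟨g, rfl⟩ := e.surjective g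
      rw [← map_inv, ← map_mul, ← map_mul, ← map_mul, e.injective.eq_iff] at hg
      exact absurd hg (hnot ((h.ellipticSubfieldTwo_eq (σ := ι * σ)
        (by rw [AlgEquiv.mul_apply, hσx, map_neg, hx]) (by rw [AlgEquiv.mul_apply, hσy, hy])) ▸
          h.hasJInvariant_ellipticSubfieldTwo hr))
    · intro g
      have := hg (e g)
      rwa [← map_mul, ← map_mul, e.injective.eq_iff] at this
  obtain ⟨g, hg⟩ := DihedralGroup.exists_conj_eq_mul (e ι) (e σ) (fun g => by
    obtain ⟨g, rfl⟩ := e.surjective g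
    rw [← map_mul, ← map_mul, hcentral]) (hne1 oι) (hsq oσ) (hne1 oσ) (e.injective.ne hσι)
  obtain ⟨g, rfl⟩ := e.surjective g
  rw [← map_mul, ← map_mul, ← map_mul, e.injective.eq_iff] at hg
  obtain ⟨a, ha, hs₂⟩ := h.exists_symmetric hf hx hy hσx hσy (hcentral g) hg
  -- for `s₁ = s₂ = s` the discriminant is `-(s - 3)³ (s + 1)`
  have hs' : -((s₁ * a ^ 2 - 3) ^ 3 * (s₁ * a ^ 2 + 1)) ≠ 0 := by
    intro h0
    apply hs
    rw [hs₂]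
    linear_combination h0 + 4 * s₁ ^ 3 * (a ^ 6 - 1) * ha
  have h' := h.rescale ha hs₂
  have hs3 : s₁ * a ^ 2 ≠ 3 := by
    intro h0
    rw [h0] at hs'
    norm_num at hs'
  have hs1 : s₁ * a ^ 2 ≠ -1 := by
    intro h0
    rw [h0] at hs'
    norm_num at hs'
  refine h'.elliptic_subfields_of_symmetric ?_ hs3 hs1 (ι := ι) ?_ hy hcentral e
  · obtain ⟨e₁, e₂, e₃, hr'⟩ := exists_areRoots (s₁ := s₁ * a ^ 2) (s₂ := s₁ * a ^ 2) (by
      intro h0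
      apply hs'
      linear_combination h0)
    exact hr'.squarefree_sextic
  · rw [map_mul, ι.commutes, hx]

end IsHyperellipticModel

end DihedralFour

/-! ### Centrality of the hyperelliptic involution -/

section Centrality

open Polynomial IntermediateField
open WeierstrassCurve.Affine (Point)

variable {k K : Type*} [Field k] [Field K] [Algebra k K] [CharZero k] [IsAlgClosed k]
  {e₁ e₂ e₃ : k} {f : k[X]} {x y A B : K} {ι g : K ≃ₐ[k] K}

namespace IsHyperellipticModel

open scoped Classical in
/-- If a point is negated by the hyperelliptic involution `ι`, then for a conjugate `ι'` of `ι` the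
product `ι ι'` acts on it as the translation by a constant point. -/
theorem exists_map_eq_add (h : IsHyperellipticModel f x y) (hf : Squarefree f)
    (hd : f.natDegree ≠ 0) (hx : ι x = x) (hy : ι y = -y) (he : AreDistinct e₁ e₂ e₃)
    (hAB : ((rootCurve e₁ e₂ e₃).baseChange K).toAffine.Nonsingular A B)
    (hA : ι A = A) (hB : ι B = -B) (g : K ≃ₐ[k] K) :
    ∃ P : ((rootCurve e₁ e₂ e₃).baseChange k).toAffine.Point,
      Point.map ((ι * (g * ι * g⁻¹) : K ≃ₐ[k] K) : K →ₐ[k] K) (Point.some A B hAB) =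
        Point.some A B hAB + Point.map (Algebra.ofId k K) P := by
  have hgx : (g * ι * g⁻¹) (g x) = g x := by
    change g (ι (g.symm (g x))) = g x
    rw [g.symm_apply_apply, hx]
  have hgy : (g * ι * g⁻¹) (g y) = -g y := by
    change g (ι (g.symm (g y))) = -g y
    rw [g.symm_apply_apply, hy, map_neg]
  obtain ⟨P, hP⟩ := (h.map_algEquiv g).exists_add_map_eq he hf hd hgx hgy (Point.some A B hAB)
  have hι : Point.map (ι : K →ₐ[k] K) (Point.some A B hAB) = -Point.some A B hAB := by
    rw [Point.neg_some, Point.map_some]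
    simp only [Point.some.injEq, WeierstrassCurve.Affine.negY, baseChange_rootCurve_a₁,
      baseChange_rootCurve_a₃, zero_mul, sub_zero]
    exact ⟨hA, hB⟩
  refine ⟨P, ?_⟩
  have hcomp : ((ι * (g * ι * g⁻¹) : K ≃ₐ[k] K) : K →ₐ[k] K) =
      (ι : K →ₐ[k] K).comp ((g * ι * g⁻¹ : K ≃ₐ[k] K) : K →ₐ[k] K) := rfl
  rw [hcomp, ← Point.map_map, eq_sub_of_add_eq' hP, map_sub, hι, Point.map_map,
    Subsingleton.elim ((ι : K →ₐ[k] K).comp (Algebra.ofId k K)) (Algebra.ofId k K)]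
  abel

/-- The abscissa of the translated point is fixed by whatever fixes the point. -/
theorem apply_conj_apply_eq (h : IsHyperellipticModel f x y) (hf : Squarefree f)
    (hd : f.natDegree ≠ 0) (hx : ι x = x) (hy : ι y = -y) (he : AreDistinct e₁ e₂ e₃)
    (hAB : B ^ 2 = aeval A (rootCubic e₁ e₂ e₃))
    (hA : ι A = A) (hB : ι B = -B) (g : K ≃ₐ[k] K) {τ : K ≃ₐ[k] K} (hτA : τ A = A)
    (hτB : τ B = B) :
    τ ((ι * (g * ι * g⁻¹)) A) = (ι * (g * ι * g⁻¹)) A := by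
  classical
  obtain ⟨P, hP⟩ := h.exists_map_eq_add hf hd hx hy he (he.nonsingular hAB) hA hB g
  have hτ : Point.map (τ : K →ₐ[k] K) (Point.some A B (he.nonsingular hAB)) =
      Point.some A B (he.nonsingular hAB) := by
    rw [Point.map_some]
    simp only [Point.some.injEq]
    exact ⟨hτA, hτB⟩
  have h1 := congrArg (Point.map (τ : K →ₐ[k] K)) hP
  rw [map_add, hτ, Point.map_map, Point.map_map,
    Subsingleton.elim ((τ : K →ₐ[k] K).comp (Algebra.ofId k K)) (Algebra.ofId k K), ← hP,
    Point.map_some, Point.map_some] at h1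
  simp only [Point.some.injEq] at h1
  exact h1.1

/-- If `ρ = ι ι'` has order dividing three, then it translates by a `3`-torsion point; if moreover
the translated abscissa is invariant under `ι`, the point is `2`-torsion as well, hence zero. -/
theorem conj_apply_eq_self (h : IsHyperellipticModel f x y) (hf : Squarefree f)
    (hd : f.natDegree ≠ 0) (hx : ι x = x) (hy : ι y = -y) (he : AreDistinct e₁ e₂ e₃)
    (hAB : B ^ 2 = aeval A (rootCubic e₁ e₂ e₃)) (hB0 : B ≠ 0)
    (hA : ι A = A) (hB : ι B = -B) (hρ : (ι * (g * ι * g⁻¹)) ^ 3 = 1)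
    (hfix : ι ((ι * (g * ι * g⁻¹)) A) = (ι * (g * ι * g⁻¹)) A) :
    (ι * (g * ι * g⁻¹)) A = A ∧ (ι * (g * ι * g⁻¹)) B = B := by
  classical
  have : CharZero K := charZero_of_injective_algebraMap (algebraMap k K).injective
  have hn := he.nonsingular hAB
  obtain ⟨P, hP⟩ := h.exists_map_eq_add hf hd hx hy he hn hA hB g
  generalize ι * (g * ι * g⁻¹) = ρ at hρ hfix hP
  have hconst : ∀ τ : K ≃ₐ[k] K, Point.map (τ : K →ₐ[k] K) (Point.map (Algebra.ofId k K) P) =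
      Point.map (Algebra.ofId k K) P := fun τ => by
    rw [Point.map_map, Subsingleton.elim ((τ : K →ₐ[k] K).comp (Algebra.ofId k K))
      (Algebra.ofId k K)]
  have hι : Point.map (ι : K →ₐ[k] K) (Point.some A B hn) = -Point.some A B hn := by
    rw [Point.neg_some, Point.map_some]
    simp only [Point.some.injEq, WeierstrassCurve.Affine.negY, baseChange_rootCurve_a₁,
      baseChange_rootCurve_a₃, zero_mul, sub_zero]
    exact ⟨hA, hB⟩
  obtain ⟨T, hT⟩ : ∃ T, T = Point.map (Algebra.ofId k K) P := ⟨_, rfl⟩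
  rw [← hT] at hconst hP
  have h3 : T + T + T = 0 := by
    have h1 : Point.map (ρ : K →ₐ[k] K) (Point.map (ρ : K →ₐ[k] K)
        (Point.map (ρ : K →ₐ[k] K) (Point.some A B hn))) = Point.some A B hn := by
      rw [Point.map_map, Point.map_map]
      have : ((ρ : K →ₐ[k] K).comp (ρ : K →ₐ[k] K)).comp (ρ : K →ₐ[k] K) = AlgHom.id k K := by
        ext z
        have := DFunLike.congr_fun hρ z
        rwa [pow_succ, pow_two] at this
      rw [this, Point.map_some]
      rfl
    simp only [hP, map_add, hconst] at h1
    rw [add_assoc, add_assoc] at h1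
    rw [add_assoc]
    exact left_eq_add.1 h1.symm
  have h2 : T + T = 0 := by
    have hS := congrArg (Point.map (ι : K →ₐ[k] K)) hP
    have hn' := (he.nonsingular (show (ρ B) ^ 2 = aeval (ρ A) (rootCubic e₁ e₂ e₃) by
      rw [← map_pow, hAB]; exact (aeval_algHom_apply (ρ : K →ₐ[k] K) A _).symm))
    have hS1 : Point.map (ρ : K →ₐ[k] K) (Point.some A B hn) = Point.some (ρ A) (ρ B) hn' := rfl
    have hcases : Point.map (ι : K →ₐ[k] K) (Point.some (ρ A) (ρ B) hn') =
        Point.some (ρ A) (ρ B) hn' ∨ Point.map (ι : K →ₐ[k] K) (Point.some (ρ A) (ρ B) hn') =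
        -Point.some (ρ A) (ρ B) hn' := by
      have hsq : (ι (ρ B)) ^ 2 = (ρ B) ^ 2 := by
        rw [baseChange_rootCurve_equation.1 hn'.1, ← map_pow,
          baseChange_rootCurve_equation.1 hn'.1]
        exact (aeval_algHom_apply (ι : K →ₐ[k] K) (ρ A) _).symm.trans (by
          change aeval (ι (ρ A)) _ = _
          rw [hfix])
      rw [Point.neg_some, Point.map_some]
      simp only [Point.some.injEq, WeierstrassCurve.Affine.negY, baseChange_rootCurve_a₁,
        baseChange_rootCurve_a₃, zero_mul, sub_zero]
      exact (sq_eq_sq_iff_eq_or_eq_neg.1 hsq).imp (fun h => ⟨hfix, h⟩) (fun h => ⟨hfix, h⟩)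
    rw [map_add, hι, hconst, hS1] at hS
    rw [hS1] at hP
    rcases hcases with hc | hc
    · exfalso
      rw [hS, hP] at hc
      have h4 := add_right_cancel hc
      rw [Point.neg_some] at h4
      simp only [Point.some.injEq, WeierstrassCurve.Affine.negY, baseChange_rootCurve_a₁,
        baseChange_rootCurve_a₃, zero_mul, sub_zero] at h4
      exact hB0 (self_eq_neg.1 h4.2.symm)
    · rw [hS, hP, neg_add] at hc
      have h4 := add_left_cancel hc
      rw [eq_neg_iff_add_eq_zero] at h4
      exact h4
  rw [h2, zero_add] at h3
  rw [h3, add_zero, Point.map_some] at hP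
  simp only [Point.some.injEq] at hP
  exact hP

/-- A product `ρ = ι ι'` of the hyperelliptic involution and a conjugate cannot have order three.
The generic points of the two elliptic subfields have abscissas `x²` and `x⁻²` and are fixed by
`σ : x ↦ -x, y ↦ y` and by `ι σ`, respectively. Hence `ρ(x²)` is fixed by `σ` and `ι σ`, therefore
by `ι`, and both translation points vanish. -/
theorem conj_eq_one_of_pow_three {s₁ s₂ : k} (h : IsHyperellipticModel (sextic s₁ s₂) x y)
    (hr : AreRoots s₁ s₂ e₁ e₂ e₃) (hx : ι x = x) (hy : ι y = -y)
    (hρ : (ι * (g * ι * g⁻¹)) ^ 3 = 1) : ι * (g * ι * g⁻¹) = 1 := by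
  have hf := hr.squarefree_sextic
  have hd := natDegree_sextic_ne_zero s₁ s₂
  obtain ⟨σ, hσx, hσy⟩ := h.exists_sigma hf
  obtain ⟨i, hi⟩ := IsAlgClosed.exists_pow_nat_eq (-1 : k) two_pos
  have hi0 : i ≠ 0 := by rintro rfl; norm_num at hi
  have hi' : algebraMap k K i ≠ 0 := (_root_.map_ne_zero _).2 hi0
  have hi2 : algebraMap k K i ^ 2 = -1 := by rw [← map_pow, hi, map_neg, map_one]
  have hx0 := h.ne_zero_left
  have hy0 : y ≠ 0 := h.ne_zero hf.ne_zero
  -- the generic points of the two elliptic subfields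
  have E1 : y ^ 2 = aeval (x ^ 2) (rootCubic e₁ e₂ e₃) := by
    rw [hr.rootCubic_eq, h.equation_sextic]
    simp only [map_sub, map_add, map_mul, map_pow, aeval_X, aeval_C, map_one]
    ring
  have E2 : (algebraMap k K i * y / x ^ 3) ^ 2 =
      aeval ((x ^ 2)⁻¹) (rootCubic (e₂ * e₃) (e₁ * e₃) (e₁ * e₂)) := by
    rw [hr.inv.rootCubic_eq, div_pow, mul_pow, h.equation_sextic, hi2]
    simp only [map_sub, map_add, map_mul, map_pow, aeval_X, aeval_C, map_one]
    field_simp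
    ring
  have hι1 : ι (x ^ 2) = x ^ 2 := by rw [map_pow, hx]
  have hι2 : ι ((x ^ 2)⁻¹) = (x ^ 2)⁻¹ := by rw [map_inv₀, hι1]
  have hι3 : ι (algebraMap k K i * y / x ^ 3) = -(algebraMap k K i * y / x ^ 3) := by
    rw [map_div₀, map_mul, ι.commutes, hy, map_pow, hx]; ring
  have F1 := h.apply_conj_apply_eq hf hd hx hy hr.distinct E1 hι1 hy g (τ := σ)
    (by rw [map_pow, hσx, neg_sq]) hσy
  have F2 := h.apply_conj_apply_eq hf hd hx hy hr.inv.distinct E2 hι2 hι3 g (τ := ι * σ)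
    (by rw [AlgEquiv.mul_apply, map_inv₀, map_pow, hσx, neg_sq, hι2])
    (by
      rw [AlgEquiv.mul_apply, map_div₀, map_mul, σ.commutes, hσy, map_pow, hσx, map_div₀, map_mul,
        ι.commutes, hy, map_pow, map_neg, hx]
      ring)
  have F3 : ι ((ι * (g * ι * g⁻¹)) (x ^ 2)) = (ι * (g * ι * g⁻¹)) (x ^ 2) := by
    rw [map_inv₀, map_inv₀, inv_inj, AlgEquiv.mul_apply ι σ, F1] at F2
    exact F2
  obtain ⟨G1, G2⟩ := h.conj_apply_eq_self hf hd hx hy hr.distinct E1 hy0 hι1 hy hρ F3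
  obtain ⟨-, G3⟩ := h.conj_apply_eq_self hf hd hx hy hr.inv.distinct E2
    (div_ne_zero (mul_ne_zero hi' hy0) (pow_ne_zero 3 hx0)) hι2 hι3 hρ
    (by rw [map_inv₀, map_inv₀, F3])
  generalize ι * (g * ι * g⁻¹) = ρ at G1 G2 G3
  refine h.algEquiv_ext ?_ G2
  change ρ x = x
  rw [map_div₀, map_mul, ρ.commutes, G2, div_eq_mul_inv, div_eq_mul_inv] at G3
  replace G3 := inv_injective (mul_left_cancel₀ (mul_ne_zero hi' hy0) G3)
  rw [map_pow] at G1 G3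
  have hx2 : x ^ 2 ≠ 0 := pow_ne_zero 2 hx0
  apply mul_right_cancel₀ hx2
  linear_combination G3 - ρ x * G1

end IsHyperellipticModel

end Centrality

/-! ### Dihedral automorphism group of order twelve -/

section DihedralSix

open Polynomial IntermediateField
open WeierstrassCurve.Affine (Point)

/-- In the dihedral group of order twelve, a noncentral involution has a conjugate such that their
product has order three. -/
theorem DihedralGroup.exists_conj_mul_pow_three : ∀ a : DihedralGroup 6, a ^ 2 = 1 →
    (∃ g, g * a * g⁻¹ ≠ a) → ∃ g, (a * (g * a * g⁻¹)) ^ 3 = 1 ∧ a * (g * a * g⁻¹) ≠ 1 := by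
  decide

/-- In the dihedral group of order twelve, a noncentral involution inverts an element of order
three. -/
theorem DihedralGroup.exists_inverted_pow_three : ∀ a : DihedralGroup 6, a ≠ 1 →
    (∀ g, g * a = a * g) → ∀ b : DihedralGroup 6, b ^ 2 = 1 → b ≠ 1 → b ≠ a →
      ∃ ρ, ρ ≠ 1 ∧ ρ ^ 3 = 1 ∧ ρ * b * ρ = b := by
  decide

/-- Comparing the odd coefficients of a sextic form invariant under `t ↦ (t + b) / (1 + c t)`. -/
theorem eq_zero_of_sextic_invariant {k : Type*} [Field k] [CharZero k] {s₁ s₂ b c r : k}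
    (hbc : b * c = -3)
    (hP : ∀ t : k, (t + b) ^ 6 - s₁ * (t + b) ^ 4 * (c * t + 1) ^ 2 +
        s₂ * (t + b) ^ 2 * (c * t + 1) ^ 4 - (c * t + 1) ^ 6 =
          r * (t ^ 6 - s₁ * t ^ 4 + s₂ * t ^ 2 - 1)) :
    4 * (s₁ ^ 3 + s₂ ^ 3) - (s₁ * s₂) ^ 2 + 110 * (s₁ * s₂) - 1125 = 0 := by
  have hb : b ≠ 0 := by
    rintro rfl
    norm_num at hbc
  -- interpolation of the coefficients of `t` and of `t⁵` from the values at `±1, ±2, ±3`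
  have h1 : 6 * b ^ 5 - s₁ * (4 * b ^ 3 + 2 * c * b ^ 4) + s₂ * (2 * b + 4 * c * b ^ 2) - 6 * c
      = 0 := by
    have h60 : (60 : k) ≠ 0 := by norm_num
    apply mul_left_cancel₀ h60
    linear_combination 45 * (hP 1 - hP (-1)) - 9 * (hP 2 - hP (-2)) + (hP 3 - hP (-3))
  have h5 : 6 * b - s₁ * (4 * b * c ^ 2 + 2 * c) + s₂ * (2 * b * c ^ 4 + 4 * c ^ 3) - 6 * c ^ 5
      = 0 := by
    have h240 : (240 : k) ≠ 0 := by norm_num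
    apply mul_left_cancel₀ h240
    linear_combination 5 * (hP 1 - hP (-1)) - 4 * (hP 2 - hP (-2)) + (hP 3 - hP (-3))
  have h1' : 3 * b ^ 6 + s₁ * b ^ 4 - 5 * (s₂ * b ^ 2) + 9 = 0 := by
    linear_combination (b * h1 - (-2 * s₁ * b ^ 4 + 4 * s₂ * b ^ 2 - 6) * hbc) / 2
  have h5' : b ^ 6 - 5 * (s₁ * b ^ 4) + 9 * (s₂ * b ^ 2) + 243 = 0 := by
    have h6 : 6 * b ^ 6 - s₁ * b ^ 4 * (4 * (b * c) ^ 2 + 2 * (b * c)) +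
        s₂ * b ^ 2 * (2 * (b * c) ^ 4 + 4 * (b * c) ^ 3) - 6 * (b * c) ^ 5 = 0 := by
      linear_combination b ^ 5 * h5
    rw [hbc] at h6
    linear_combination h6 / 6
  have g1 : s₁ * b ^ 4 = 2 * b ^ 6 + 81 := by
    linear_combination (-9 * h1' - 5 * h5') / 16
  have g2 : s₂ * b ^ 2 = b ^ 6 + 18 := by
    linear_combination (-5 * h1' - h5') / 16
  rw [← eq_div_iff (pow_ne_zero _ hb)] at g1 g2
  rw [g1, g2]
  field_simp
  ring

namespace IsHyperellipticModel

variable {k K : Type*} [Field k] [Field K] [Algebra k K] [CharZero k] {s₁ s₂ : k} {x y : K}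

/-- An automorphism `ρ` of order three that is inverted by `σ : x ↦ -x` acts by
`x ↦ (x + b) / (1 + c x)` with `b c = -3`. -/
theorem exists_moebius_of_pow_three (h : IsHyperellipticModel (sextic s₁ s₂) x y)
    (hf : Squarefree (sextic s₁ s₂)) {ι σ ρ : K ≃ₐ[k] K} (hx : ι x = x) (hy : ι y = -y)
    (hσx : σ x = -x) (hρι : ρ * ι = ι * ρ) (hρσ : ρ * σ * ρ = σ) (hρ : ρ ^ 3 = 1) (hρ1 : ρ ≠ 1) :
    ∃ b c r : k, b * c = -3 ∧
      ∀ t : k, (t + b) ^ 6 - s₁ * (t + b) ^ 4 * (c * t + 1) ^ 2 +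
        s₂ * (t + b) ^ 2 * (c * t + 1) ^ 4 - (c * t + 1) ^ 6 =
          r * (t ^ 6 - s₁ * t ^ 4 + s₂ * t ^ 2 - 1) := by
  have : CharZero K := charZero_of_injective_algebraMap (algebraMap k K).injective
  obtain ⟨a, b, c, d, r, hne, -, hm, -, hP⟩ := h.exists_moebius hf hx hy hρι
  have hx0 := h.ne_zero_left
  have hcube : ∀ z, ρ (ρ (ρ z)) = z := fun z => by
    have := DFunLike.congr_fun hρ z
    rwa [pow_succ, pow_two] at this
  have hρx : ρ x ≠ 0 := (map_ne_zero_iff ρ ρ.injective).2 hx0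
  -- the relation `ρ σ ρ = σ` applied to `x`
  have h1 : ρ (σ (ρ x)) = -x := by
    have := DFunLike.congr_fun hρσ x
    rwa [hσx] at this
  have h2 := congrArg (fun z => ρ (σ z)) hm
  simp only [map_mul, map_add, AlgEquiv.commutes, hσx, map_neg, h1] at h2
  obtain ⟨k1, k2, k3⟩ := h.transcendental.eq_zero_of_quadratic
    (p := c * (a - d)) (q := (a - d) * (a + d)) (r := b * (a - d)) (by
      simp only [map_mul, map_add, map_sub]
      linear_combination (algebraMap k K c * x + algebraMap k K d) * h2 +
        (-algebraMap k K a - algebraMap k K c * x) * hm)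
  by_cases had : a = d
  -- the relation `ρ³ = 1` applied to `x` gives `3 a² + b c = 0` unless `ρ` fixes `x`
  · subst had
    have hm2 := congrArg ρ hm
    have hm3 := congrArg ρ hm2
    simp only [map_mul, map_add, AlgEquiv.commutes, hcube] at hm2 hm3
    have hne2 : algebraMap k K c * ρ x + algebraMap k K a ≠ 0 := by
      have := (map_ne_zero_iff ρ ρ.injective).2 hne
      simpa only [map_mul, map_add, AlgEquiv.commutes] using this
    obtain ⟨l1, -, l3⟩ := h.transcendental.eq_zero_of_quadratic
      (p := c * (3 * a ^ 2 + b * c)) (q := 0) (r := -(b * (3 * a ^ 2 + b * c))) (by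
        simp only [map_mul, map_add, map_neg, map_zero, map_pow, map_ofNat]
        linear_combination (algebraMap k K c * x + algebraMap k K a) *
          ((algebraMap k K c * ρ x + algebraMap k K a) * hm3 -
            (x * algebraMap k K c - algebraMap k K a) * hm2) -
          ((x * algebraMap k K c - algebraMap k K a) * algebraMap k K a +
            (x * algebraMap k K a - algebraMap k K b) * algebraMap k K c) * hm)
    by_cases hW : 3 * a ^ 2 + b * c = 0
    · have ha : a ≠ 0 := by
        rintro rfl
        have hbc : b * c = 0 := by linear_combination hW
        rcases mul_eq_zero.1 hbc with rfl | rfl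
        · simp only [map_zero, add_zero, zero_mul] at hm hne
          exact mul_ne_zero hρx hne hm
        · simp at hne
      refine ⟨b / a, c / a, r ^ 2 / a ^ 6, ?_, fun t => ?_⟩
      · field_simp
        linear_combination hW
      · field_simp
        linear_combination hP t
    · exfalso
      obtain rfl := (mul_eq_zero.1 l1).resolve_right hW
      obtain rfl := (mul_eq_zero.1 (neg_eq_zero.1 l3)).resolve_right hW
      simp only [map_zero, zero_mul, zero_add, add_zero] at hm hne
      have hρx' : ρ x = x := mul_right_cancel₀ hne (by rw [hm, mul_comm])
      have hy2 : (ρ y) ^ 2 = y ^ 2 := by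
        rw [← map_pow, h.equation]
        refine (aeval_algHom_apply (ρ : K →ₐ[k] K) x _).symm.trans ?_
        change aeval (ρ x) _ = _
        rw [hρx']
      rcases sq_eq_sq_iff_eq_or_eq_neg.1 hy2 with hy' | hy'
      · exact hρ1 (h.algEquiv_ext hρx' hy')
      · have := hcube y
        rw [hy', map_neg, hy', map_neg, map_neg, hy', neg_neg] at this
        exact h.ne_zero hf.ne_zero (self_eq_neg.1 this.symm)
  -- otherwise `ρ x = -x`, which contradicts `ρ³ = 1`
  · exfalso
    have had' := _root_.sub_ne_zero.2 had
    obtain rfl := (mul_eq_zero.1 k1).resolve_right had'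
    obtain rfl := (mul_eq_zero.1 k3).resolve_right had'
    have k4 := (mul_eq_zero.1 k2).resolve_left had'
    obtain rfl : a = -d := eq_neg_of_add_eq_zero_left k4
    simp only [map_zero, zero_mul, zero_add, add_zero, map_neg] at hm hne
    have hρx' : ρ x = -x := mul_right_cancel₀ hne (by rw [hm]; ring)
    have := hcube x
    rw [hρx', map_neg, hρx', map_neg, map_neg, hρx', neg_neg] at this
    exact h.neg_ne_left this

variable [IsAlgClosed k] {e₁ e₂ e₃ : k}

/-- If the automorphism group is dihedral of order twelve, the hyperelliptic involution is central,
and `σ : x ↦ -x, y ↦ y` inverts an automorphism of order three. The invariance of the sextic under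
the latter is the asserted relation. -/
theorem eq_zero_of_mulEquiv_dihedralGroup_six (h : IsHyperellipticModel (sextic s₁ s₂) x y)
    (hr : AreRoots s₁ s₂ e₁ e₂ e₃) (e : (K ≃ₐ[k] K) ≃* DihedralGroup 6) :
    4 * (s₁ ^ 3 + s₂ ^ 3) - (s₁ * s₂) ^ 2 + 110 * (s₁ * s₂) - 1125 = 0 := by
  have hf := hr.squarefree_sextic
  have hd := natDegree_sextic_ne_zero s₁ s₂
  obtain ⟨ι, hx, hy⟩ := h.exists_involution hf hd
  obtain ⟨σ, hσx, hσy⟩ := h.exists_sigma hf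
  have hι := h.orderOf_involution hf.ne_zero hx hy
  have hσ := h.orderOf_sigma hσx hσy
  have hι2 : ι ^ 2 = 1 := hι ▸ pow_orderOf_eq_one ι
  have hσ2 : σ ^ 2 = 1 := hσ ▸ pow_orderOf_eq_one σ
  have hι1 : ι ≠ 1 := by rintro rfl; simp at hι
  have hσ1 : σ ≠ 1 := by rintro rfl; simp at hσ
  have hσι : σ ≠ ι := by
    rintro rfl
    rw [hx] at hσx
    exact h.neg_ne_left hσx.symm
  have hcentral : ∀ g, g * ι * g⁻¹ = ι := by
    by_contra! hne
    obtain ⟨g, hg⟩ := hne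
    obtain ⟨g', h3, h1⟩ := DihedralGroup.exists_conj_mul_pow_three (e ι)
      (by rw [← map_pow, hι2, map_one]) ⟨e g, by
        rwa [← map_inv, ← map_mul, ← map_mul, e.injective.ne_iff]⟩
    obtain ⟨g', rfl⟩ := e.surjective g'
    rw [← map_inv, ← map_mul, ← map_mul, ← map_mul] at h3 h1
    rw [← map_pow, map_eq_one_iff e e.injective] at h3
    rw [Ne, map_eq_one_iff e e.injective] at h1
    exact h1 (h.conj_eq_one_of_pow_three hr hx hy h3)
  have hcomm : ∀ g, g * ι = ι * g := fun g => mul_inv_eq_iff_eq_mul.1 (hcentral g)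
  obtain ⟨ρ, hρ1, hρ3, hρσ⟩ := DihedralGroup.exists_inverted_pow_three (e ι)
    (by rwa [Ne, map_eq_one_iff e e.injective])
    (fun g => by
      obtain ⟨g, rfl⟩ := e.surjective g
      rw [← map_mul, ← map_mul, hcomm]) (e σ) (by rw [← map_pow, hσ2, map_one])
    (by rwa [Ne, map_eq_one_iff e e.injective]) (e.injective.ne hσι)
  obtain ⟨ρ, rfl⟩ := e.surjective ρ
  rw [← map_mul, ← map_mul, e.injective.eq_iff] at hρσ
  rw [← map_pow, map_eq_one_iff e e.injective] at hρ3
  rw [Ne, map_eq_one_iff e e.injective] at hρ1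
  obtain ⟨b, c, r, hbc, hP⟩ :=
    h.exists_moebius_of_pow_three hf hx hy hσx (hcomm ρ) hρσ hρ3 hρ1
  exact eq_zero_of_sextic_invariant hbc hP

end IsHyperellipticModel

end DihedralSix

theorem mainTheorem10 {k K : Type*} [Field k] [IsAlgClosed k] [CharZero k] [Field K] [Algebra k K]
    (s₁ s₂ u v : k) (hu : u = s₁ * s₂) (hv : v = s₁ ^ 3 + s₂ ^ 3)
    (hs : 27 - 18 * s₁ * s₂ - s₁ ^ 2 * s₂ ^ 2 + 4 * s₁ ^ 3 + 4 * s₂ ^ 3 ≠ 0)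
    -- `K = k(X, Y)` is the function field of `Y² = X⁶ - s₁ X⁴ + s₂ X² - 1`
    (X Y : K) (hX : Transcendental k X) (hgen : IntermediateField.adjoin k {X, Y} = ⊤)
    (hXY : Y ^ 2 = X ^ 6 - algebraMap k K s₁ * X ^ 4 + algebraMap k K s₂ * X ^ 2 - 1) :
    -- `E₁` and `E₂` are elliptic subfields of degree 2
    IsEllipticSubfieldDegTwo (ellipticSubfieldOne k X Y) ∧
    IsEllipticSubfieldDegTwo (ellipticSubfieldTwo k X Y) ∧
    -- the `j`-invariants are the roots (with multiplicity) of the quadratic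
    (∀ j₁ j₂ : k, HasJInvariant k (ellipticSubfieldOne k X Y) j₁ →
      HasJInvariant k (ellipticSubfieldTwo k X Y) j₂ →
      (∀ j : k,
        j ^ 2 + 256 * ((2 * u ^ 3 - 54 * u ^ 2 + 9 * u * v - v ^ 2 + 27 * v) /
            (u ^ 2 + 18 * u - 4 * v - 27)) * j +
          65536 * ((u ^ 2 + 9 * u - 3 * v) ^ 3 / (u ^ 2 + 18 * u - 4 * v - 27) ^ 2) =
        (j - j₁) * (j - j₂)) ∧
      (j₁ = j₂ ↔ (v ^ 2 - 4 * u ^ 3) * (v - 9 * u + 27) = 0)) ∧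
    -- isomorphic elliptic subcovers
    (Nonempty (ellipticSubfieldOne k X Y ≃ₐ[k] ellipticSubfieldTwo k X Y) ↔
      (v ^ 2 - 4 * u ^ 3) * (v - 9 * u + 27) = 0) ∧
    -- 3-isogenies
    (IsogenousOfDegree k (ellipticSubfieldOne k X Y) (ellipticSubfieldTwo k X Y) 3 ↔
      (4 * v - u ^ 2 + 110 * u - 1125) * gOne u v * gTwo u v = 0) ∧
    (Nonempty ((K ≃ₐ[k] K) ≃* DihedralGroup 6) →
      4 * v - u ^ 2 + 110 * u - 1125 = 0 ∧
      IsogenousOfDegree k (ellipticSubfieldOne k X Y) (ellipticSubfieldTwo k X Y) 3) ∧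
    -- 2-isogenies
    (IsogenousOfDegree k (ellipticSubfieldOne k X Y) (ellipticSubfieldTwo k X Y) 2 ↔
      fOne u v * fTwo u v = 0) ∧
    -- automorphism group dihedral of order 8: there are exactly two conjugacy classes of elliptic
    -- subfields of degree 2, and non-conjugate ones are 2-isogenous
    (Nonempty ((K ≃ₐ[k] K) ≃* DihedralGroup 4) →
      (∃ F F' : IntermediateField k K,
        IsEllipticSubfieldDegTwo F ∧ IsEllipticSubfieldDegTwo F' ∧ ¬ AreConjugate F F' ∧
        ∀ F'' : IntermediateField k K, IsEllipticSubfieldDegTwo F'' →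
          AreConjugate F F'' ∨ AreConjugate F' F'') ∧
      ∀ F F' : IntermediateField k K,
        IsEllipticSubfieldDegTwo F → IsEllipticSubfieldDegTwo F' → ¬ AreConjugate F F' →
        IsogenousOfDegree k F F' 2) := by
  have hK : IsHyperellipticModel (sextic s₁ s₂) X Y := ⟨hX, by rw [aeval_sextic]; exact hXY, hgen⟩
  obtain ⟨e₁, e₂, e₃, hr⟩ := exists_areRoots hs
  have hD : u ^ 2 + 18 * u - 4 * v - 27 ≠ 0 := by
    intro h
    apply hs
    rw [hu, hv] at h
    linear_combination -h
  have hJ1 : HasJInvariant k (ellipticSubfieldOne k X Y) (subcoverJ s₁ s₂) :=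
    hr.rootJ_eq ▸ hK.hasJInvariant_ellipticSubfieldOne hr
  have hJ2 : HasJInvariant k (ellipticSubfieldTwo k X Y) (subcoverJ s₂ s₁) :=
    hr.inv.rootJ_eq ▸ hK.hasJInvariant_ellipticSubfieldTwo hr
  have h3 := hJ1.isogenousOfDegree_three_iff hJ2
  rw [modularThree_subcoverJ_eq_zero_iff hu hv hD] at h3
  have h2 := hJ1.isogenousOfDegree_two_iff hJ2
  rw [modularTwo_subcoverJ_eq_zero_iff hu hv hD] at h2
  refine ⟨⟨hK.finrank_ellipticSubfieldOne hr.squarefree_sextic, _, hJ1⟩,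
    ⟨hK.finrank_ellipticSubfieldTwo hr.squarefree_sextic, _, hJ2⟩, ?_, ?_, h3, ?_, h2, ?_⟩
  · intro j₁ j₂ h₁ h₂
    obtain rfl := h₁.eq hJ1
    obtain rfl := h₂.eq hJ2
    refine ⟨fun j => ?_, subcoverJ_eq_iff hu hv hD⟩
    linear_combination j * subcoverJ_add hu hv - subcoverJ_mul hu hv
  · rw [hJ1.nonempty_algEquiv_iff hJ2, subcoverJ_eq_iff hu hv hD]
  · rintro ⟨e⟩
    have h := hK.eq_zero_of_mulEquiv_dihedralGroup_six hr e
    rw [← hu, ← hv] at h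
    exact ⟨h, h3.2 (by rw [h]; ring)⟩
  · rintro ⟨e⟩
    exact hK.elliptic_subfields_of_mulEquiv_dihedralGroup_four hr hs e
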